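/- \textbf{Theorem (Spherical Green Formulas II).} Let $\Omega\subset\mathbb{R}^3$ be the unit sphere with surface element $d\omega$, and let $\nabla^*$, $\mathrm{L}^*_\xi=\xi\wedge\nabla^*_\xi$ and $\Delta^*$ denote the surface gradient, the surface curl gradient and the Beltrami operator on $\Omega$. Let $\Gamma\subset\Omega$ be a regular region, i.e. an open subset of $\Omega$ with boundary of class $\mathrm{C}^{(2)}$: every $\xi\in\partial\Gamma$ has a neighbourhood in $\Omega$ on which $\Gamma$ coincides with $\{\varphi<0\}$ for a $\mathrm{C}^{(2)}$ function $\varphi$ with $\nabla^*\varphi(\xi)\neq 0$ (connectedness is not required). Let $d\sigma$ be the line element on $\partial\Gamma$, let $\nu$ be the outward unit normal on $\partial\Gamma$ (tangential to $\Omega$), and $\frac{\partial}{\partial\nu}F=\nu\cdot\nabla^*F$. Put $$G(\Delta^*;t)=\frac{1}{4\pi}\ln(1-t)+\frac{1}{4\pi}(1-\ln 2),\qquad t\in[-1,1),$$ and let $\alpha(\xi)=2\pi$ for $\xi\in\Gamma$, $\alpha(\xi)=\pi$ for $\xi\in\partial\Gamma$, and $\alpha(\xi)=0$ for $\xi\in\Omega\setminus\overline{\Gamma}$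 (where the left-hand sides below are read as $0$). (a) If $F$ is of class $\mathrm{C}^{(2)}(\overline{\Gamma})$, then for every $\xi\in\Omega$ $$\frac{\alpha(\xi)}{2\pi}F(\xi)=\frac{1}{4\pi}\int_\Gamma F(\eta)\,d\omega(\eta)+\int_\Gamma G(\Delta^*;\xi\cdot\eta)\,\Delta^*_\eta F(\eta)\,d\omega(\eta)+\int_{\partial\Gamma}F(\eta)\frac{\partial}{\partial\nu(\eta)}G(\Delta^*;\xi\cdot\eta)\,d\sigma(\eta)-\int_{\partial\Gamma}G(\Delta^*;\xi\cdot\eta)\frac{\partial}{\partial\nu(\eta)}F(\eta)\,d\sigma(\eta).$$ (b) If $F$ is of class $\mathrm{C}^{(1)}(\overline{\Gamma})$, then for every $\xi\in\Omega$ $$\frac{\alpha(\xi)}{2\pi}F(\xi)=\frac{1}{4\pi}\int_\Gamma F(\eta)\,d\omega(\eta)-\int_\Gamma \nabla^*_\eta G(\Delta^*;\xi\cdot\eta)\cdot\nabla^*_\eta F(\eta)\,d\omega(\eta)+\int_{\partial\Gamma}F(\eta)\frac{\partial}{\partial\nu(\eta)}G(\Delta^*;\xi\cdot\eta)\,d\sigma(\eta)$$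 $$=\frac{1}{4\pi}\int_\Gamma F(\eta)\,d\omega(\eta)-\int_\Gamma \mathrm{L}^*_\eta G(\Delta^*;\xi\cdot\eta)\cdot\mathrm{L}^*_\eta F(\eta)\,d\omega(\eta)+\int_{\partial\Gamma}F(\eta)\frac{\partial}{\partial\nu(\eta)}G(\Delta^*;\xi\cdot\eta)\,d\sigma(\eta).$$ All integrands in (a) and (b) are absolutely integrable. Here $\mathrm{C}^{(k)}(\overline\Gamma)$ means $k$ times continuously differentiable in $\Gamma$ with derivatives up to order $k$ extending continuously to $\overline\Gamma$; on $\partial\Gamma$, $\nabla^*F$ denotes this extension. -/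

import Mathlib

open MeasureTheory Set Filter Topology InnerProductSpace

noncomputable section

namespace SphericalGreen

/-- Euclidean three-space. -/
abbrev E3 : Type := EuclideanSpace ℝ (Fin 3)

/-- The unit sphere `Ω` of `ℝ³`, with the topology and the (chordal) metric of the ambient space. -/
abbrev Sph : Type := Metric.sphere (0 : E3) 1

/-- Radial projection `x ↦ x / |x|` onto the sphere (the value at the origin is irrelevant). -/
def proj (x : E3) : Sph :=
  if h : x = 0 then ⟨EuclideanSpace.single 0 1, by simp⟩
  else ⟨‖x‖⁻¹ • x, by simp [norm_smul, h]⟩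

/-- The open cone `{x ≠ 0 : x / |x| ∈ S}` over a subset `S` of the sphere. -/
def cone (S : Set Sph) : Set E3 := {x | x ≠ 0 ∧ proj x ∈ S}

/-- The extension of a function on the sphere which is constant along rays. -/
def radialExt (F : Sph → ℝ) (x : E3) : ℝ := F (proj x)

/-- `F` is of class `C^(k)` on `S` (used for open sets and for closures of regular regions, where
derivatives at boundary points are one-sided, that is, the continuous extensions of the
derivatives in the interior). Only the values of `F` on `S` matter. -/
def ClassC (k : ℕ) (S : Set Sph) (F : Sph → ℝ) : Prop :=
  ContDiffOn ℝ k (radialExt F) (cone S)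

/-- The surface gradient `∇*F` at `ξ ∈ S` of a function given on `S`: as
`∇ = ξ ∂/∂r + (1/r) ∇*`, it is the gradient at `ξ` of the extension constant along rays. -/
def surfGrad (S : Set Sph) (F : Sph → ℝ) (ξ : Sph) : E3 :=
  gradientWithin (radialExt F) (cone S) (ξ : E3)

/-- The surface curl gradient `L*F = ξ ∧ ∇*F`. -/
def surfCurlGrad (S : Set Sph) (F : Sph → ℝ) (ξ : Sph) : E3 :=
  WithLp.toLp 2 (crossProduct (WithLp.ofLp (ξ : E3)) (WithLp.ofLp (surfGrad S F ξ)))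

/-- The Beltrami operator `Δ*F` at `ξ ∈ S`: as `Δ = r⁻² ∂/∂r (r² ∂/∂r) + r⁻² Δ*`, it is the
Laplacian at `ξ` of the extension constant along rays. -/
def beltrami (S : Set Sph) (F : Sph → ℝ) (ξ : Sph) : ℝ :=
  laplacianWithin (radialExt F) (cone S) (ξ : E3)

/-- Regular regions: open subsets of the sphere whose boundary is a `C²` curve (or finitely many
closed `C²` curves), with the region lying locally on one side of its boundary. Every boundary
point has a neighbourhood in which the region is `{φ < 0}` for a `C²` function `φ` whose surface
gradient does not vanish. Connectedness is not required. -/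
structure IsRegularRegion (Γ : Set Sph) : Prop where
  isOpen : IsOpen Γ
  boundary : ∀ ξ ∈ frontier Γ, ∃ φ : Sph → ℝ,
    ContDiffAt ℝ 2 (radialExt φ) (ξ : E3) ∧ surfGrad univ φ ξ ≠ 0 ∧
      ∀ᶠ η in 𝓝 ξ, (η ∈ Γ ↔ φ η < 0)

/-- `v` is the outward unit normal of `Γ` at the boundary point `ξ`: a unit vector, tangential to
the sphere, perpendicular to the boundary curve, and pointing into the exterior of `Γ`. -/
structure IsOuterUnitNormal (Γ : Set Sph) (ξ : Sph) (v : E3) : Prop where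
  norm_eq : ‖v‖ = 1
  perp_point : inner ℝ v (ξ : E3) = 0
  perp_curve : ∀ w ∈ tangentConeAt ℝ (((↑) : Sph → E3) '' frontier Γ) (ξ : E3), inner ℝ v w = 0
  outward : ∀ᶠ t : ℝ in 𝓝[>] 0, proj ((ξ : E3) + t • v) ∈ (closure Γ)ᶜ

open Classical in
/-- The outward unit normal field `ν` on `∂Γ` (zero at points where there is no normal). -/
def outerNormal (Γ : Set Sph) (ξ : Sph) : E3 :=
  if h : ∃ v, IsOuterUnitNormal Γ ξ v then h.choose else 0

/-- The normal derivative `∂F/∂ν = ν · ∇*F` on `∂Γ` of a function given on `S`. -/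
def normalDeriv (Γ S : Set Sph) (F : Sph → ℝ) (ξ : Sph) : ℝ :=
  inner ℝ (outerNormal Γ ξ) (surfGrad S F ξ)

/-- The surface element `dω` of the unit sphere (total mass `4π`). -/
def surfMeasure : Measure Sph := (volume : Measure E3).toSphere

/-- The line element `dσ` on `∂Γ`: arc length, that is, one-dimensional Hausdorff measure. -/
def lineMeasure (Γ : Set Sph) : Measure Sph := (Measure.hausdorffMeasure 1).restrict (frontier Γ)

/-- The fundamental solution `G(Δ*; t)` for the Beltrami operator, `-1 ≤ t < 1`. -/
def fundSol (t : ℝ) : ℝ :=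
  1 / (4 * Real.pi) * Real.log (1 - t) + 1 / (4 * Real.pi) * (1 - Real.log 2)

/-- The function `η ↦ G(Δ*; ξ · η)`. -/
def greenAt (ξ η : Sph) : ℝ := fundSol (inner ℝ (ξ : E3) (η : E3))

open Classical in
/-- The solid angle `α` of `Γ`. -/
def solidAngle (Γ : Set Sph) (ξ : Sph) : ℝ :=
  if ξ ∈ Γ then 2 * Real.pi else if ξ ∈ frontier Γ then Real.pi else 0

end SphericalGreen

end

open SphericalGreen

open scoped ENNReal Pointwise

noncomputable section

namespace SphericalGreen

/-! The logarithm in the kernel is regularised: with t = ξ · η, ln(1 - t) becomes ln(1 + ε - t). The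
regularised kernel (`greenReg`) is smooth on the whole sphere. Its surface gradient (`kernelField`)
has divergence `peak` - 1/(4π), where `peak` = (2ε + ε²) / (4π(1 + ε - t)²) is nonnegative, has
total mass 1 and concentrates at ξ as ε → 0 (`surfDiv_kernelField`, `integral_peak`).

The divergence theorem applied to F times `kernelField` is formula (b) with F(ξ) replaced by the
integral of `peak` times F over Γ (`setIntegral_peak_mul_eq`). As ε → 0 this integral tends to F(ξ),
F(ξ)/2 or 0. The factor 1/2 at a boundary point comes from the half-turn about ξ: it preserves
`peak` and exchanges Γ with its complement, up to a set so thin near ξ that it carries no mass in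
the limit (`tendsto_setIntegral_peak_frontier`). The interior term converges by domination by 1/|ξ -
η|, which is integrable over a surface. In the boundary term the singularity cancels, because |ν(η)
· ξ| ≤ C|ξ - η|² on a boundary of class C² (`exists_abs_inner_outerNormal_le`). The version with the
surface curl gradient is Lagrange's identity for cross products.

For (a), the divergence theorem applied to `greenReg` times ∇*F gives Green's first identity, and ε
→ 0 is justified because a logarithm is dominated by |ξ - η|^(-1/2), integrable over the surface and
along the boundary. Combining it with (b) eliminates the gradient term.

The divergence theorem itself (`IsTangentialField.integral_surfDiv`) works with tangential fields
extended to cones with homogeneity -1, for which the surface divergence is the Euclidean one. A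
partition of unity reduces it to fields with small support. In gnomonic coordinates centred at a
boundary point the region is a subgraph; shearing it to a rectangle leaves the divergence theorem
for rectangles, with only one side contributing. That side is the boundary integral because
one-dimensional Hausdorff measure of a curve is the integral of its speed
(`hausdorffMeasure_curve`). -/

/-! ### Radial projection, cones and ray-constant extensions. -/

lemma coe_proj {x : E3} (hx : x ≠ 0) : (proj x : E3) = ‖x‖⁻¹ • x := by
  simp [proj, hx]

lemma norm_sph (η : Sph) : ‖(η : E3)‖ = 1 := by
  simp

lemma sph_ne_zero (η : Sph) : (η : E3) ≠ 0 := by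
  intro h
  simpa [h] using norm_sph η

lemma proj_coe (η : Sph) : proj (η : E3) = η := by
  ext1
  rw [coe_proj (sph_ne_zero η), norm_sph]
  simp

lemma proj_smul {c : ℝ} (hc : 0 < c) (x : E3) : proj (c • x) = proj x := by
  by_cases hx : x = 0
  · simp [hx]
  · ext1
    rw [coe_proj hx, coe_proj (smul_ne_zero hc.ne' hx), norm_smul, smul_smul]
    congr 1
    have : ‖x‖ ≠ 0 := norm_ne_zero_iff.2 hx
    rw [Real.norm_of_nonneg hc.le]
    field_simp

lemma norm_smul_proj (x : E3) : ‖x‖ • (proj x : E3) = x := by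
  by_cases hx : x = 0
  · simp [hx]
  · rw [coe_proj hx, smul_inv_smul₀ (norm_ne_zero_iff.2 hx)]

lemma contDiffAt_proj {n : WithTop ℕ∞} {x : E3} (hx : x ≠ 0) :
    ContDiffAt ℝ n (fun y => (proj y : E3)) x := by
  have h : ContDiffAt ℝ n (fun y : E3 => ‖y‖⁻¹ • y) x :=
    ((contDiffAt_norm ℝ hx).inv (norm_ne_zero_iff.2 hx)).smul contDiffAt_id
  refine h.congr_of_eventuallyEq ?_
  filter_upwards [isOpen_ne.mem_nhds hx] with y hy using coe_proj hy

lemma continuousAt_proj {x : E3} (hx : x ≠ 0) : ContinuousAt proj x :=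
  Topology.IsInducing.subtypeVal.continuousAt_iff.2 (contDiffAt_proj (n := 0) hx).continuousAt

lemma measurable_proj : Measurable proj := by
  have h : Measurable fun x : E3 => (proj x : E3) := by
    have : (fun x : E3 => (proj x : E3)) =
        fun x => if x = 0 then EuclideanSpace.single 0 1 else ‖x‖⁻¹ • x := by
      funext x
      split_ifs with hx
      · simp [proj, hx]
      · exact coe_proj hx
    rw [this]
    exact Measurable.ite (measurableSet_singleton 0) measurable_const (by fun_prop)
  exact Measurable.subtype_mk h

lemma mem_cone {S : Set Sph} {x : E3} : x ∈ cone S ↔ x ≠ 0 ∧ proj x ∈ S := Iff.rfl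

lemma coe_mem_cone {S : Set Sph} {η : Sph} : (η : E3) ∈ cone S ↔ η ∈ S := by
  rw [mem_cone, proj_coe]
  exact ⟨fun h => h.2, fun h => ⟨sph_ne_zero η, h⟩⟩

lemma smul_mem_cone {S : Set Sph} {c : ℝ} (hc : 0 < c) {x : E3} :
    c • x ∈ cone S ↔ x ∈ cone S := by
  simp [mem_cone, proj_smul hc, hc.ne']

lemma cone_mono {S T : Set Sph} (h : S ⊆ T) : cone S ⊆ cone T := fun _ hx => ⟨hx.1, h hx.2⟩

lemma isOpen_cone {S : Set Sph} (hS : IsOpen S) : IsOpen (cone S) := by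
  rw [isOpen_iff_mem_nhds]
  intro x hx
  exact inter_mem (isOpen_ne.mem_nhds hx.1) ((continuousAt_proj hx.1).preimage_mem_nhds
    (hS.mem_nhds hx.2))

lemma radialExt_coe (F : Sph → ℝ) (η : Sph) : radialExt F η = F η := by
  rw [radialExt, proj_coe]

lemma radialExt_smul (F : Sph → ℝ) {c : ℝ} (hc : 0 < c) (x : E3) :
    radialExt F (c • x) = radialExt F x := by
  rw [radialExt, radialExt, proj_smul hc]

/-! ### Orthonormal frames and polar coordinates. -/

/-- The linear coordinates of an orthonormal basis. -/
def frameMap (e : OrthonormalBasis (Fin 3) ℝ E3) (q : (ℝ × ℝ) × ℝ) : E3 :=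
  q.1.1 • e 0 + q.1.2 • e 1 + q.2 • e 2

lemma frameMap_eq (e : OrthonormalBasis (Fin 3) ℝ E3) (q : (ℝ × ℝ) × ℝ) :
    frameMap e q = e.repr.symm (WithLp.toLp 2 ![q.1.1, q.1.2, q.2]) := by
  rw [frameMap, ← e.sum_repr_symm, Fin.sum_univ_three]
  simp

lemma measurePreserving_frameMap (e : OrthonormalBasis (Fin 3) ℝ E3) :
    MeasurePreserving (frameMap e) volume volume := by
  have h1 := e.measurePreserving_repr_symm
  have h2 : MeasurePreserving (WithLp.toLp 2) (volume : Measure (Fin 3 → ℝ)) volume :=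
    PiLp.volume_preserving_toLp (Fin 3)
  have h3 := (volume_preserving_piFinSuccAbove (fun _ : Fin 3 => ℝ) 2).symm
  have h4 := (volume_preserving_piFinTwo (fun _ : Fin 2 => ℝ)).symm
  have h5 : MeasurePreserving (Prod.swap : (ℝ × (Fin 2 → ℝ)) → _) volume volume :=
    Measure.measurePreserving_swap
  have h6 : MeasurePreserving (Prod.swap : ((Fin 2 → ℝ) × ℝ) → _) volume volume :=
    Measure.measurePreserving_swap
  have h7 : MeasurePreserving (Prod.map (MeasurableEquiv.piFinTwo (fun _ : Fin 2 => ℝ)).symm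
    (id : ℝ → ℝ)) volume volume := h4.prod (MeasurePreserving.id _)
  have := h1.comp (h2.comp (h3.comp (h6.comp h7)))
  convert this using 1
  funext q
  rw [frameMap_eq]
  simp only [Function.comp]
  congr 2
  funext i
  fin_cases i <;> simp [MeasurableEquiv.piFinSuccAbove, MeasurableEquiv.piFinTwo, piFinTwoEquiv,
    Fin.insertNthEquiv, Fin.insertNth, Fin.succAboveCases]

lemma surfMeasure_univ : surfMeasure univ = ENNReal.ofReal (4 * Real.pi) := by
  rw [surfMeasure, Measure.toSphere_apply_univ, EuclideanSpace.volume_ball_fin_three]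
  simp only [finrank_euclideanSpace, Fintype.card_fin, ENNReal.ofReal_one, one_pow, one_mul]
  rw [← ENNReal.ofReal_natCast, ← ENNReal.ofReal_mul (by positivity)]
  congr 1
  push_cast
  ring

instance : IsFiniteMeasure surfMeasure :=
  inferInstanceAs (IsFiniteMeasure (volume : Measure E3).toSphere)

/-- Integration in polar coordinates. -/
lemma lintegral_polar {f : E3 → ℝ≥0∞} (hf : Measurable f) :
    ∫⁻ x, f x = ∫⁻ ω : Sph, ∫⁻ r in Ioi (0 : ℝ), ENNReal.ofReal (r ^ 2) * f (r • (ω : E3))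
      ∂volume ∂surfMeasure := by
  have h := (volume : Measure E3).measurePreserving_homeomorphUnitSphereProd
  have h1 : ∫⁻ x, f x = ∫⁻ x : ({0}ᶜ : Set E3), f (x : E3) ∂(volume.comap Subtype.val) := by
    rw [lintegral_subtype_comap (measurableSet_singleton _).compl, restrict_compl_singleton]
  have hfm : Measurable fun q : Sph × Ioi (0 : ℝ) => f ((q.2 : ℝ) • (q.1 : E3)) := by fun_prop
  have h2 := h.lintegral_comp hfm
  rw [h1]
  have h3 : ∀ x : ({0}ᶜ : Set E3), f (((homeomorphUnitSphereProd E3 x).2 : ℝ) •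
      ((homeomorphUnitSphereProd E3 x).1 : E3)) = f x := by
    intro x
    rw [← homeomorphUnitSphereProd_symm_apply_coe, Homeomorph.symm_apply_apply]
  simp only [h3] at h2
  rw [h2, lintegral_prod _ hfm.aemeasurable]
  refine lintegral_congr fun ω => ?_
  simp only [finrank_euclideanSpace, Fintype.card_fin]
  rw [Measure.volumeIoiPow, lintegral_withDensity_eq_lintegral_mul _ (by fun_prop) (by fun_prop)]
  exact lintegral_subtype_comap measurableSet_Ioi
    (fun r : ℝ => ENNReal.ofReal (r ^ 2) * f (r • (ω : E3)))

/-! ### Gnomonic coordinates and the surface element. -/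

/-- The gnomonic parametrization by the tangent plane at `e 2`. -/
def gnom (e : OrthonormalBasis (Fin 3) ℝ E3) (q : ℝ × ℝ) : E3 :=
  q.1 • e 0 + q.2 • e 1 + e 2

/-- The distance of a point of the tangent plane from the centre of the sphere. -/
def rho (q : ℝ × ℝ) : ℝ := √(1 + q.1 ^ 2 + q.2 ^ 2)

lemma rho_pos (q : ℝ × ℝ) : 0 < rho q := Real.sqrt_pos.2 (by positivity)

lemma rho_sq (q : ℝ × ℝ) : rho q ^ 2 = 1 + q.1 ^ 2 + q.2 ^ 2 := Real.sq_sqrt (by positivity)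

lemma inner_basis (e : OrthonormalBasis (Fin 3) ℝ E3) (i j : Fin 3) :
    inner ℝ (e i) (e j) = if i = j then (1 : ℝ) else 0 :=
  orthonormal_iff_ite.1 e.orthonormal i j

lemma norm_sq_eq_sum (e : OrthonormalBasis (Fin 3) ℝ E3) (x : E3) :
    ‖x‖ ^ 2 = inner ℝ (e 0) x ^ 2 + inner ℝ (e 1) x ^ 2 + inner ℝ (e 2) x ^ 2 := by
  rw [← e.sum_sq_inner_right x, Fin.sum_univ_three]

lemma inner_gnom_zero (e : OrthonormalBasis (Fin 3) ℝ E3) (q : ℝ × ℝ) :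
    inner ℝ (e 0) (gnom e q) = q.1 := by
  simp [gnom, inner_add_right, inner_smul_right]

lemma inner_gnom_one (e : OrthonormalBasis (Fin 3) ℝ E3) (q : ℝ × ℝ) :
    inner ℝ (e 1) (gnom e q) = q.2 := by
  simp [gnom, inner_add_right, inner_smul_right]

lemma inner_gnom_two (e : OrthonormalBasis (Fin 3) ℝ E3) (q : ℝ × ℝ) :
    inner ℝ (e 2) (gnom e q) = 1 := by
  simp [gnom, inner_add_right, inner_smul_right]

lemma gnom_ne_zero (e : OrthonormalBasis (Fin 3) ℝ E3) (q : ℝ × ℝ) : gnom e q ≠ 0 := by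
  intro h
  simpa [h] using inner_gnom_two e q

lemma norm_gnom (e : OrthonormalBasis (Fin 3) ℝ E3) (q : ℝ × ℝ) : ‖gnom e q‖ = rho q := by
  rw [← Real.sqrt_sq (norm_nonneg (gnom e q)), norm_sq_eq_sum e, inner_gnom_zero, inner_gnom_one,
    inner_gnom_two, rho]
  congr 1
  ring

lemma coe_proj_gnom (e : OrthonormalBasis (Fin 3) ℝ E3) (q : ℝ × ℝ) :
    (proj (gnom e q) : E3) = (rho q)⁻¹ • gnom e q := by
  rw [coe_proj (gnom_ne_zero e q), norm_gnom]

lemma contDiff_gnom {n : WithTop ℕ∞} (e : OrthonormalBasis (Fin 3) ℝ E3) :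
    ContDiff ℝ n (gnom e) := by
  unfold gnom
  fun_prop

lemma measurable_gnom (e : OrthonormalBasis (Fin 3) ℝ E3) : Measurable (gnom e) :=
  (contDiff_gnom (n := 0) e).continuous.measurable

lemma continuous_rho : Continuous rho := by
  unfold rho
  fun_prop

lemma lintegral_comp_smul_plane (h : ℝ × ℝ → ℝ≥0∞) (hh : Measurable h) {c : ℝ} (hc : 0 < c) :
    ∫⁻ q, h q = ENNReal.ofReal (c ^ 2) * ∫⁻ q, h (c • q) := by
  have h1 := Measure.map_addHaar_smul (volume : Measure (ℝ × ℝ)) hc.ne'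
  have h2 : ∫⁻ q, h (c • q) = ∫⁻ q, h q ∂(Measure.map (fun x => c • x) volume) :=
    (lintegral_map hh (measurable_const_smul c)).symm
  rw [h2, h1, lintegral_smul_measure, smul_eq_mul, ← mul_assoc, ← ENNReal.ofReal_mul (by positivity)]
  have : c ^ 2 * |(c ^ Module.finrank ℝ (ℝ × ℝ))⁻¹| = 1 := by
    simp only [Module.finrank_prod, Module.finrank_self]
    rw [abs_of_pos (by positivity)]
    norm_num
    field_simp
  rw [this]
  simp

lemma lintegral_sq_Ioo {a : ℝ} (ha : 0 ≤ a) :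
    ∫⁻ r in Ioo 0 a, ENNReal.ofReal (r ^ 2) = ENNReal.ofReal (a ^ 3 / 3) := by
  rw [Measure.restrict_congr_set Ioo_ae_eq_Ioc, ← ofReal_integral_eq_lintegral_ofReal,
    ← intervalIntegral.integral_of_le ha]
  · simp
    norm_num
  · exact (intervalIntegral.intervalIntegrable_pow 2).1
  · filter_upwards with y using by positivity

/-- The surface element in gnomonic coordinates. -/
lemma lintegral_gnom (e : OrthonormalBasis (Fin 3) ℝ E3) {h : Sph → ℝ≥0∞} (hh : Measurable h) :
    ∫⁻ η in {η : Sph | 0 < inner ℝ (e 2) (η : E3)}, h η ∂surfMeasure =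
      ∫⁻ q, ENNReal.ofReal ((rho q)⁻¹ ^ 3) * h (proj (gnom e q)) := by
  classical
  -- `k` is homogeneous of degree 0, and its integral over the slab 0 < x · `e 2` < 1 is computed
  -- twice: along rays and along planes parallel to the tangent plane. Both computations produce the
  -- factor 1/3, so no Jacobian has to be evaluated.
  set k : E3 → ℝ≥0∞ := fun x => ENNReal.ofReal (inner ℝ (e 2) (proj x : E3) ^ 3) * h (proj x)
    with hk
  have hkm : Measurable k := by
    have h1 := hh.comp measurable_proj
    have h2 : Measurable fun x => (proj x : E3) := measurable_subtype_coe.comp measurable_proj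
    have h3 : Measurable fun x => inner ℝ (e 2) (proj x : E3) := by fun_prop
    exact (h3.pow_const 3).ennreal_ofReal.mul h1
  have hks : ∀ {c : ℝ}, 0 < c → ∀ x, k (c • x) = k x := by
    intro c hc x
    simp only [hk, proj_smul hc]
  set A : Set E3 := {x | inner ℝ (e 2) x ∈ Ioo (0 : ℝ) 1} with hA
  have hAm : MeasurableSet A :=
    measurableSet_Ioo.preimage (by fun_prop : Measurable fun x : E3 => inner ℝ (e 2) x)
  have hfm : Measurable (A.indicator k) := hkm.indicator hAm
  -- Along the ray through ω the slab is 0 < r < 1/t with t = ω · `e 2`; the integral of r² is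
  -- t⁻³/3, and the weight t³ in `k` cancels t⁻³.
  have P : ∫⁻ x, A.indicator k x = 3⁻¹ *
      ∫⁻ η in {η : Sph | 0 < inner ℝ (e 2) (η : E3)}, h η ∂surfMeasure := by
    have hSm : MeasurableSet {η : Sph | 0 < inner ℝ (e 2) (η : E3)} :=
      measurableSet_lt measurable_const (by fun_prop)
    rw [lintegral_polar hfm, ← lintegral_indicator hSm, ← lintegral_const_mul _ (hh.indicator hSm)]
    refine lintegral_congr fun ω => ?_
    by_cases hω : 0 < inner ℝ (e 2) (ω : E3)
    · rw [indicator_of_mem (by exact hω)]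
      set t : ℝ := inner ℝ (e 2) (ω : E3) with ht
      have h1 : ∀ r ∈ Ioi (0 : ℝ), ENNReal.ofReal (r ^ 2) * A.indicator k (r • (ω : E3)) =
          (Ioo 0 t⁻¹).indicator (fun r => ENNReal.ofReal (r ^ 2) * (ENNReal.ofReal (t ^ 3) * h ω)) r
          := by
        intro r hr
        have hr' : 0 < r := hr
        have hmem : r • (ω : E3) ∈ A ↔ r ∈ Ioo 0 t⁻¹ := by
          simp only [hA, mem_ofPred_eq, inner_smul_right, ← ht, mem_Ioo]
          rw [lt_inv_comm₀ hr' hω, ← one_div, lt_div_iff₀ hr', mul_comm t r]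
          exact ⟨fun h => ⟨hr', h.2⟩, fun h => ⟨by positivity, h.2⟩⟩
        by_cases hm : r ∈ Ioo 0 t⁻¹
        · rw [indicator_of_mem hm, indicator_of_mem (hmem.2 hm), hks hr', hk]
          simp only [proj_coe, ← ht]
        · rw [indicator_of_notMem hm, indicator_of_notMem (fun h => hm (hmem.1 h)), mul_zero]
      rw [setLIntegral_congr_fun measurableSet_Ioi h1, setLIntegral_indicator measurableSet_Ioo,
        inter_eq_left.2 (fun r hr => hr.1), lintegral_mul_const _ (by fun_prop),
        lintegral_sq_Ioo (by positivity), ← mul_assoc, ← ENNReal.ofReal_mul (by positivity)]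
      have : t⁻¹ ^ 3 / 3 * t ^ 3 = 3⁻¹ := by field_simp
      rw [this, ENNReal.ofReal_inv_of_pos (by norm_num)]
      simp
    · rw [indicator_of_notMem (by exact hω), mul_zero]
      refine (setLIntegral_congr_fun measurableSet_Ioi (g := fun _ => 0) fun r hr => ?_).trans
        (by simp)
      have hr' : 0 < r := hr
      have : r • (ω : E3) ∉ A := by
        simp only [hA, mem_ofPred_eq, inner_smul_right, mem_Ioo, not_and]
        intro h
        exact absurd (pos_of_mul_pos_right h hr'.le) hω
      simp [indicator_of_notMem this]
  -- The slice at height c is c times the tangent plane, hence contributes c² times the same planar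
  -- integral, and c² integrates to 1/3 over (0, 1).
  have Q : ∫⁻ x, A.indicator k x = 3⁻¹ *
      ∫⁻ q, ENNReal.ofReal ((rho q)⁻¹ ^ 3) * h (proj (gnom e q)) := by
    have hm := measurePreserving_frameMap e
    rw [← hm.lintegral_comp hfm, Measure.volume_eq_prod,
      lintegral_prod_symm (fun a => A.indicator k (frameMap e a)) (hfm.comp hm.measurable).aemeasurable]
    have hg : ∀ q, k (gnom e q) = ENNReal.ofReal ((rho q)⁻¹ ^ 3) * h (proj (gnom e q)) := by
      intro q
      simp only [hk]
      rw [coe_proj_gnom, inner_smul_right, inner_gnom_two, mul_one]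
    have h1 : ∀ c : ℝ, ∫⁻ q : ℝ × ℝ, A.indicator k (frameMap e (q, c)) =
        (Ioo (0 : ℝ) 1).indicator (fun c => ENNReal.ofReal (c ^ 2) * ∫⁻ q, k (gnom e q)) c := by
      intro c
      have hin : ∀ q : ℝ × ℝ, inner ℝ (e 2) (frameMap e (q, c)) = c := by
        intro q
        simp [frameMap, inner_add_right, inner_smul_right]
      by_cases hc : c ∈ Ioo (0 : ℝ) 1
      · rw [indicator_of_mem hc]
        have h2 : ∀ q : ℝ × ℝ, A.indicator k (frameMap e (q, c)) = k (frameMap e (q, c)) :=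
          fun q => indicator_of_mem (by simpa only [hA, mem_ofPred_eq, hin] using hc) _
        simp only [h2]
        rw [lintegral_comp_smul_plane (fun q => k (frameMap e (q, c)))
          (hkm.comp (hm.measurable.comp (measurable_id.prodMk measurable_const))) hc.1]
        congr 1
        refine lintegral_congr fun q => ?_
        rw [← hks hc.1 (gnom e q)]
        congr 1
        simp [frameMap, gnom, mul_smul]
      · rw [indicator_of_notMem hc]
        have h2 : ∀ q : ℝ × ℝ, A.indicator k (frameMap e (q, c)) = 0 :=
          fun q => indicator_of_notMem (by simpa only [hA, mem_ofPred_eq, hin] using hc) _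
        simp [h2]
    simp only [h1]
    rw [lintegral_indicator measurableSet_Ioo, lintegral_mul_const _ (by fun_prop),
      lintegral_sq_Ioo zero_le_one]
    simp only [hg]
    congr 1
    rw [one_pow, one_div, ENNReal.ofReal_inv_of_pos (by norm_num)]
    simp
  have h3 := P.symm.trans Q
  have h30 : (3⁻¹ : ℝ≥0∞) ≠ 0 := by simp
  have h3t : (3⁻¹ : ℝ≥0∞) ≠ ⊤ := by simp
  exact (ENNReal.mul_right_inj h30 h3t).1 h3

lemma measurable_proj_gnom (e : OrthonormalBasis (Fin 3) ℝ E3) :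
    Measurable fun q => proj (gnom e q) := measurable_proj.comp (measurable_gnom e)

/-- Testing the preceding formula on indicators turns it into an equality of measures, which makes
it available for real-valued integrals. -/
lemma restrict_surfMeasure_eq_map (e : OrthonormalBasis (Fin 3) ℝ E3) :
    surfMeasure.restrict {η : Sph | 0 < inner ℝ (e 2) (η : E3)} =
      Measure.map (fun q => proj (gnom e q))
        (volume.withDensity fun q => ENNReal.ofReal ((rho q)⁻¹ ^ 3)) := by
  have hr : Measurable fun q => ENNReal.ofReal ((rho q)⁻¹ ^ 3) :=
    (continuous_rho.measurable.inv.pow_const 3).ennreal_ofReal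
  ext s hs
  have h := lintegral_gnom e (h := s.indicator 1) (measurable_one.indicator hs)
  rw [lintegral_indicator_one hs] at h
  rw [h, Measure.map_apply (measurable_proj_gnom e) hs,
    withDensity_apply _ (measurable_proj_gnom e hs), ← lintegral_indicator
      (measurable_proj_gnom e hs)]
  refine lintegral_congr fun q => ?_
  by_cases hq : proj (gnom e q) ∈ s
  · rw [indicator_of_mem hq, indicator_of_mem (by exact hq)]
    simp
  · rw [indicator_of_notMem hq, indicator_of_notMem (by exact hq)]
    simp

lemma integral_gnom (e : OrthonormalBasis (Fin 3) ℝ E3) {h : Sph → ℝ}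
    (hh : Integrable h surfMeasure) (h0 : ∀ η : Sph, inner ℝ (e 2) (η : E3) ≤ 0 → h η = 0) :
    Integrable (fun q => (rho q)⁻¹ ^ 3 * h (proj (gnom e q))) ∧
    ∫ η, h η ∂surfMeasure = ∫ q, (rho q)⁻¹ ^ 3 * h (proj (gnom e q)) := by
  have hr : Measurable fun q => ENNReal.ofReal ((rho q)⁻¹ ^ 3) :=
    (continuous_rho.measurable.inv.pow_const 3).ennreal_ofReal
  have hfin : ∀ᵐ q : ℝ × ℝ, ENNReal.ofReal ((rho q)⁻¹ ^ 3) < ⊤ := by simp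
  have h1 := hh.restrict (s := {η : Sph | 0 < inner ℝ (e 2) (η : E3)})
  have h2 : ∫ η, h η ∂surfMeasure =
      ∫ η in {η : Sph | 0 < inner ℝ (e 2) (η : E3)}, h η ∂surfMeasure := by
    rw [setIntegral_eq_integral_of_forall_compl_eq_zero]
    intro η hη
    exact h0 η (not_lt.1 hη)
  rw [restrict_surfMeasure_eq_map e] at h1 h2
  have h3 : ∀ q, (ENNReal.ofReal ((rho q)⁻¹ ^ 3)).toReal = (rho q)⁻¹ ^ 3 := fun q =>
    ENNReal.toReal_ofReal (by have := rho_pos q; positivity)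
  refine ⟨?_, ?_⟩
  · have h4 := (integrable_map_measure h1.aestronglyMeasurable
      (measurable_proj_gnom e).aemeasurable).1 h1
    rw [integrable_withDensity_iff_integrable_smul' hr hfin] at h4
    simpa only [h3, smul_eq_mul, Function.comp] using h4
  · rw [h2, integral_map (measurable_proj_gnom e).aemeasurable h1.aestronglyMeasurable,
      integral_withDensity_eq_integral_toReal_smul hr hfin]
    simp only [h3, smul_eq_mul]

/-! ### Singular powers, null circles and isometries on the sphere. -/

lemma integrableOn_abs_rpow {a : ℝ} (ha : -1 < a) (b : ℝ) :
    IntegrableOn (fun x : ℝ => |x| ^ a) (Icc (-b) b) := by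
  rcases lt_or_ge b 0 with hb | hb
  · rw [Icc_eq_empty (by linarith)]
    exact integrableOn_empty
  have h1 : IntegrableOn (fun x : ℝ => |x| ^ a) (Icc 0 b) := by
    have := (intervalIntegrable_iff_integrableOn_Icc_of_le hb).1
      (intervalIntegral.intervalIntegrable_rpow' (a := 0) (b := b) ha)
    refine this.congr_fun (fun x hx => ?_) measurableSet_Icc
    simp only [abs_of_nonneg hx.1]
  have h2 : IntegrableOn (fun x : ℝ => |x| ^ a) (Icc (-b) 0) := by
    have := (Measure.measurePreserving_neg (volume : Measure ℝ)).integrableOn_comp_preimage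
      (MeasurableEquiv.neg ℝ).measurableEmbedding (f := fun x : ℝ => |x| ^ a) (s := Icc 0 b)
    have h3 := this.2 h1
    simpa [Function.comp_def] using h3
  rw [← Icc_union_Icc_eq_Icc (neg_nonpos.2 hb) hb]
  exact h2.union h1

/-- The source of the dominating functions for surface integrals singular at ξ = `e 2`: powers of
the distance are bounded by powers of the two tangential coordinates. In a cube the product of
powers separates into one-dimensional integrals. Since both exponents are nonpositive, the function
only grows when a point of the sphere is moved towards the origin, so polar integration over the
unit ball bounds the spherical integral by three times the integral over the cube. -/
lemma integrable_abs_rpow_mul_abs_rpow (e : OrthonormalBasis (Fin 3) ℝ E3) {a b : ℝ}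
    (ha : -1 < a) (ha0 : a ≤ 0) (hb : -1 < b) (hb0 : b ≤ 0) :
    Integrable (fun η : Sph => |inner ℝ (e 0) (η : E3)| ^ a * |inner ℝ (e 1) (η : E3)| ^ b)
      surfMeasure := by
  set f : E3 → ℝ := fun x => |inner ℝ (e 0) x| ^ a * |inner ℝ (e 1) x| ^ b with hf
  have hfm : Measurable f := by
    have h1 : Measurable fun x : E3 => inner ℝ (e 0) x := by fun_prop
    have h2 : Measurable fun x : E3 => inner ℝ (e 1) x := by fun_prop
    exact ((measurable_abs.comp h1).pow_const a).mul ((measurable_abs.comp h2).pow_const b)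
  have hf0 : ∀ x, 0 ≤ f x := fun x => by positivity
  have hscale : ∀ (x : E3) (r : ℝ), r ∈ Ioo (0 : ℝ) 1 → f x ≤ f (r • x) := by
    intro x r hr
    have h1 : ∀ {c : ℝ} (t : ℝ), c ≤ 0 → |t| ^ c ≤ |r * t| ^ c := by
      intro c t hc
      rw [abs_mul, Real.mul_rpow (abs_nonneg _) (abs_nonneg _), abs_of_pos hr.1]
      exact le_mul_of_one_le_left (by positivity) (Real.one_le_rpow_of_pos_of_le_one_of_nonpos hr.1 hr.2.le hc)
    simp only [hf, inner_smul_right]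
    exact mul_le_mul (h1 _ ha0) (h1 _ hb0) (by positivity) (by positivity)
  have hcube : ∫⁻ x in {x : E3 | ∀ i, inner ℝ (e i) x ∈ Icc (-1 : ℝ) 1}, ENNReal.ofReal (f x) < ⊤ := by
    have hm := measurePreserving_frameMap e
    have hS : MeasurableSet {x : E3 | ∀ i, inner ℝ (e i) x ∈ Icc (-1 : ℝ) 1} := by
      rw [Set.ofPred_forall]
      exact MeasurableSet.iInter fun i => measurableSet_Icc.preimage
        (by fun_prop : Measurable fun x : E3 => inner ℝ (e i) x)
    rw [← hm.setLIntegral_comp_preimage hS hfm.ennreal_ofReal]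
    have hin : ∀ (q : (ℝ × ℝ) × ℝ), inner ℝ (e 0) (frameMap e q) = q.1.1 ∧
        inner ℝ (e 1) (frameMap e q) = q.1.2 ∧ inner ℝ (e 2) (frameMap e q) = q.2 := by
      intro q
      simp [frameMap, inner_add_right, inner_smul_right]
    have hpre : frameMap e ⁻¹' {x : E3 | ∀ i, inner ℝ (e i) x ∈ Icc (-1 : ℝ) 1} =
        (Icc (-1 : ℝ) 1 ×ˢ Icc (-1 : ℝ) 1) ×ˢ Icc (-1 : ℝ) 1 := by
      ext q
      simp only [mem_preimage, mem_ofPred_eq, Fin.forall_fin_succ, mem_prod]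
      simp [hin, and_assoc, -Icc_prod_Icc]
    rw [hpre]
    have hI : IntegrableOn (fun q : (ℝ × ℝ) × ℝ => (|q.1.1| ^ a * |q.1.2| ^ b) * (1 : ℝ))
        ((Icc (-1 : ℝ) 1 ×ˢ Icc (-1 : ℝ) 1) ×ˢ Icc (-1 : ℝ) 1) := by
      rw [IntegrableOn, Measure.volume_eq_prod, Measure.volume_eq_prod, ← Measure.prod_restrict,
        ← Measure.prod_restrict]
      exact ((integrableOn_abs_rpow ha 1).mul_prod (integrableOn_abs_rpow hb 1)).mul_prod
        (integrableOn_const (by simp))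
    have := hI.2
    rw [hasFiniteIntegral_iff_ofReal (by filter_upwards with q; positivity)] at this
    refine lt_of_eq_of_lt (lintegral_congr fun q => ?_) this
    simp [hf, hin]
  refine ⟨(hfm.comp measurable_subtype_coe).aestronglyMeasurable, ?_⟩
  rw [hasFiniteIntegral_iff_ofReal (by filter_upwards with q; positivity)]
  have hsub : (∫⁻ ω : Sph, ENNReal.ofReal (f ω) ∂surfMeasure) * 3⁻¹ ≤
      ∫⁻ x in {x : E3 | ∀ i, inner ℝ (e i) x ∈ Icc (-1 : ℝ) 1}, ENNReal.ofReal (f x) := by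
    have hfS : Measurable fun ω : Sph => ENNReal.ofReal (f ω) :=
      (hfm.comp measurable_subtype_coe).ennreal_ofReal
    have hS : MeasurableSet (Metric.ball (0 : E3) 1) := Metric.isOpen_ball.measurableSet
    refine le_trans ?_ (lintegral_mono_set (s := Metric.ball (0 : E3) 1) ?_)
    · rw [← lintegral_indicator hS, lintegral_polar (hfm.ennreal_ofReal.indicator hS),
        ← lintegral_mul_const _ hfS]
      refine lintegral_mono fun ω => ?_
      have h3 : (3⁻¹ : ℝ≥0∞) = ∫⁻ r in Ioo (0 : ℝ) 1, ENNReal.ofReal (r ^ 2) := by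
        rw [lintegral_sq_Ioo zero_le_one, one_pow, one_div, ENNReal.ofReal_inv_of_pos (by norm_num)]
        simp
      rw [h3, ← lintegral_const_mul _ (by fun_prop)]
      refine le_trans ?_ (lintegral_mono_set (s := Ioo (0 : ℝ) 1) fun r hr => hr.1)
      refine setLIntegral_mono' measurableSet_Ioo fun r hr => ?_
      have hmem : r • (ω : E3) ∈ Metric.ball (0 : E3) 1 := by
        simp [norm_smul, abs_of_pos hr.1, hr.2]
      rw [indicator_of_mem hmem, mul_comm]
      gcongr
      exact hscale _ _ hr
    · intro x hx i
      rw [mem_ball_zero_iff] at hx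
      have := abs_real_inner_le_norm (e i) x
      rw [e.norm_eq_one, one_mul] at this
      exact abs_le.1 (this.trans hx.le)
  by_contra hcon
  rw [not_lt, top_le_iff] at hcon
  rw [hcon, ENNReal.top_mul (by simp)] at hsub
  exact absurd (lt_of_le_of_lt hsub hcube) (lt_irrefl _)

/-- Great circles are null: the cone over one lies in a plane, which has volume zero. -/
lemma ae_inner_ne_zero {v : E3} (hv : v ≠ 0) :
    ∀ᵐ η : Sph ∂surfMeasure, inner ℝ v (η : E3) ≠ 0 := by
  have hm : MeasurableSet {η : Sph | inner ℝ v (η : E3) = 0} :=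
    (measurableSet_singleton (0 : ℝ)).preimage (by fun_prop : Measurable fun η : Sph => inner ℝ v (η : E3))
  rw [ae_iff]
  simp only [not_not]
  rw [surfMeasure, Measure.toSphere_apply' _ hm]
  have : volume (Ioo (0 : ℝ) 1 • (Subtype.val '' {η : Sph | inner ℝ v (η : E3) = 0}) : Set E3) = 0 := by
    refine measure_mono_null (t := ((ℝ ∙ v)ᗮ : Submodule ℝ E3)) ?_ ?_
    · rintro _ ⟨r, -, _, ⟨η, hη, rfl⟩, rfl⟩
      rw [SetLike.mem_coe, Submodule.mem_orthogonal_singleton_iff_inner_right]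
      simp only [inner_smul_right]
      rw [show inner ℝ v (η : E3) = 0 from hη, mul_zero]
    · refine Measure.addHaar_submodule _ _ fun h => hv ?_
      have : v ∈ ((ℝ ∙ v)ᗮ : Submodule ℝ E3) := h ▸ Submodule.mem_top
      rw [Submodule.mem_orthogonal_singleton_iff_inner_right] at this
      exact inner_self_eq_zero.1 this
  rw [this, mul_zero]

/-- The isometry of the sphere induced by a linear isometry. -/
def sphIso (L : E3 ≃ₗᵢ[ℝ] E3) (η : Sph) : Sph := ⟨L η, by simp⟩

/-- The surface measure of a set is a multiple of the volume of the truncated cone over it, and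
linear isometries preserve volume. -/
lemma measurePreserving_sphIso (L : E3 ≃ₗᵢ[ℝ] E3) :
    MeasurePreserving (sphIso L) surfMeasure surfMeasure := by
  have hm : Measurable (sphIso L) := by
    unfold sphIso
    fun_prop
  refine ⟨hm, ?_⟩
  ext s hs
  rw [Measure.map_apply hm hs, surfMeasure, Measure.toSphere_apply' _ hs,
    Measure.toSphere_apply' _ (hm hs)]
  congr 1
  symm
  rw [← L.measurePreserving.measure_preimage_equiv (f := L.toHomeomorph.toMeasurableEquiv)]
  congr 1
  ext x
  constructor
  · rintro ⟨r, hr, _, ⟨η, hη, rfl⟩, hx⟩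
    have hx' : r • (η : E3) = L x := hx
    refine ⟨r, hr, _, ⟨sphIso L.symm η, ?_, rfl⟩, ?_⟩
    · rw [mem_preimage]
      convert hη
      simp [sphIso]
    · apply L.injective
      simpa [sphIso] using hx'
  · rintro ⟨r, hr, _, ⟨η, hη, rfl⟩, rfl⟩
    exact ⟨r, hr, _, ⟨sphIso L η, hη, rfl⟩, by simp [sphIso]⟩

/-! ### Hausdorff measure of curves. -/

section CurveLength

variable {X : Type*} [MetricSpace X]

/-- The curve `γ` has metric speed `c` at `v`, in the strict sense. -/
def HasMetricSpeedAt (γ : ℝ → X) (c : ℝ) (v : ℝ) : Prop :=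
  ∀ ε > 0, ∀ᶠ p : ℝ × ℝ in 𝓝 (v, v),
    |dist (γ p.1) (γ p.2) - c * (|p.1 - p.2|)| ≤ ε * |p.1 - p.2|

lemma HasMetricSpeedAt.continuousAt {γ : ℝ → X} {c v : ℝ} (h : HasMetricSpeedAt γ c v) :
    ContinuousAt γ v := by
  have h1 := h 1 one_pos
  have h2 : Tendsto (fun w : ℝ => (w, v)) (𝓝 v) (𝓝 (v, v)) :=
    (Continuous.prodMk continuous_id continuous_const).tendsto v
  have h3 := h2.eventually h1
  rw [ContinuousAt, tendsto_iff_dist_tendsto_zero]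
  have h4 : Tendsto (fun w : ℝ => (c + 1) * |w - v|) (𝓝 v) (𝓝 0) := by
    have : Continuous fun w : ℝ => (c + 1) * |w - v| := by fun_prop
    simpa using this.tendsto v
  refine squeeze_zero' (Eventually.of_forall fun _ => dist_nonneg) ?_ h4
  filter_upwards [h3] with w hw
  have := (abs_le.1 hw).2
  linarith

variable [MeasurableSpace X] [BorelSpace X]

lemma hausdorffMeasure_image_le_of_dist_le {γ : ℝ → X} {D : Set ℝ} {k : ℝ}
    (h : ∀ x ∈ D, ∀ y ∈ D, dist (γ x) (γ y) ≤ k * |x - y|) (hk : 0 ≤ k) :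
    μH[1] (γ '' D) ≤ ENNReal.ofReal k * volume D := by
  have hL : LipschitzOnWith k.toNNReal γ D := by
    refine LipschitzOnWith.of_dist_le_mul fun x hx y hy => ?_
    rw [Real.coe_toNNReal _ hk, Real.dist_eq]
    exact h x hx y hy
  have := hL.hausdorffMeasure_image_le (d := 1) zero_le_one
  rwa [ENNReal.rpow_one, hausdorffMeasure_real] at this

/-- For k > 0 the curve is injective on `D` and its inverse is Lipschitz with constant 1/k, so the
upper bound for Lipschitz images applies to the inverse. -/
lemma le_hausdorffMeasure_image_of_le_dist {γ : ℝ → X} {D : Set ℝ} {k : ℝ}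
    (h : ∀ x ∈ D, ∀ y ∈ D, k * |x - y| ≤ dist (γ x) (γ y)) :
    ENNReal.ofReal k * volume D ≤ μH[1] (γ '' D) := by
  rcases le_or_gt k 0 with hk | hk
  · simp [ENNReal.ofReal_of_nonpos hk]
  have hinj : InjOn γ D := by
    intro x hx y hy hxy
    have := h x hx y hy
    rw [hxy, dist_self] at this
    have h2 : |x - y| ≤ 0 := by
      by_contra hc
      rw [not_le] at hc
      nlinarith
    exact sub_eq_zero.1 (abs_eq_zero.1 (le_antisymm h2 (abs_nonneg _)))
  have hL : LipschitzOnWith (k⁻¹).toNNReal (Function.invFunOn γ D) (γ '' D) := by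
    refine LipschitzOnWith.of_dist_le_mul ?_
    rintro _ ⟨x, hx, rfl⟩ _ ⟨y, hy, rfl⟩
    rw [hinj.leftInvOn_invFunOn hx, hinj.leftInvOn_invFunOn hy,
      Real.coe_toNNReal _ (inv_nonneg.2 hk.le), Real.dist_eq, inv_mul_eq_div, le_div_iff₀ hk,
      mul_comm]
    exact h x hx y hy
  have := hL.hausdorffMeasure_image_le (d := 1) zero_le_one
  rw [ENNReal.rpow_one, hausdorffMeasure_real, hinj.invFunOn_image Subset.rfl] at this
  calc ENNReal.ofReal k * volume D
      ≤ ENNReal.ofReal k * ((k⁻¹).toNNReal * μH[1] (γ '' D)) := by gcongr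
    _ = μH[1] (γ '' D) := by
      rw [← mul_assoc]
      have : ENNReal.ofReal k * ((k⁻¹).toNNReal : ℝ≥0∞) = 1 := by
        change ENNReal.ofReal k * ENNReal.ofReal k⁻¹ = 1
        rw [← ENNReal.ofReal_mul hk.le, mul_inv_cancel₀ hk.ne', ENNReal.ofReal_one]
      rw [this, one_mul]

/-- The length of an injective curve is the integral of its speed. -/
theorem hausdorffMeasure_curve {γ : ℝ → X} {c : ℝ → ℝ} {I : Set ℝ}
    (hinj : InjOn γ I) (hc : ContinuousOn c I) (hIo : IsOpen I)
    (hs : ∀ v ∈ I, HasMetricSpeedAt γ (c v) v) (hc0 : ∀ v ∈ I, 0 ≤ c v) {B : Set ℝ} (hB : MeasurableSet B)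
    (hBI : B ⊆ I) (hfin : volume B ≠ ⊤) :
    μH[1] (γ '' B) = ∫⁻ v in B, ENNReal.ofReal (c v) := by
  rcases I.eq_empty_or_nonempty with rfl | hIne
  · simp [subset_empty_iff.1 hBI]
  have hcont : ContinuousOn γ I := fun v hv => (hs v hv).continuousAt.continuousWithinAt
  -- Near v the curve distorts lengths by factors between c(v) - ε and c(v) + ε, and c differs from
  -- c(v) by at most ε; together these account for the error 2ε per unit of parameter length.
  have key : ∀ ε > 0, μH[1] (γ '' B) ≤ (∫⁻ v in B, ENNReal.ofReal (c v)) + ENNReal.ofReal (2 * ε) * volume B ∧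
      (∫⁻ v in B, ENNReal.ofReal (c v)) ≤ μH[1] (γ '' B) + ENNReal.ofReal (2 * ε) * volume B := by
    intro ε hε
    have hloc : ∀ v ∈ I, ∃ J : Set ℝ, IsOpen J ∧ v ∈ J ∧ ∀ D ⊆ J ∩ I, MeasurableSet D →
        μH[1] (γ '' D) ≤ (∫⁻ v in D, ENNReal.ofReal (c v)) + ENNReal.ofReal (2 * ε) * volume D ∧
        (∫⁻ v in D, ENNReal.ofReal (c v)) ≤ μH[1] (γ '' D) + ENNReal.ofReal (2 * ε) * volume D := by
      intro v hv
      have h1 := hs v hv ε hε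
      obtain ⟨δ, hδ, h1⟩ := Metric.eventually_nhds_iff.1 h1
      have h2 : ∀ᶠ w in 𝓝 v, dist (c w) (c v) < ε :=
        (hc.continuousAt (hIo.mem_nhds hv)) (Metric.ball_mem_nhds _ hε)
      obtain ⟨δ', hδ', h2⟩ := Metric.eventually_nhds_iff.1 h2
      refine ⟨Metric.ball v (min δ δ'), Metric.isOpen_ball,
        Metric.mem_ball_self (lt_min hδ hδ'), fun D hD hDm => ?_⟩
      have hd : ∀ x ∈ D, ∀ y ∈ D, |dist (γ x) (γ y) - c v * (|x - y|)| ≤ ε * |x - y| := by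
        intro x hx y hy
        refine h1 (y := (x, y)) ?_
        have hx' := Metric.mem_ball.1 (hD hx).1
        have hy' := Metric.mem_ball.1 (hD hy).1
        rw [Prod.dist_eq]
        exact max_lt (hx'.trans_le (min_le_left _ _)) (hy'.trans_le (min_le_left _ _))
      have hcd : ∀ x ∈ D, |c x - c v| ≤ ε := fun x hx => by
        have := h2 ((Metric.mem_ball.1 (hD hx).1).trans_le (min_le_right _ _))
        exact this.le
      constructor
      · have := hausdorffMeasure_image_le_of_dist_le (k := c v + ε)
          (fun x hx y hy => by have := (abs_le.1 (hd x hx y hy)).2; linarith)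
          (by have := hc0 v hv; linarith)
        refine this.trans ?_
        rw [← setLIntegral_const, ← setLIntegral_const, ← lintegral_add_right _ measurable_const]
        refine setLIntegral_mono' hDm fun x hx => ?_
        rw [← ENNReal.ofReal_add (hc0 x (hD hx).2) (by positivity)]
        apply ENNReal.ofReal_le_ofReal
        have := (abs_le.1 (hcd x hx)).1
        linarith
      · have := le_hausdorffMeasure_image_of_le_dist (γ := γ) (D := D) (k := c v - ε)
          (fun x hx y hy => by have := (abs_le.1 (hd x hx y hy)).1; linarith)
        refine le_trans ?_ (add_le_add_left this _)
        rw [← setLIntegral_const, ← setLIntegral_const, ← lintegral_add_right _ measurable_const]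
        refine setLIntegral_mono' hDm fun x hx => ?_
        refine le_trans (ENNReal.ofReal_le_ofReal ?_) ENNReal.ofReal_add_le
        have := (abs_le.1 (hcd x hx)).2
        linarith
    choose! J hJo hJv hJ using hloc
    -- Countably many of the neighbourhoods cover `I`; made disjoint, they cut `B` into pieces on
    -- which the local estimates hold. Injectivity keeps the image pieces disjoint, so all three
    -- quantities are additive.
    obtain ⟨t, htI, htc, ht⟩ := TopologicalSpace.countable_cover_nhdsWithin (s := I) (f := J)
      fun x hx => mem_nhdsWithin_of_mem_nhds ((hJo x hx).mem_nhds (hJv x hx))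
    have htne : t.Nonempty := by
      by_contra h
      rw [not_nonempty_iff_eq_empty] at h
      subst h
      obtain ⟨x, hx⟩ := hIne
      simpa using ht hx
    obtain ⟨f, rfl⟩ := htc.exists_eq_range htne
    have hfI : ∀ n, f n ∈ I := fun n => htI (mem_range_self n)
    set A : ℕ → Set ℝ := fun n => B ∩ disjointed (fun n => J (f n)) n with hA
    have hAm : ∀ n, MeasurableSet (A n) := fun n =>
      hB.inter (MeasurableSet.disjointed (fun i => (hJo _ (hfI i)).measurableSet) n)
    have hAd : Pairwise (Function.onFun Disjoint A) := fun i j hij =>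
      ((disjoint_disjointed _) hij).mono inter_subset_right inter_subset_right
    have hAU : B = ⋃ n, A n := by
      rw [← inter_iUnion, iUnion_disjointed, eq_comm, inter_eq_left]
      rw [biUnion_range] at ht
      exact hBI.trans ht
    have hAB : ∀ n, A n ⊆ B := fun n => inter_subset_left
    have hAJ : ∀ n, A n ⊆ J (f n) ∩ I := fun n x hx =>
      ⟨disjointed_subset _ n hx.2, hBI hx.1⟩
    have hmeas : ∀ n, MeasurableSet (γ '' A n) := fun n =>
      (hAm n).image_of_continuousOn_injOn (hcont.mono fun x hx => (hAJ n hx).2)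
        (hinj.mono fun x hx => (hAJ n hx).2)
    have hdis : Pairwise (Function.onFun Disjoint fun n => γ '' A n) := by
      intro i j hij
      refine disjoint_image_image ?_
      intro x hx y hy hxy
      have := hinj (hAJ i hx).2 (hAJ j hy).2 hxy
      subst this
      exact disjoint_left.1 (hAd hij) hx hy
    have e1 : μH[1] (γ '' B) = ∑' n, μH[1] (γ '' A n) := by
      conv_lhs => rw [hAU, image_iUnion]
      exact measure_iUnion hdis hmeas
    have e2 : ∫⁻ v in B, ENNReal.ofReal (c v) = ∑' n, ∫⁻ v in A n, ENNReal.ofReal (c v) := by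
      conv_lhs => rw [hAU]
      exact lintegral_iUnion hAm hAd _
    have e3 : ENNReal.ofReal (2 * ε) * volume B = ∑' n, ENNReal.ofReal (2 * ε) * volume (A n) := by
      conv_lhs => rw [hAU, measure_iUnion hAd hAm]
      exact ENNReal.tsum_mul_left.symm
    rw [e1, e2, e3, ← ENNReal.tsum_add, ← ENNReal.tsum_add]
    exact ⟨ENNReal.tsum_le_tsum fun n => (hJ _ (hfI n) _ (hAJ n) (hAm n)).1,
      ENNReal.tsum_le_tsum fun n => (hJ _ (hfI n) _ (hAJ n) (hAm n)).2⟩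
  -- Finiteness of the volume of `B` is what makes the error term disappear as ε → 0.
  have hlim : ∀ a : ℝ≥0∞, Tendsto (fun ε : ℝ => a + ENNReal.ofReal (2 * ε) * volume B) (𝓝[>] 0) (𝓝 a) := by
    intro a
    have h1 : Tendsto (fun ε : ℝ => ENNReal.ofReal (2 * ε)) (𝓝[>] 0) (𝓝 0) := by
      have : Continuous fun ε : ℝ => ENNReal.ofReal (2 * ε) :=
        ENNReal.continuous_ofReal.comp (by fun_prop)
      simpa using (this.tendsto 0).mono_left nhdsWithin_le_nhds
    have h2 := ENNReal.Tendsto.mul_const h1 (Or.inr hfin)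
    simpa using tendsto_const_nhds (x := a) |>.add h2
  refine le_antisymm ?_ ?_
  · refine ge_of_tendsto (hlim _) ?_
    filter_upwards [self_mem_nhdsWithin] with ε hε using (key ε hε).1
  · refine ge_of_tendsto (hlim _) ?_
    filter_upwards [self_mem_nhdsWithin] with ε hε using (key ε hε).2

/-- The length formula for arbitrary measurable parameter sets, stated as an equality of measures so
that line integrals can be pulled back to the parameter interval. -/
theorem restrict_hausdorffMeasure_curve {γ : ℝ → X} {c : ℝ → ℝ} {I : Set ℝ}
    (hinj : InjOn γ I) (hc : ContinuousOn c I) (hIo : IsOpen I)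
    (hs : ∀ v ∈ I, HasMetricSpeedAt γ (c v) v) (hc0 : ∀ v ∈ I, 0 ≤ c v)
    (hfin : volume I ≠ ⊤) :
    MeasurableSet (γ '' I) ∧ AEMeasurable γ ((volume.restrict I).withDensity fun v => ENNReal.ofReal (c v)) ∧
    (μH[1] : Measure X).restrict (γ '' I) =
      Measure.map γ ((volume.restrict I).withDensity fun v => ENNReal.ofReal (c v)) := by
  have hcont : ContinuousOn γ I := fun v hv => (hs v hv).continuousAt.continuousWithinAt
  have hm : MeasurableSet (γ '' I) := hIo.measurableSet.image_of_continuousOn_injOn hcont hinj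
  have hae : AEMeasurable γ ((volume.restrict I).withDensity fun v => ENNReal.ofReal (c v)) :=
    (hcont.aemeasurable₀ hIo.measurableSet.nullMeasurableSet).mono_ac (withDensity_absolutelyContinuous _ _)
  refine ⟨hm, hae, ?_⟩
  ext s hs'
  have hpre : MeasurableSet (I ∩ γ ⁻¹' s) := by
    have := (continuousOn_iff_continuous_domRestrict.1 hcont).measurable hs'
    have h2 := hIo.measurableSet.subtype_image this
    convert h2 using 1
    ext x
    simp [and_comm]
  have himg : s ∩ γ '' I = γ '' (I ∩ γ ⁻¹' s) := by
    rw [inter_comm, image_inter_preimage]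
  have hnull : ∀ t : Set ℝ, ((volume.restrict I).withDensity fun v => ENNReal.ofReal (c v)) t =
      ((volume.restrict I).withDensity fun v => ENNReal.ofReal (c v)) (I ∩ t) := by
    intro t
    refine measure_congr ?_
    have : ∀ᵐ v ∂((volume.restrict I).withDensity fun v => ENNReal.ofReal (c v)), v ∈ I :=
      (withDensity_absolutelyContinuous _ _).ae_le (ae_restrict_mem hIo.measurableSet)
    filter_upwards [this] with v hv
    exact propext ⟨fun h => ⟨hv, h⟩, fun h => h.2⟩
  rw [Measure.restrict_apply hs', Measure.map_apply_of_aemeasurable hae hs', himg, hnull,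
    withDensity_apply _ hpre, Measure.restrict_restrict hpre, inter_right_comm, inter_self]
  exact hausdorffMeasure_curve hinj hc hIo hs hc0 hpre inter_subset_left
    (measure_ne_top_of_subset inter_subset_left hfin)

end CurveLength

/-! ### Homogeneous functions and local defining functions of a regular region. -/

/-- The derivative of a homogeneous map is homogeneous. -/
lemma HasFDerivWithinAt.smul_of_homogeneous {G : Type*} [NormedAddCommGroup G] [NormedSpace ℝ G]
    {f : E3 → G} {S : Set Sph} {L : E3 →L[ℝ] G} {x : E3} {c d : ℝ} (hc : 0 < c)
    (hf : ∀ y ∈ cone S, f (c • y) = d • f y) (hx : x ∈ cone S)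
    (h : HasFDerivWithinAt f L (cone S) x) :
    HasFDerivWithinAt f ((d * c⁻¹) • L) (cone S) (c • x) := by
  have h1 : HasFDerivWithinAt (fun y : E3 => c⁻¹ • y) (c⁻¹ • ContinuousLinearMap.id ℝ E3)
      (cone S) (c • x) := ((hasFDerivAt_id _).const_smul c⁻¹).hasFDerivWithinAt
  have h2 : HasFDerivWithinAt f L (cone S) (c⁻¹ • c • x) := by
    rwa [inv_smul_smul₀ hc.ne']
  have h3 := (h2.comp (c • x) h1 fun y hy => (smul_mem_cone (inv_pos.2 hc)).2 hy).const_smul d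
  have h4 : HasFDerivWithinAt f (d • L.comp (c⁻¹ • ContinuousLinearMap.id ℝ E3)) (cone S)
      (c • x) := by
    refine h3.congr (fun y hy => ?_) ?_
    · simp only [Pi.smul_apply, Function.comp]
      rw [← hf _ ((smul_mem_cone (inv_pos.2 hc)).2 hy), smul_inv_smul₀ hc.ne']
    · simp only [Pi.smul_apply, Function.comp, inv_smul_smul₀ hc.ne']
      exact hf x hx
  have heq : d • L.comp (c⁻¹ • ContinuousLinearMap.id ℝ E3) = (d * c⁻¹) • L :=
    ContinuousLinearMap.ext fun y => by
      simp only [smul_apply, ContinuousLinearMap.comp_apply,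
        ContinuousLinearMap.id_apply, map_smul, smul_smul]
  rwa [heq] at h4

lemma cone_univ : cone univ = {x | x ≠ 0} := by
  ext x
  simp [mem_cone]

lemma closure_cone {S : Set Sph} {x : E3} (hx : x ≠ 0) :
    x ∈ cone (closure S) ↔ x ∈ closure (cone S) := by
  constructor
  · intro h
    have h1 : Continuous fun η : Sph => ‖x‖ • (η : E3) := by fun_prop
    have h2 := map_mem_closure h1 h.2 (t := cone S) fun η hη =>
      (smul_mem_cone (norm_pos_iff.2 hx)).2 (coe_mem_cone.2 hη)
    rwa [norm_smul_proj] at h2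
  · intro h
    refine ⟨hx, ?_⟩
    have := (continuousAt_proj hx).continuousWithinAt.mem_closure_image h
    exact closure_mono (by rintro _ ⟨y, hy, rfl⟩; exact hy.2) this

/-- `Φ` is a regular `C²` function defining `Γ` near the ray through `y`. -/
structure DefinesAt (Γ : Set Sph) (Φ : E3 → ℝ) (y : E3) : Prop where
  ne_zero : y ≠ 0
  contDiffAt : ContDiffAt ℝ 2 Φ y
  gradient_ne : gradient Φ y ≠ 0
  mem_iff : y ∈ cone Γ ↔ Φ y < 0
  mem_closure_iff : y ∈ cone (closure Γ) ↔ Φ y ≤ 0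

lemma DefinesAt.differentiableAt {Γ : Set Sph} {Φ : E3 → ℝ} {y : E3} (h : DefinesAt Γ Φ y) :
    DifferentiableAt ℝ Φ y := h.contDiffAt.differentiableAt (by norm_num)

lemma mem_cone_frontier_iff {Γ : Set Sph} (hΓ : IsOpen Γ) {y : E3} :
    y ∈ cone (frontier Γ) ↔ y ∈ cone (closure Γ) ∧ y ∉ cone Γ := by
  rw [hΓ.frontier_eq]
  simp only [mem_cone, Set.mem_sdiff]
  tauto

lemma DefinesAt.mem_frontier_iff {Γ : Set Sph} (hΓ : IsOpen Γ) {Φ : E3 → ℝ} {y : E3}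
    (h : DefinesAt Γ Φ y) : y ∈ cone (frontier Γ) ↔ Φ y = 0 := by
  rw [mem_cone_frontier_iff hΓ, h.mem_iff, h.mem_closure_iff, not_lt]
  exact ⟨fun h => le_antisymm h.1 h.2, fun h => ⟨h.le, h.ge⟩⟩

lemma eventually_pos_of_inner_gradient_pos {Φ : E3 → ℝ} {y z : E3} (h : DifferentiableAt ℝ Φ y)
    (h0 : Φ y = 0) (hz : 0 < inner ℝ (gradient Φ y) z) : ∀ᶠ t : ℝ in 𝓝[>] 0, 0 < Φ (y + t • z) := by
  have h1 : HasDerivAt (fun t : ℝ => Φ (y + t • z)) (inner ℝ (gradient Φ y) z) 0 := by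
    have h2 : HasDerivAt (fun t : ℝ => y + t • z) z 0 := by
      simpa using ((hasDerivAt_id (0 : ℝ)).smul_const z).const_add y
    have h3 : HasFDerivAt Φ (fderiv ℝ Φ y) (y + (0 : ℝ) • z) := by simpa using h.hasFDerivAt
    have := h3.comp_hasDerivAt (0 : ℝ) h2
    rwa [← inner_gradient_left] at this
  have h4 := (hasDerivAt_iff_tendsto_slope.1 h1).eventually (lt_mem_nhds hz)
  have h5 : 𝓝[>] (0 : ℝ) ≤ 𝓝[≠] 0 := nhdsWithin_mono _ fun t ht => (ne_of_gt ht : t ≠ 0)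
  filter_upwards [h5 h4, self_mem_nhdsWithin] with t ht ht0
  have ht0' : 0 < t := ht0
  rw [slope_def_field, zero_smul, add_zero, h0, sub_zero, sub_zero] at ht
  exact (div_pos_iff_of_pos_right ht0').1 ht

lemma eventually_neg_of_inner_gradient_neg {Φ : E3 → ℝ} {y z : E3} (h : DifferentiableAt ℝ Φ y)
    (h0 : Φ y = 0) (hz : inner ℝ (gradient Φ y) z < 0) : ∀ᶠ t : ℝ in 𝓝[>] 0, Φ (y + t • z) < 0 := by
  have hg : gradient (-Φ) y = - gradient Φ y := by
    simp [gradient, fderiv_neg]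
  have := eventually_pos_of_inner_gradient_pos (Φ := -Φ) (z := z) h.neg (by simp [h0])
    (by rw [hg, inner_neg_left]; linarith)
  filter_upwards [this] with t ht
  simpa using ht

/-- Near every boundary point a regular region is defined by a function constant along rays. -/
theorem IsRegularRegion.exists_definesAt {Γ : Set Sph} (hΓ : IsRegularRegion Γ) {x : E3}
    (hx : x ∈ cone (frontier Γ)) :
    ∃ Φ : E3 → ℝ, (∀ c : ℝ, 0 < c → ∀ y, Φ (c • y) = Φ y) ∧ ∀ᶠ y in 𝓝 x, DefinesAt Γ Φ y := by
  obtain ⟨φ, hφ, hφ0, hφΓ⟩ := hΓ.boundary _ hx.2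
  have hx0 := hx.1
  have hnx : 0 < ‖x‖⁻¹ := inv_pos.2 (norm_pos_iff.2 hx0)
  have hom : ∀ c : ℝ, 0 < c → ∀ y, radialExt φ (c • y) = radialExt φ y := fun c hc y =>
    radialExt_smul φ hc y
  rw [coe_proj hx0] at hφ
  have hC : ContDiffAt ℝ 2 (radialExt φ) x := by
    have h1 : ContDiffAt ℝ 2 (fun y : E3 => ‖x‖⁻¹ • y) x := by fun_prop
    refine (hφ.comp x h1).congr_of_eventuallyEq (Eventually.of_forall fun y => ?_)
    simp only [Function.comp, hom _ hnx]
  have hG : gradient (radialExt φ) x ≠ 0 := by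
    intro h
    -- The ray-constant extension has, up to a positive factor, the same gradient along a ray; if it
    -- vanished at `x`, the surface gradient of φ would vanish at `proj x`.
    apply hφ0
    have h1 : HasFDerivWithinAt (radialExt φ) (0 : E3 →L[ℝ] ℝ) (cone univ) x := by
      have h2 := (hC.differentiableAt (by norm_num)).hasGradientAt
      rw [h, hasGradientAt_iff_hasFDerivAt] at h2
      simpa using h2.hasFDerivWithinAt
    have h3 := HasFDerivWithinAt.smul_of_homogeneous (d := 1) hnx
      (fun y _ => by rw [one_smul, hom _ hnx]) (by simpa [cone_univ] using hx0) h1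
    rw [smul_zero, ← coe_proj hx0] at h3
    have hu : UniqueDiffWithinAt ℝ (cone univ) (proj x : E3) :=
      (isOpen_cone isOpen_univ).uniqueDiffWithinAt (coe_mem_cone.2 (mem_univ _))
    rw [surfGrad, gradientWithin, h3.fderivWithin hu, map_zero]
  have hgc : ContinuousAt (gradient (radialExt φ)) x := by
    have h1 : ContinuousAt (fderiv ℝ (radialExt φ)) x :=
      (hC.fderiv_right (m := 0) (by norm_num)).continuousAt
    exact (LinearIsometryEquiv.continuous _).continuousAt.comp h1
  have hev1 : ∀ᶠ y in 𝓝 x, ContDiffAt ℝ 2 (radialExt φ) y := hC.eventually (by simp)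
  have hev2 : ∀ᶠ y in 𝓝 x, gradient (radialExt φ) y ≠ 0 := hgc.eventually_ne hG
  have hev3 : ∀ᶠ y in 𝓝 x, y ≠ 0 := isOpen_ne.mem_nhds hx0
  have hev4 : ∀ᶠ y in 𝓝 x, (proj y ∈ Γ ↔ φ (proj y) < 0) := (continuousAt_proj hx0).eventually hφΓ
  have hev := (hev1.and (hev2.and (hev3.and hev4)))
  refine ⟨radialExt φ, hom, ?_⟩
  have hmem : ∀ y, y ≠ 0 → (proj y ∈ Γ ↔ φ (proj y) < 0) → (y ∈ cone Γ ↔ radialExt φ y < 0) := by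
    intro y hy h
    rw [mem_cone, h]
    simp [hy, radialExt]
  filter_upwards [hev, hev.eventually_nhds] with y ⟨hy1, hy2, hy3, hy4⟩ hy
  refine ⟨hy3, hy1, hy2, hmem y hy3 hy4, ?_⟩
  have hdiff : DifferentiableAt ℝ (radialExt φ) y := hy1.differentiableAt (by norm_num)
  rw [closure_cone hy3]
  constructor
  · intro h
    by_contra hpos
    rw [not_le] at hpos
    have h1 : ∀ᶠ z in 𝓝 y, 0 < radialExt φ z := hy1.continuousAt.eventually (lt_mem_nhds hpos)
    rw [mem_closure_iff_frequently] at h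
    obtain ⟨z, hz, hz1, -, -, hz3, hz4⟩ := (h.and_eventually (h1.and hy)).exists
    exact absurd ((hmem z hz3 hz4).1 hz) (not_lt.2 hz1.le)
  · intro h
    rcases h.lt_or_eq with h | h
    · exact subset_closure ((hmem y hy3 hy4).2 h)
    -- A zero of Φ is reached from Γ along the direction of steepest descent, where Φ becomes
    -- negative at once. Hence the closure is exactly {Φ ≤ 0} near the boundary.
    · have hneg : inner ℝ (gradient (radialExt φ) y) (-gradient (radialExt φ) y) < 0 := by
        rw [inner_neg_right]
        exact neg_lt_zero.2 (real_inner_self_pos.2 hy2)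
      have h1 := eventually_neg_of_inner_gradient_neg hdiff h hneg
      have h2 : Tendsto (fun t : ℝ => y + t • (-gradient (radialExt φ) y)) (𝓝[>] 0) (𝓝 y) := by
        have : Continuous fun t : ℝ => y + t • (-gradient (radialExt φ) y) := by fun_prop
        simpa using (this.tendsto 0).mono_left nhdsWithin_le_nhds
      refine mem_closure_of_tendsto h2 ?_
      filter_upwards [h1, h2.eventually hy] with t ht1 ht2
      exact (hmem _ ht2.2.2.1 ht2.2.2.2).2 ht1

/-- At a boundary point the closed region contains a small open convex cone with vertex there,
opening against the gradient of the defining function. Derivatives within the closed cone are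
therefore unique, which is what gives one-sided derivatives at the boundary a meaning. -/
theorem IsRegularRegion.uniqueDiffOn {Γ : Set Sph} (hΓ : IsRegularRegion Γ) :
    UniqueDiffOn ℝ (cone (closure Γ)) := by
  intro y hy
  by_cases hyΓ : y ∈ cone Γ
  · exact ((isOpen_cone hΓ.isOpen).uniqueDiffWithinAt hyΓ).mono (cone_mono subset_closure)
  have hyf : y ∈ cone (frontier Γ) := (mem_cone_frontier_iff hΓ.isOpen).2 ⟨hy, hyΓ⟩
  obtain ⟨Φ, -, hΦ⟩ := hΓ.exists_definesAt hyf
  have hd := hΦ.self_of_nhds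
  have h0 : Φ y = 0 := (hd.mem_frontier_iff hΓ.isOpen).1 hyf
  set w := gradient Φ y with hw
  have hwpos : 0 < ‖w‖ := norm_pos_iff.2 hd.gradient_ne
  have hlit := hd.differentiableAt.hasFDerivAt.isLittleO.bound (half_pos hwpos)
  obtain ⟨δ, hδ, hb⟩ := Metric.eventually_nhds_iff.1 (hlit.and hΦ)
  -- In the ball the first-order Taylor remainder of Φ at `y` is at most ‖w‖/2 · ‖x - y‖, so Φ is
  -- negative on this set. Any factor strictly between 0 and ‖w‖ would serve, since -w must remain
  -- inside.
  set K : Set E3 := {x | ‖w‖ / 2 * ‖x - y‖ + inner ℝ w (x - y) < 0} ∩ Metric.ball y δ with hK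
  have hKC : K ⊆ cone (closure Γ) := by
    rintro x ⟨hx1, hx2⟩
    obtain ⟨hb1, hb2⟩ := hb (Metric.mem_ball.1 hx2)
    rw [hb2.mem_closure_iff]
    rw [h0, sub_zero, ← inner_gradient_left, ← hw, Real.norm_eq_abs] at hb1
    have := (abs_le.1 hb1).2
    have hx1' : ‖w‖ / 2 * ‖x - y‖ + inner ℝ w (x - y) < 0 := hx1
    linarith
  have hKo : IsOpen K := (isOpen_lt (by fun_prop) continuous_const).inter Metric.isOpen_ball
  have hKc : Convex ℝ K := by
    refine Convex.inter ?_ (convex_ball y δ)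
    have h1 : ConvexOn ℝ univ fun x : E3 => ‖w‖ / 2 * ‖x - y‖ + inner ℝ w (x - y) := by
      have h2 : ConvexOn ℝ univ fun x : E3 => ‖x - y‖ := by
        simpa [dist_eq_norm] using convexOn_univ_dist y
      have h3 : ConvexOn ℝ univ fun x : E3 => inner ℝ w (x - y) := by
        refine ⟨convex_univ, fun a _ b _ s t _ _ hst => le_of_eq ?_⟩
        have : s • a + t • b - y = s • (a - y) + t • (b - y) := by
          rw [smul_sub, smul_sub, sub_add_sub_comm, ← add_smul, hst, one_smul]
        simp only [this]
        rw [inner_add_right, inner_smul_right, inner_smul_right, smul_eq_mul, smul_eq_mul]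
      exact (h2.smul (by positivity)).add h3
    simpa using h1.convex_lt 0
  have hKy : y ∈ closure K := by
    have h2 : Tendsto (fun t : ℝ => y + t • (-w)) (𝓝[>] 0) (𝓝 y) := by
      have : Continuous fun t : ℝ => y + t • (-w) := by fun_prop
      simpa using (this.tendsto 0).mono_left nhdsWithin_le_nhds
    refine mem_closure_of_tendsto h2 ?_
    filter_upwards [self_mem_nhdsWithin, h2 (Metric.ball_mem_nhds y hδ)] with t ht htb
    refine ⟨?_, htb⟩
    have ht' : 0 < t := ht
    simp only [mem_ofPred_eq, add_sub_cancel_left, norm_smul, norm_neg, inner_smul_right,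
      inner_neg_right, Real.norm_of_nonneg ht'.le, real_inner_self_eq_norm_sq]
    have : 0 < t * ‖w‖ ^ 2 := by positivity
    nlinarith
  refine UniqueDiffWithinAt.mono ?_ hKC
  have hKne : K.Nonempty := by
    rw [← closure_nonempty_iff]
    exact ⟨y, hKy⟩
  exact uniqueDiffWithinAt_convex hKc (by rwa [hKo.interior_eq]) hKy

lemma DefinesAt.continuousAt_gradient {Γ : Set Sph} {Φ : E3 → ℝ} {y : E3} (h : DefinesAt Γ Φ y) :
    ContinuousAt (gradient Φ) y := by
  have h1 : ContinuousAt (fderiv ℝ Φ) y :=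
    (h.contDiffAt.fderiv_right (m := 0) (by norm_num)).continuousAt
  exact (LinearIsometryEquiv.continuous _).continuousAt.comp h1

lemma inner_gradient_self_of_homogeneous {Φ : E3 → ℝ} (hom : ∀ c : ℝ, 0 < c → ∀ y, Φ (c • y) = Φ y)
    {y : E3} (h : DifferentiableAt ℝ Φ y) : inner ℝ (gradient Φ y) y = 0 := by
  have h1 : HasDerivAt (fun t : ℝ => Φ (t • y)) (inner ℝ (gradient Φ y) y) 1 := by
    have h2 : HasDerivAt (fun t : ℝ => t • y) y 1 := by
      simpa using (hasDerivAt_id (1 : ℝ)).smul_const y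
    have h3 : HasFDerivAt Φ (fderiv ℝ Φ y) ((1 : ℝ) • y) := by simpa using h.hasFDerivAt
    have := h3.comp_hasDerivAt (1 : ℝ) h2
    rwa [← inner_gradient_left] at this
  have h4 : HasDerivAt (fun t : ℝ => Φ (t • y)) 0 1 := by
    refine (hasDerivAt_const (1 : ℝ) (Φ y)).congr_of_eventuallyEq ?_
    filter_upwards [lt_mem_nhds one_pos] with t ht using hom t ht y
  exact h1.unique h4

lemma gradient_smul_of_homogeneous {Φ : E3 → ℝ} (hom : ∀ c : ℝ, 0 < c → ∀ y, Φ (c • y) = Φ y)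
    {y : E3} (hy : y ≠ 0) (h : DifferentiableAt ℝ Φ y) {c : ℝ} (hc : 0 < c) :
    gradient Φ (c • y) = c⁻¹ • gradient Φ y := by
  have h1 := HasFDerivWithinAt.smul_of_homogeneous (S := univ) (d := 1) hc
    (fun z _ => by rw [one_smul, hom _ hc]) (by simpa [cone_univ] using hy)
    h.hasFDerivAt.hasFDerivWithinAt
  have h2 := h1.hasFDerivAt ((isOpen_cone isOpen_univ).mem_nhds
    ((smul_mem_cone hc).2 (by simpa [cone_univ] using hy)))
  rw [gradient, h2.fderiv, one_mul, map_smul, gradient]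

/-! ### Graph charts at the boundary. -/

/-- A regular region as a subgraph in gnomonic coordinates near a boundary point. -/
structure GraphChart (Γ : Set Sph) (Φ : E3 → ℝ) (e : OrthonormalBasis (Fin 3) ℝ E3)
    (g : ℝ → ℝ) (a b : ℝ) : Prop where
  a_pos : 0 < a
  b_pos : 0 < b
  definesAt : ∀ u ∈ Ioo (-a) a, ∀ v ∈ Ioo (-b) b, DefinesAt Γ Φ (gnom e (u, v))
  inner_pos : ∀ u ∈ Ioo (-a) a, ∀ v ∈ Ioo (-b) b, 0 < inner ℝ (gradient Φ (gnom e (u, v))) (e 0)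
  contDiffAt : ∀ v ∈ Ioo (-b) b, ContDiffAt ℝ 2 g v
  abs_lt : ∀ v ∈ Ioo (-b) b, |g v| < a / 3
  zero : g 0 = 0
  deriv_zero : deriv g 0 = 0
  eq_zero : ∀ v ∈ Ioo (-b) b, Φ (gnom e (g v, v)) = 0

lemma ext_inner_basis (e : OrthonormalBasis (Fin 3) ℝ E3) {x y : E3}
    (h : ∀ i, inner ℝ (e i) x = inner ℝ (e i) y) : x = y := by
  rw [← e.sum_repr' x, ← e.sum_repr' y]
  simp only [h]

lemma hasDerivAt_comp_gnom_fst {Φ : E3 → ℝ} (e : OrthonormalBasis (Fin 3) ℝ E3) {u v : ℝ}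
    (h : DifferentiableAt ℝ Φ (gnom e (u, v))) :
    HasDerivAt (fun u => Φ (gnom e (u, v))) (inner ℝ (gradient Φ (gnom e (u, v))) (e 0)) u := by
  have h2 : HasDerivAt (fun u : ℝ => gnom e (u, v)) (e 0) u := by
    simp only [gnom]
    simpa using (((hasDerivAt_id u).smul_const (e 0)).add_const (v • e 1)).add_const (e 2)
  rw [inner_gradient_left]
  exact h.hasFDerivAt.comp_hasDerivAt u h2

lemma hasDerivAt_gnom_graph (e : OrthonormalBasis (Fin 3) ℝ E3) {g : ℝ → ℝ} {v g' : ℝ} (s : ℝ)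
    (hg : HasDerivAt g g' v) :
    HasDerivAt (fun v => gnom e (s + g v, v)) (g' • e 0 + e 1) v := by
  simp only [gnom]
  simpa using (((hg.const_add s).smul_const (e 0)).add
    ((hasDerivAt_id v).smul_const (e 1))).add_const (e 2)

namespace GraphChart

variable {Γ : Set Sph} {Φ : E3 → ℝ} {e : OrthonormalBasis (Fin 3) ℝ E3} {g : ℝ → ℝ} {a b : ℝ}

lemma mem_Ioo (H : GraphChart Γ Φ e g a b) {v : ℝ} (hv : v ∈ Ioo (-b) b) :
    g v ∈ Ioo (-a) a := by
  have h1 := _root_.abs_lt.1 (H.abs_lt v hv)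
  have h2 := H.a_pos
  constructor <;> linarith [h1.1, h1.2]

lemma strictMonoOn (H : GraphChart Γ Φ e g a b) {v : ℝ} (hv : v ∈ Ioo (-b) b) :
    StrictMonoOn (fun u => Φ (gnom e (u, v))) (Ioo (-a) a) := by
  have hd : ∀ u ∈ Ioo (-a) a, HasDerivAt (fun u => Φ (gnom e (u, v)))
      (inner ℝ (gradient Φ (gnom e (u, v))) (e 0)) u := fun u hu =>
    hasDerivAt_comp_gnom_fst e (H.definesAt u hu v hv).differentiableAt
  refine strictMonoOn_of_deriv_pos (convex_Ioo _ _)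
    (fun u hu => (hd u hu).continuousAt.continuousWithinAt) fun u hu => ?_
  rw [interior_Ioo] at hu
  rw [(hd u hu).deriv]
  exact H.inner_pos u hu v hv

lemma mem_cone_iff (H : GraphChart Γ Φ e g a b) {u v : ℝ} (hu : u ∈ Ioo (-a) a)
    (hv : v ∈ Ioo (-b) b) : gnom e (u, v) ∈ cone Γ ↔ u < g v := by
  rw [(H.definesAt u hu v hv).mem_iff, ← H.eq_zero v hv]
  exact (H.strictMonoOn hv).lt_iff_lt hu (H.mem_Ioo hv)

lemma mem_cone_closure_iff (H : GraphChart Γ Φ e g a b) {u v : ℝ} (hu : u ∈ Ioo (-a) a)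
    (hv : v ∈ Ioo (-b) b) : gnom e (u, v) ∈ cone (closure Γ) ↔ u ≤ g v := by
  rw [(H.definesAt u hu v hv).mem_closure_iff, ← H.eq_zero v hv]
  exact (H.strictMonoOn hv).le_iff_le hu (H.mem_Ioo hv)

lemma mem_cone_frontier_iff (H : GraphChart Γ Φ e g a b) (hΓ : IsOpen Γ) {u v : ℝ}
    (hu : u ∈ Ioo (-a) a) (hv : v ∈ Ioo (-b) b) : gnom e (u, v) ∈ cone (frontier Γ) ↔ u = g v := by
  rw [SphericalGreen.mem_cone_frontier_iff hΓ, H.mem_cone_iff hu hv, H.mem_cone_closure_iff hu hv,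
    not_lt]
  exact le_antisymm_iff.symm

lemma hasDerivAt (H : GraphChart Γ Φ e g a b) {v : ℝ} (hv : v ∈ Ioo (-b) b) :
    HasDerivAt g (deriv g v) v :=
  ((H.contDiffAt v hv).differentiableAt (by norm_num)).hasDerivAt

/-- The gradient of the defining function is a positive multiple of the conormal. -/
lemma gradient_eq (H : GraphChart Γ Φ e g a b) (hom : ∀ c : ℝ, 0 < c → ∀ y, Φ (c • y) = Φ y)
    {v : ℝ} (hv : v ∈ Ioo (-b) b) :
    gradient Φ (gnom e (g v, v)) = inner ℝ (gradient Φ (gnom e (g v, v))) (e 0) •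
      (e 0 - deriv g v • e 1 + (deriv g v * v - g v) • e 2) := by
  set w := gradient Φ (gnom e (g v, v)) with hw
  have hD := H.definesAt (g v) (H.mem_Ioo hv) v hv
  have h1 : inner ℝ w (deriv g v • e 0 + e 1) = 0 := by
    have h2 := hasDerivAt_gnom_graph e 0 (H.hasDerivAt hv)
    simp only [zero_add] at h2
    have h3 := hD.differentiableAt.hasFDerivAt.comp_hasDerivAt v h2
    rw [← inner_gradient_left, ← hw] at h3
    have h4 : HasDerivAt (Φ ∘ fun v => gnom e (g v, v)) 0 v := by
      refine (hasDerivAt_const v (0 : ℝ)).congr_of_eventuallyEq ?_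
      filter_upwards [isOpen_Ioo.mem_nhds hv] with t ht using H.eq_zero t ht
    exact h3.unique h4
  have h2 : inner ℝ w (gnom e (g v, v)) = 0 :=
    inner_gradient_self_of_homogeneous hom hD.differentiableAt
  simp only [gnom, inner_add_right, inner_smul_right] at h1 h2
  -- The gradient is orthogonal to the tangent vector (g', 1, 0) of the lifted curve and to its
  -- position vector (g, v, 1). These two relations determine it from its component along `e 0`.
  refine ext_inner_basis e fun i => ?_
  fin_cases i
  · simp [inner_add_right, inner_sub_right, inner_smul_right, real_inner_comm w]
  · simp [inner_add_right, inner_sub_right, inner_smul_right, real_inner_comm w]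
    linarith
  · simp [inner_add_right, inner_sub_right, inner_smul_right, real_inner_comm w]
    linear_combination h2 - v * h1

end GraphChart

/-- Near every boundary point a regular region is a subgraph in gnomonic coordinates. -/
theorem exists_graphChart {Γ : Set Sph} {Φ : E3 → ℝ} {ξ : Sph} (hΓ : IsOpen Γ)
    (hom : ∀ c : ℝ, 0 < c → ∀ y, Φ (c • y) = Φ y)
    (hξ : ξ ∈ frontier Γ) (hΦ : ∀ᶠ y in 𝓝 (ξ : E3), DefinesAt Γ Φ y) :
    ∃ (e : OrthonormalBasis (Fin 3) ℝ E3) (g : ℝ → ℝ) (a b : ℝ), e 2 = ξ ∧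
      gradient Φ ξ = ‖gradient Φ ξ‖ • e 0 ∧ GraphChart Γ Φ e g a b := by
  have hD := hΦ.self_of_nhds
  have h0 : Φ ξ = 0 := (hD.mem_frontier_iff hΓ).1 (coe_mem_cone.2 hξ)
  set w := gradient Φ ξ with hw
  have hwpos : 0 < ‖w‖ := norm_pos_iff.2 hD.gradient_ne
  have hwξ : inner ℝ w (ξ : E3) = 0 := inner_gradient_self_of_homogeneous hom hD.differentiableAt
  obtain ⟨e, he0, he2⟩ : ∃ e : OrthonormalBasis (Fin 3) ℝ E3, e 0 = ‖w‖⁻¹ • w ∧ e 2 = ξ := by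
    set f : Fin 3 → E3 := ![‖w‖⁻¹ • w, 0, ξ] with hf
    have hon : Orthonormal ℝ (({0, 2} : Set (Fin 3)).domRestrict f) := by
      have hf0 : f 0 = ‖w‖⁻¹ • w := rfl
      have hf2 : f 2 = ξ := rfl
      refine ⟨?_, ?_⟩
      · rintro ⟨i, rfl | hi⟩
        · rw [domRestrict_apply, hf0, norm_smul, norm_inv, norm_norm, inv_mul_cancel₀ hwpos.ne']
        · obtain rfl : i = 2 := hi
          rw [domRestrict_apply, hf2, norm_sph]
      · rintro ⟨i, rfl | hi⟩ ⟨j, rfl | hj⟩ hij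
        · exact absurd rfl hij
        · obtain rfl : j = 2 := hj
          simp only [domRestrict_apply, hf0, hf2, inner_smul_left, hwξ, mul_zero]
        · obtain rfl : i = 2 := hi
          rw [domRestrict_apply, domRestrict_apply, hf0, hf2, inner_smul_right, real_inner_comm,
            hwξ, mul_zero]
        · obtain rfl : i = 2 := hi
          obtain rfl : j = 2 := hj
          exact absurd rfl hij
    obtain ⟨e, he⟩ := hon.exists_orthonormalBasis_extension_of_card_eq (by simp)
    exact ⟨e, by rw [he 0 (by simp)]; simp [hf], by rw [he 2 (by simp)]; simp [hf]⟩
  have hwe : w = ‖w‖ • e 0 := by rw [he0, smul_inv_smul₀ hwpos.ne']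
  -- The coordinates are exchanged because the implicit function theorem solves for the second
  -- variable, while the graph is u = g(v).
  set G : ℝ × ℝ → ℝ := fun p => Φ (gnom e (p.2, p.1)) with hG
  have hg00 : gnom e (0, 0) = ξ := by simp [gnom, he2]
  have hGc : ContDiffAt ℝ 2 G (0, 0) := by
    have h1 : ContDiffAt ℝ 2 (fun p : ℝ × ℝ => gnom e (p.2, p.1)) (0, 0) :=
      ((contDiff_gnom e).comp (contDiff_snd.prodMk contDiff_fst)).contDiffAt
    exact ContDiffAt.comp (0, 0) (by rw [hg00]; exact hD.contDiffAt) h1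
  have hGd := (hGc.differentiableAt (by norm_num)).hasFDerivAt
  have hdu : (fderiv ℝ G (0, 0)) (0, 1) = ‖w‖ := by
    have h1 : HasDerivAt (fun u : ℝ => G (0, u)) ((fderiv ℝ G (0, 0)) (0, 1)) 0 :=
      HasFDerivAt.comp_hasDerivAt (0 : ℝ) hGd ((hasDerivAt_const (0 : ℝ) (0 : ℝ)).prodMk
        (hasDerivAt_id (0 : ℝ)))
    have h2 := hasDerivAt_comp_gnom_fst (Φ := Φ) e (u := 0) (v := 0)
      (by rw [hg00]; exact hD.differentiableAt)
    have h3 := h1.unique h2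
    rw [h3, hg00, ← hw, hwe, inner_smul_left]
    simp [norm_smul]
  have hdv : (fderiv ℝ G (0, 0)) (1, 0) = 0 := by
    have h1 : HasDerivAt (fun v : ℝ => G (v, 0)) ((fderiv ℝ G (0, 0)) (1, 0)) 0 :=
      HasFDerivAt.comp_hasDerivAt (f := fun v : ℝ => (v, (0 : ℝ))) (0 : ℝ) hGd
        ((hasDerivAt_id (0 : ℝ)).prodMk (hasDerivAt_const (0 : ℝ) (0 : ℝ)))
    have h2 := hasDerivAt_gnom_graph e (g := fun _ => 0) (v := 0) 0 (hasDerivAt_const _ _)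
    have h3 : HasFDerivAt Φ (fderiv ℝ Φ ξ) (gnom e (0 + 0, 0)) := by
      rw [add_zero, hg00]; exact hD.differentiableAt.hasFDerivAt
    have h4 := h3.comp_hasDerivAt (0 : ℝ) h2
    have h5 : HasDerivAt (fun v : ℝ => G (v, 0)) ((fderiv ℝ Φ ξ) ((0 : ℝ) • e 0 + e 1)) 0 := by
      simpa [Function.comp_def, hG] using h4
    rw [h1.unique h5, ← inner_gradient_left, ← hw, hwe, inner_smul_left]
    simp
  have hinv : (fderiv ℝ G (0, 0) ∘L .inr ℝ ℝ ℝ).IsInvertible := by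
    have : fderiv ℝ G (0, 0) ∘L .inr ℝ ℝ ℝ =
        (ContinuousLinearEquiv.unitsEquivAut ℝ (Units.mk0 ‖w‖ hwpos.ne') : ℝ →L[ℝ] ℝ) := by
      ext
      simp [hdu]
    rw [this]
    exact ContinuousLinearMap.isInvertible_equiv
  have hn2 : (2 : WithTop ℕ∞) ≠ 0 := by norm_num
  set g := hGc.implicitFunction hn2 hinv with hgdef
  have hgz : g 0 = 0 := hGc.implicitFunction_apply_self hn2 hinv
  have hgC : ContDiffAt ℝ 2 g 0 := hGc.contDiffAt_implicitFunction hn2 hinv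
  have hgE : ∀ᶠ v in 𝓝 (0 : ℝ), G (v, g v) = 0 := by
    have := hGc.eventually_apply_implicitFunction hn2 hinv
    filter_upwards [this] with v hv
    rw [hv]
    simp only [hG, hg00, h0]
  have hgd : HasDerivAt g (deriv g 0) 0 := (hgC.differentiableAt (by norm_num)).hasDerivAt
  have hgd0 : deriv g 0 = 0 := by
    have h1 : HasFDerivAt G (fderiv ℝ G (0, 0)) (0, g 0) := by rw [hgz]; exact hGd
    have h2 : HasDerivAt (fun v : ℝ => G (v, g v)) ((fderiv ℝ G (0, 0)) (1, deriv g 0)) 0 :=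
      HasFDerivAt.comp_hasDerivAt (f := fun v : ℝ => (v, g v)) (0 : ℝ) h1 ((hasDerivAt_id (0 : ℝ)).prodMk hgd)
    have h3 : HasDerivAt (fun v : ℝ => G (v, g v)) 0 0 :=
      (hasDerivAt_const (0 : ℝ) (0 : ℝ)).congr_of_eventuallyEq hgE
    have h4 := h2.unique h3
    have h5 : ((1 : ℝ), deriv g 0) = (1, 0) + deriv g 0 • ((0 : ℝ), (1 : ℝ)) := by simp
    rw [h5, map_add, map_smul, hdv, hdu, zero_add, smul_eq_mul] at h4
    exact (mul_eq_zero.1 h4).resolve_right hwpos.ne'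
  have hpos : ∀ᶠ y in 𝓝 (ξ : E3), 0 < inner ℝ (gradient Φ y) (e 0) := by
    have h1 : ContinuousAt (fun y => inner ℝ (gradient Φ y) (e 0)) (ξ : E3) :=
      hD.continuousAt_gradient.inner continuousAt_const
    refine h1.eventually (lt_mem_nhds ?_)
    change 0 < inner ℝ (gradient Φ (ξ : E3)) (e 0)
    rw [← hw, hwe, inner_smul_left]
    simpa using hwpos
  have hbox : ∀ᶠ q in 𝓝 ((0 : ℝ), (0 : ℝ)), DefinesAt Γ Φ (gnom e q) ∧
      0 < inner ℝ (gradient Φ (gnom e q)) (e 0) := by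
    have h1 : Tendsto (gnom e) (𝓝 (0, 0)) (𝓝 (ξ : E3)) := by
      rw [← hg00]
      exact (contDiff_gnom (n := 0) e).continuous.tendsto _
    exact h1.eventually (hΦ.and hpos)
  obtain ⟨a, ha, hbox⟩ := Metric.eventually_nhds_iff.1 hbox
  have hsmall : ∀ᶠ v in 𝓝 (0 : ℝ), |g v| < a / 3 := by
    have h1 : Tendsto (fun v => |g v|) (𝓝 0) (𝓝 |g 0|) := hgC.continuousAt.abs
    rw [hgz, abs_zero] at h1
    exact h1.eventually (gt_mem_nhds (by positivity))
  obtain ⟨b, hb, hball⟩ := Metric.eventually_nhds_iff.1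
    ((hgC.eventually (by simp)).and (hsmall.and hgE))
  -- The first ball, of radius `a` in the maximum norm, also restricts v; hence the half-width min a
  -- b.
  have hq : ∀ u ∈ Ioo (-a) a, ∀ v ∈ Ioo (-(min a b)) (min a b), DefinesAt Γ Φ (gnom e (u, v)) ∧
      0 < inner ℝ (gradient Φ (gnom e (u, v))) (e 0) := by
    intro u hu v hv
    refine hbox (y := (u, v)) ?_
    rw [Prod.dist_eq, max_lt_iff, Real.dist_eq, Real.dist_eq, sub_zero, sub_zero]
    exact ⟨abs_lt.2 hu, (abs_lt.2 hv).trans_le (min_le_left _ _)⟩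
  have hv' : ∀ v ∈ Ioo (-(min a b)) (min a b), dist v 0 < b := by
    intro v hv
    rw [Real.dist_eq, sub_zero]
    exact (abs_lt.2 hv).trans_le (min_le_right _ _)
  refine ⟨e, g, a, min a b, he2, hwe, ha, lt_min ha hb, fun u hu v hv => (hq u hu v hv).1,
    fun u hu v hv => (hq u hu v hv).2, fun v hv => (hball (hv' v hv)).1,
    fun v hv => (hball (hv' v hv)).2.1, hgz, hgd0, fun v hv => (hball (hv' v hv)).2.2⟩

/-! ### The boundary curve and the line element. -/

/-- The boundary curve of a subgraph in gnomonic coordinates. -/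
def graphCurve (e : OrthonormalBasis (Fin 3) ℝ E3) (g : ℝ → ℝ) (v : ℝ) : Sph :=
  proj (gnom e (g v, v))

/-- A vector normal to the cone over the boundary curve. -/
def conormal (e : OrthonormalBasis (Fin 3) ℝ E3) (g : ℝ → ℝ) (v : ℝ) : E3 :=
  e 0 - deriv g v • e 1 + (deriv g v * v - g v) • e 2

/-- The speed of the boundary curve. -/
def graphSpeed (e : OrthonormalBasis (Fin 3) ℝ E3) (g : ℝ → ℝ) (v : ℝ) : ℝ :=
  ‖conormal e g v‖ * (rho (g v, v))⁻¹ ^ 2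

lemma inner_conormal (e : OrthonormalBasis (Fin 3) ℝ E3) (g : ℝ → ℝ) (v : ℝ) :
    inner ℝ (e 0) (conormal e g v) = 1 ∧ inner ℝ (e 1) (conormal e g v) = -deriv g v ∧
      inner ℝ (e 2) (conormal e g v) = deriv g v * v - g v := by
  simp [conormal, inner_add_right, inner_sub_right, inner_smul_right]

lemma norm_conormal_pos (e : OrthonormalBasis (Fin 3) ℝ E3) (g : ℝ → ℝ) (v : ℝ) :
    0 < ‖conormal e g v‖ := by
  refine norm_pos_iff.2 fun h => ?_
  simpa [h] using (inner_conormal e g v).1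

lemma graphSpeed_pos (e : OrthonormalBasis (Fin 3) ℝ E3) (g : ℝ → ℝ) (v : ℝ) :
    0 < graphSpeed e g v :=
  mul_pos (norm_conormal_pos e g v) (pow_pos (inv_pos.2 (rho_pos _)) 2)

lemma hasDerivAt_rho {p q : ℝ → ℝ} {p' q' t : ℝ} (hp : HasDerivAt p p' t) (hq : HasDerivAt q q' t) :
    HasDerivAt (fun t => (rho (p t, q t))⁻¹)
      (-(p t * p' + q t * q') * (rho (p t, q t))⁻¹ ^ 3) t := by
  have h1 : HasDerivAt (fun t => 1 + p t ^ 2 + q t ^ 2)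
      (2 * p t * p' + 2 * q t * q') t := by
    refine (((hp.fun_pow 2).const_add 1).fun_add (hq.fun_pow 2)).congr_deriv ?_
    simp
  have hpos : (0 : ℝ) < 1 + p t ^ 2 + q t ^ 2 := by positivity
  have h2 := (h1.sqrt hpos.ne').inv (Real.sqrt_pos.2 hpos).ne'
  have h3 : √(1 + p t ^ 2 + q t ^ 2) ≠ 0 := (Real.sqrt_pos.2 hpos).ne'
  refine (h2.congr_deriv ?_).congr_of_eventuallyEq (Eventually.of_forall fun _ => rfl)
  simp only [rho]
  field_simp

lemma hasDerivAt_graphCurve (e : OrthonormalBasis (Fin 3) ℝ E3) {g : ℝ → ℝ} {v : ℝ}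
    (hg : HasDerivAt g (deriv g v) v) :
    HasDerivAt (fun v => (graphCurve e g v : E3))
      ((rho (g v, v))⁻¹ • (deriv g v • e 0 + e 1) +
        (-(g v * deriv g v + v) * (rho (g v, v))⁻¹ ^ 3) • gnom e (g v, v)) v := by
  simp only [graphCurve, coe_proj_gnom]
  have h1 := hasDerivAt_rho hg (hasDerivAt_id v)
  have h2 := hasDerivAt_gnom_graph e 0 hg
  simp only [zero_add] at h2
  refine (h1.fun_smul h2).congr_deriv ?_
  simp

/-- For a curve γ in space, the speed of γ/|γ| is |γ' ∧ γ| / |γ|². Here γ = (g, v, 1) and γ' = (g',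
1, 0), so γ' ∧ γ is `conormal` and |γ| is `rho`. -/
lemma norm_deriv_graphCurve (e : OrthonormalBasis (Fin 3) ℝ E3) {g : ℝ → ℝ} {v : ℝ}
    (hg : HasDerivAt g (deriv g v) v) :
    ‖deriv (fun v => (graphCurve e g v : E3)) v‖ = graphSpeed e g v := by
  rw [(hasDerivAt_graphCurve e hg).deriv,
    ← sq_eq_sq₀ (norm_nonneg _) (graphSpeed_pos e g v).le, graphSpeed, mul_pow,
    norm_sq_eq_sum e, norm_sq_eq_sum e (conormal e g v)]
  obtain ⟨h0, h1, h2⟩ := inner_conormal e g v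
  rw [h0, h1, h2]
  simp only [inner_add_right, inner_smul_right, inner_gnom_zero, inner_gnom_one, inner_gnom_two,
    inner_basis]
  simp only [Fin.isValue, reduceIte, Fin.reduceEq]
  have hr := rho_sq (g v, v)
  simp only at hr
  have hr0 := (rho_pos (g v, v)).ne'
  set r := rho (g v, v)
  set d := deriv g v
  field_simp
  simp only [hr]
  ring

/-- The part of the sphere covered by a box in gnomonic coordinates. -/
def chartBox (e : OrthonormalBasis (Fin 3) ℝ E3) (a b : ℝ) : Set Sph :=
  {η | 0 < inner ℝ (e 2) (η : E3) ∧ |inner ℝ (e 0) (η : E3)| < a * inner ℝ (e 2) (η : E3) ∧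
    |inner ℝ (e 1) (η : E3)| < b * inner ℝ (e 2) (η : E3)}

lemma isOpen_chartBox (e : OrthonormalBasis (Fin 3) ℝ E3) (a b : ℝ) : IsOpen (chartBox e a b) := by
  have h : ∀ i, Continuous fun η : Sph => inner ℝ (e i) (η : E3) := fun i => by fun_prop
  exact (isOpen_lt continuous_const (h 2)).inter
    ((isOpen_lt (h 0).abs (continuous_const.mul (h 2))).inter
      (isOpen_lt (h 1).abs (continuous_const.mul (h 2))))

lemma inner_proj_gnom (e : OrthonormalBasis (Fin 3) ℝ E3) (q : ℝ × ℝ) :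
    inner ℝ (e 0) (proj (gnom e q) : E3) = (rho q)⁻¹ * q.1 ∧
    inner ℝ (e 1) (proj (gnom e q) : E3) = (rho q)⁻¹ * q.2 ∧
    inner ℝ (e 2) (proj (gnom e q) : E3) = (rho q)⁻¹ := by
  simp only [coe_proj_gnom, inner_smul_right, inner_gnom_zero, inner_gnom_one, inner_gnom_two,
    mul_one, and_self]

lemma proj_gnom_injective (e : OrthonormalBasis (Fin 3) ℝ E3) :
    Function.Injective fun q => proj (gnom e q) := by
  intro q p h
  simp only at h
  obtain ⟨h0, h1, h2⟩ := inner_proj_gnom e q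
  obtain ⟨h0', h1', h2'⟩ := inner_proj_gnom e p
  rw [h] at h0 h1 h2
  have hr := h2.symm.trans h2'
  have h3 := h0.symm.trans h0'
  have h4 := h1.symm.trans h1'
  rw [hr] at h3 h4
  have hp := (inv_pos.2 (rho_pos p)).ne'
  exact Prod.ext (mul_left_cancel₀ hp h3) (mul_left_cancel₀ hp h4)

lemma proj_gnom_mem_chartBox {e : OrthonormalBasis (Fin 3) ℝ E3} {a b u v : ℝ} :
    proj (gnom e (u, v)) ∈ chartBox e a b ↔ u ∈ Ioo (-a) a ∧ v ∈ Ioo (-b) b := by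
  obtain ⟨h0, h1, h2⟩ := inner_proj_gnom e (u, v)
  have hr := inv_pos.2 (rho_pos (u, v))
  simp only [chartBox, mem_ofPred_eq, h0, h1, h2, abs_mul, abs_of_pos hr, hr, true_and]
  rw [mul_comm a, mul_comm b, mul_lt_mul_iff_right₀ hr, mul_lt_mul_iff_right₀ hr, abs_lt, abs_lt]
  rfl

lemma exists_eq_proj_gnom {e : OrthonormalBasis (Fin 3) ℝ E3} {η : Sph}
    (h : 0 < inner ℝ (e 2) (η : E3)) : ∃ q, η = proj (gnom e q) := by
  refine ⟨(inner ℝ (e 0) (η : E3) / inner ℝ (e 2) (η : E3),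
    inner ℝ (e 1) (η : E3) / inner ℝ (e 2) (η : E3)), ?_⟩
  have h1 : gnom e (inner ℝ (e 0) (η : E3) / inner ℝ (e 2) (η : E3),
      inner ℝ (e 1) (η : E3) / inner ℝ (e 2) (η : E3)) =
      (inner ℝ (e 2) (η : E3))⁻¹ • (η : E3) := by
    refine ext_inner_basis e fun i => ?_
    fin_cases i
    · simp only [Fin.zero_eta, inner_gnom_zero, inner_smul_right]; ring
    · simp only [Fin.mk_one, inner_gnom_one, inner_smul_right]; ring
    · simp only [Fin.reduceFinMk, inner_gnom_two, inner_smul_right]; field_simp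
  rw [h1, proj_smul (inv_pos.2 h), proj_coe]

lemma mem_chartBox_iff {e : OrthonormalBasis (Fin 3) ℝ E3} {a b : ℝ} {η : Sph} :
    η ∈ chartBox e a b ↔ ∃ u ∈ Ioo (-a) a, ∃ v ∈ Ioo (-b) b, η = proj (gnom e (u, v)) := by
  constructor
  · intro h
    obtain ⟨⟨u, v⟩, rfl⟩ := exists_eq_proj_gnom h.1
    have := proj_gnom_mem_chartBox.1 h
    exact ⟨u, this.1, v, this.2, rfl⟩
  · rintro ⟨u, hu, v, hv, rfl⟩
    exact proj_gnom_mem_chartBox.2 ⟨hu, hv⟩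

lemma gnom_mem_cone_iff {e : OrthonormalBasis (Fin 3) ℝ E3} {q : ℝ × ℝ} {S : Set Sph} :
    gnom e q ∈ cone S ↔ proj (gnom e q) ∈ S := by
  rw [mem_cone]
  exact ⟨fun h => h.2, fun h => ⟨gnom_ne_zero e q, h⟩⟩

lemma contDiffAt_graphCurve (e : OrthonormalBasis (Fin 3) ℝ E3) {g : ℝ → ℝ} {v : ℝ}
    (hg : ContDiffAt ℝ 2 g v) : ContDiffAt ℝ 2 (fun v => (graphCurve e g v : E3)) v := by
  have h1 : ContDiffAt ℝ 2 (fun v => gnom e (g v, v)) v :=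
    (contDiff_gnom e).contDiffAt.comp v (hg.prodMk contDiffAt_id)
  exact ContDiffAt.comp (g := fun y => (proj y : E3)) v
    (contDiffAt_proj (gnom_ne_zero e (g v, v))) h1

/-- A C¹ curve is strictly differentiable, which is the two-point estimate that a metric speed
requires. -/
lemma hasMetricSpeedAt_graphCurve (e : OrthonormalBasis (Fin 3) ℝ E3) {g : ℝ → ℝ} {v : ℝ}
    (hg : ContDiffAt ℝ 2 g v) : HasMetricSpeedAt (graphCurve e g) (graphSpeed e g v) v := by
  intro ε hε
  have h1 := (contDiffAt_graphCurve e hg).hasStrictDerivAt (by norm_num)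
  have hg' : HasDerivAt g (deriv g v) v := (hg.differentiableAt (by norm_num)).hasDerivAt
  have h2 := h1.hasStrictFDerivAt.isLittleO.bound hε
  rw [← norm_deriv_graphCurve e hg']
  filter_upwards [h2] with p hp
  rw [Subtype.dist_eq, dist_eq_norm]
  rw [Real.norm_eq_abs, ContinuousLinearMap.toSpanSingleton_apply] at hp
  refine le_trans ?_ hp
  rw [← Real.norm_eq_abs (p.1 - p.2), mul_comm, ← norm_smul]
  exact abs_norm_sub_norm_le _ _

lemma continuousOn_graphSpeed (e : OrthonormalBasis (Fin 3) ℝ E3) {g : ℝ → ℝ} {b : ℝ}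
    (hg : ∀ v ∈ Ioo (-b) b, ContDiffAt ℝ 2 g v) : ContinuousOn (graphSpeed e g) (Ioo (-b) b) := by
  intro v hv
  have h1 : ContinuousAt g v := (hg v hv).continuousAt
  have h2 : ContinuousAt (deriv g) v := by
    exact ((hg v hv).derivWithin (m := 1) (by norm_num)).continuousAt
  have h3 : ContinuousAt (fun v => rho (g v, v)) v :=
    continuous_rho.continuousAt.comp (h1.prodMk continuousAt_id)
  have h4 : ContinuousAt (fun v => (rho (g v, v))⁻¹) v := h3.inv₀ (rho_pos (g v, v)).ne'
  refine ContinuousAt.continuousWithinAt ?_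
  unfold graphSpeed conormal
  exact ContinuousAt.mul (by fun_prop) (h4.pow 2)

namespace GraphChart

variable {Γ : Set Sph} {Φ : E3 → ℝ} {e : OrthonormalBasis (Fin 3) ℝ E3} {g : ℝ → ℝ} {a b : ℝ}

lemma frontier_inter_chartBox (H : GraphChart Γ Φ e g a b) (hΓ : IsOpen Γ) :
    frontier Γ ∩ chartBox e a b = graphCurve e g '' Ioo (-b) b := by
  ext η
  constructor
  · rintro ⟨h1, h2⟩
    obtain ⟨u, hu, v, hv, rfl⟩ := mem_chartBox_iff.1 h2
    rw [← gnom_mem_cone_iff, H.mem_cone_frontier_iff hΓ hu hv] at h1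
    exact ⟨v, hv, by rw [h1, graphCurve]⟩
  · rintro ⟨v, hv, rfl⟩
    refine ⟨?_, proj_gnom_mem_chartBox.2 ⟨H.mem_Ioo hv, hv⟩⟩
    rw [graphCurve, ← gnom_mem_cone_iff, H.mem_cone_frontier_iff hΓ (H.mem_Ioo hv) hv]

/-- The line element in a graph chart. -/
lemma restrict_hausdorffMeasure (H : GraphChart Γ Φ e g a b) (hΓ : IsOpen Γ) :
    AEMeasurable (graphCurve e g)
      ((volume.restrict (Ioo (-b) b)).withDensity fun v => ENNReal.ofReal (graphSpeed e g v)) ∧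
    (lineMeasure Γ).restrict (chartBox e a b) = Measure.map (graphCurve e g)
      ((volume.restrict (Ioo (-b) b)).withDensity fun v => ENNReal.ofReal (graphSpeed e g v)) := by
  have hinj : InjOn (graphCurve e g) (Ioo (-b) b) := fun v _ w _ h =>
    (Prod.ext_iff.1 (proj_gnom_injective e h)).2
  obtain ⟨-, h2, h3⟩ := restrict_hausdorffMeasure_curve hinj (continuousOn_graphSpeed e H.contDiffAt)
    isOpen_Ioo (fun v hv => hasMetricSpeedAt_graphCurve e (H.contDiffAt v hv))
    (fun v _ => (graphSpeed_pos e g v).le) (by simp)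
  refine ⟨h2, ?_⟩
  rw [← h3, lineMeasure, Measure.restrict_restrict (isOpen_chartBox e a b).measurableSet, inter_comm,
    H.frontier_inter_chartBox hΓ]

end GraphChart

/-! ### The outward unit normal. -/

/-- The outward unit normal is the normalized gradient of a defining function. -/
theorem outerNormal_eq {Γ : Set Sph} {Φ : E3 → ℝ} {η : Sph} (hΓ : IsOpen Γ)
    (hom : ∀ c : ℝ, 0 < c → ∀ y, Φ (c • y) = Φ y)
    (hη : η ∈ frontier Γ) (hΦ : ∀ᶠ y in 𝓝 (η : E3), DefinesAt Γ Φ y) :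
    outerNormal Γ η = ‖gradient Φ η‖⁻¹ • gradient Φ η := by
  have hD := hΦ.self_of_nhds
  have h0 : Φ η = 0 := (hD.mem_frontier_iff hΓ).1 (coe_mem_cone.2 hη)
  obtain ⟨e, g, a, b, he2, he0, H⟩ := exists_graphChart hΓ hom hη hΦ
  set w := gradient Φ η with hw
  have hwpos : 0 < ‖w‖ := norm_pos_iff.2 hD.gradient_ne
  have hwe : ‖w‖⁻¹ • w = e 0 := by
    conv_lhs => rw [he0]
    rw [norm_smul, e.norm_eq_one, mul_one, norm_norm, inv_smul_smul₀ hwpos.ne']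
  have hline : ∀ z : E3, Tendsto (fun t : ℝ => (η : E3) + t • z) (𝓝[>] 0) (𝓝 (η : E3)) := by
    intro z
    have : Continuous fun t : ℝ => (η : E3) + t • z := by fun_prop
    simpa using (this.tendsto 0).mono_left nhdsWithin_le_nhds
  have hin : IsOuterUnitNormal Γ η (e 0) := by
    refine ⟨e.norm_eq_one 0, by rw [← he2, inner_basis]; simp, ?_, ?_⟩
    -- Φ vanishes on the boundary near η, so its derivative annihilates every tangent direction of
    -- the boundary.
    · intro z hz
      have h1 := hD.differentiableAt.hasFDerivAt.hasFDerivWithinAt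
        (s := ((↑) : Sph → E3) '' frontier Γ)
      have h2 : HasFDerivWithinAt Φ (0 : E3 →L[ℝ] ℝ) (((↑) : Sph → E3) '' frontier Γ) (η : E3) := by
        refine (hasFDerivWithinAt_const (0 : ℝ) _ _).congr_of_eventuallyEq ?_ h0
        filter_upwards [self_mem_nhdsWithin, mem_nhdsWithin_of_mem_nhds hΦ] with y hy hyD
        obtain ⟨ζ, hζ, rfl⟩ := hy
        exact (hyD.mem_frontier_iff hΓ).1 (coe_mem_cone.2 hζ)
      have h3 := HasFDerivWithinAt.unique_on h1 h2 hz
      rw [← inner_gradient_left, ← hw] at h3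
      rw [← hwe, inner_smul_left, h3]
      simp
    · have hpos : 0 < inner ℝ w (e 0) := by
        rw [he0, inner_smul_left]
        simpa using hwpos
      filter_upwards [eventually_pos_of_inner_gradient_pos hD.differentiableAt h0 hpos,
        (hline (e 0)).eventually hΦ] with t ht htD hmem
      exact absurd (htD.mem_closure_iff.1 ⟨htD.ne_zero, hmem⟩) (not_le.2 ht)
  have huniq : ∀ v, IsOuterUnitNormal Γ η v → v = e 0 := by
    intro v hv
    -- The velocity of the boundary curve at parameter 0 is `e 1`, since g and g' vanish there.
    -- Orthogonality to `e 1` and to `e 2` = η leaves only ± `e 0`.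
    have h1 : inner ℝ v (e 1) = 0 := by
      apply hv.perp_curve
      have hd := hasDerivAt_graphCurve e (H.hasDerivAt (v := 0) ⟨neg_lt_zero.2 H.b_pos, H.b_pos⟩)
      simp only [H.zero, H.deriv_zero, zero_smul, zero_mul, add_zero, neg_zero, zero_add] at hd
      have hr : rho (0, 0) = 1 := by simp [rho]
      rw [hr, inv_one, one_smul] at hd
      have hγ : (graphCurve e g 0 : E3) = η := by
        rw [graphCurve, H.zero]
        simp [gnom, he2, proj_coe]
      have h2 := hd.hasFDerivAt.hasFDerivWithinAt (s := Ioo (-b) b) |>.mapsTo_tangent_cone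
      rw [hγ] at h2
      have h3 : (1 : ℝ) ∈ tangentConeAt ℝ (Ioo (-b) b) 0 := by
        rw [tangentConeAt_of_mem_nhds (Ioo_mem_nhds (neg_lt_zero.2 H.b_pos) H.b_pos)]
        trivial
      have h4 := h2 h3
      simp only [ContinuousLinearMap.toSpanSingleton_apply, one_smul] at h4
      refine tangentConeAt_mono ?_ h4
      rintro _ ⟨s, hs, rfl⟩
      refine ⟨_, ?_, rfl⟩
      have : graphCurve e g s ∈ frontier Γ ∩ chartBox e a b := by
        rw [H.frontier_inter_chartBox hΓ]
        exact ⟨s, hs, rfl⟩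
      exact this.1
    have h2 : inner ℝ v (e 2) = 0 := by rw [he2]; exact hv.perp_point
    set c := inner ℝ v (e 0) with hc
    have hvc : v = c • e 0 := by
      refine ext_inner_basis e fun i => ?_
      rw [inner_smul_right, inner_basis, real_inner_comm]
      fin_cases i
      · simp [hc]
      · simpa using h1
      · simpa using h2
    have hc1 : |c| = 1 := by
      have := hv.norm_eq
      rwa [hvc, norm_smul, e.norm_eq_one, mul_one, Real.norm_eq_abs] at this
    rcases (abs_eq zero_le_one).1 hc1 with h | h
    · rw [hvc, h, one_smul]
    · exfalso
      -- The choice - `e 0` is excluded: Φ decreases in that direction, so one would enter Γ instead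
      -- of the exterior.
      have hneg : inner ℝ w v < 0 := by
        rw [hvc, h, he0, inner_smul_left, inner_smul_right]
        simpa using hwpos
      have hev := (eventually_neg_of_inner_gradient_neg hD.differentiableAt h0 hneg).and
        (((hline v).eventually hΦ).and hv.outward)
      obtain ⟨t, ht, htD, hout⟩ := hev.exists
      exact hout (htD.mem_closure_iff.2 ht.le).2
  have hex : ∃ v, IsOuterUnitNormal Γ η v := ⟨e 0, hin⟩
  rw [outerNormal, dif_pos hex, hwe]
  exact huniq _ hex.choose_spec

/-! ### The divergence theorem in a chart. -/

/-- The divergence of a vector field from the derivative. -/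
def trc (L : E3 →L[ℝ] E3) : ℝ := LinearMap.trace ℝ E3 L

lemma trc_eq_sum (e : OrthonormalBasis (Fin 3) ℝ E3) (L : E3 →L[ℝ] E3) :
    trc L = inner ℝ (e 0) (L (e 0)) + inner ℝ (e 1) (L (e 1)) + inner ℝ (e 2) (L (e 2)) := by
  rw [trc, LinearMap.trace_eq_sum_inner _ e, Fin.sum_univ_three]
  rfl

lemma trc_smul (c : ℝ) (L : E3 →L[ℝ] E3) : trc (c • L) = c * trc L := by
  simp [trc]

lemma trc_add (L M : E3 →L[ℝ] E3) : trc (L + M) = trc L + trc M := by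
  simp [trc]

lemma trc_zero : trc 0 = 0 := by simp [trc]

lemma continuous_trc : Continuous trc := by
  have h : ∀ L, trc L = ∑ i, inner ℝ (stdOrthonormalBasis ℝ E3 i) (L (stdOrthonormalBasis ℝ E3 i)) :=
    fun L => LinearMap.trace_eq_sum_inner _ (stdOrthonormalBasis ℝ E3)
  simp_rw [funext h]
  fun_prop

lemma inner_hasDerivAt {f : ℝ → E3} {f' : E3} {t : ℝ} (h : HasDerivAt f f' t) (x : E3) :
    HasDerivAt (fun t => inner ℝ x (f t)) (inner ℝ x f') t := by
  have := (hasDerivAt_const t x).inner ℝ h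
  simpa using this

/-- The divergence theorem in the region below a graph, in gnomonic coordinates. -/
theorem chart_divergence (e : OrthonormalBasis (Fin 3) ℝ E3) {g : ℝ → ℝ} {C D : Set E3}
    {W : E3 → E3} {d M : ℝ} (hd : 0 ≤ d) (hM : 0 ≤ M)
    (hg : ∀ v ∈ Icc (-d) d, ContDiffAt ℝ 2 g v) (hC : UniqueDiffOn ℝ C) (hDo : IsOpen D)
    (hDC : D ⊆ C) (hχC : ∀ v ∈ Icc (-d) d, ∀ s ∈ Icc (-M) 0, gnom e (s + g v, v) ∈ C)
    (hχD : ∀ v ∈ Ioo (-d) d, ∀ s ∈ Ioo (-M) 0, gnom e (s + g v, v) ∈ D)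
    (hW : ContDiffOn ℝ 1 W C) (heuler : ∀ x ∈ D, fderivWithin ℝ W C x x = -W x)
    (htan : ∀ x ∈ D, inner ℝ x (W x) = 0)
    (hbot : ∀ v ∈ Icc (-d) d, W (gnom e (-M + g v, v)) = 0)
    (hleft : ∀ s ∈ Icc (-M) 0, W (gnom e (s + g (-d), -d)) = 0)
    (hright : ∀ s ∈ Icc (-M) 0, W (gnom e (s + g d, d)) = 0) :
    ∫ v in (-d)..d, ∫ s in (-M)..0,
      (rho (s + g v, v))⁻¹ * trc (fderivWithin ℝ W C (gnom e (s + g v, v))) =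
    ∫ v in (-d)..d, (rho (g v, v))⁻¹ * inner ℝ (conormal e g v) (W (gnom e (g v, v))) := by
  have hdd : -d ≤ d := by linarith
  have hMM : -M ≤ 0 := by linarith
  set χ : ℝ × ℝ → E3 := fun p => gnom e (p.2 + g p.1, p.1) with hχ
  set R : ℝ × ℝ → ℝ := fun p => (rho (p.2 + g p.1, p.1))⁻¹ with hR
  -- Projecting W radially onto the tangent plane gives the planar components W₀ - u W₂ and W₁ - v
  -- W₂. In the sheared coordinates (v, s), with u = s + g(v), the second is the v-component and the
  -- first minus g' times the second is the s-component. `A` and `B` are these components times 1/ρ.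
  set A : ℝ × ℝ → ℝ := fun p => R p * (inner ℝ (e 1) (W (χ p)) - p.1 * inner ℝ (e 2) (W (χ p)))
    with hA
  set B : ℝ × ℝ → ℝ := fun p => R p * (inner ℝ (e 0) (W (χ p)) -
    deriv g p.1 * inner ℝ (e 1) (W (χ p)) +
    (deriv g p.1 * p.1 - (p.2 + g p.1)) * inner ℝ (e 2) (W (χ p))) with hB
  set T : ℝ × ℝ → ℝ := fun p => R p * trc (fderivWithin ℝ W C (χ p)) with hT
  set Q : Set (ℝ × ℝ) := Icc (-d) d ×ˢ Icc (-M) 0 with hQ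
  set Qo : Set (ℝ × ℝ) := Ioo (-d) d ×ˢ Ioo (-M) 0 with hQo
  have hQoQ : Qo ⊆ Q := prod_mono Ioo_subset_Icc_self Ioo_subset_Icc_self
  have hgc : ∀ p ∈ Q, ContDiffAt ℝ 2 (fun p : ℝ × ℝ => g p.1) p := fun p hp =>
    (hg p.1 hp.1).comp p contDiffAt_fst
  have hg'c : ∀ p ∈ Q, ContDiffAt ℝ 1 (fun p : ℝ × ℝ => deriv g p.1) p := fun p hp =>
    ContDiffAt.comp (g := deriv g) p ((hg p.1 hp.1).derivWithin (m := 1) (by norm_num))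
      contDiffAt_fst
  have hqc : ∀ p ∈ Q, ContDiffAt ℝ 1 (fun p : ℝ × ℝ => (p.2 + g p.1, p.1)) p := fun p hp =>
    (contDiffAt_snd.add ((hgc p hp).of_le (by norm_num))).prodMk contDiffAt_fst
  have hχc : ∀ p ∈ Q, ContDiffAt ℝ 1 χ p := fun p hp =>
    (contDiff_gnom e).contDiffAt.comp p (hqc p hp)
  have hRc : ∀ p ∈ Q, ContDiffAt ℝ 1 R p := by
    intro p hp
    have h1 : ContDiffAt ℝ 1 (fun p : ℝ × ℝ => 1 + (p.2 + g p.1) ^ 2 + p.1 ^ 2) p :=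
      (contDiffAt_const.add ((contDiffAt_snd.add ((hgc p hp).of_le (by norm_num))).pow 2)).add
        (contDiffAt_fst.pow 2)
    have hpos : (0 : ℝ) < 1 + (p.2 + g p.1) ^ 2 + p.1 ^ 2 := by positivity
    exact (h1.sqrt hpos.ne').inv (Real.sqrt_pos.2 hpos).ne'
  have hχmap : MapsTo χ Q C := fun p hp => hχC p.1 hp.1 p.2 hp.2
  have hχcont : ContinuousOn χ Q := fun p hp => (hχc p hp).continuousAt.continuousWithinAt
  have hRcont : ContinuousOn R Q := fun p hp => (hRc p hp).continuousAt.continuousWithinAt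
  have hgcont : ContinuousOn (fun p : ℝ × ℝ => g p.1) Q := fun p hp =>
    (hgc p hp).continuousAt.continuousWithinAt
  have hg'cont : ContinuousOn (fun p : ℝ × ℝ => deriv g p.1) Q := fun p hp =>
    (hg'c p hp).continuousAt.continuousWithinAt
  have hWcont : ContinuousOn (fun p => W (χ p)) Q := hW.continuousOn.comp hχcont hχmap
  have hwc : ∀ i, ContinuousOn (fun p => inner ℝ (e i) (W (χ p))) Q := fun i =>
    continuousOn_const.inner hWcont
  have hAcont : ContinuousOn A Q := by
    have h1 := hwc 1
    have h2 := hwc 2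
    simp only [hA]
    fun_prop
  have hBcont : ContinuousOn B Q := by
    have h0 := hwc 0
    have h1 := hwc 1
    have h2 := hwc 2
    exact hRcont.mul ((h0.sub (hg'cont.mul h1)).add
      (((hg'cont.mul continuousOn_fst).sub (continuousOn_snd.add hgcont)).mul h2))
  have hTcont : ContinuousOn T Q := by
    have h1 : ContinuousOn (fun p => fderivWithin ℝ W C (χ p)) Q :=
      (hW.continuousOn_fderivWithin hC le_rfl).comp hχcont hχmap
    exact hRcont.mul (continuous_trc.comp_continuousOn h1)
  have hWd : ∀ p ∈ Qo, HasFDerivAt W (fderivWithin ℝ W C (χ p)) (χ p) := by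
    intro p hp
    have hx : χ p ∈ D := hχD p.1 hp.1 p.2 hp.2
    have hCn : C ∈ 𝓝 (χ p) := mem_of_superset (hDo.mem_nhds hx) hDC
    exact ((hW.differentiableOn (by norm_num) _ (hDC hx)).hasFDerivWithinAt).hasFDerivAt hCn
  have hWχd : ∀ p ∈ Qo, DifferentiableAt ℝ (fun p => W (χ p)) p := fun p hp =>
    (hWd p hp).differentiableAt.comp p ((hχc p (hQoQ hp)).differentiableAt (by norm_num))
  have hwd : ∀ i, ∀ p ∈ Qo, DifferentiableAt ℝ (fun p => inner ℝ (e i) (W (χ p))) p :=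
    fun i p hp => (differentiableAt_const _).inner ℝ (hWχd p hp)
  have hAd : ∀ p ∈ Qo, DifferentiableAt ℝ A p := by
    intro p hp
    have h5 := hwd 0 p hp
    have h6 := hwd 1 p hp
    have h7 := hwd 2 p hp
    have h2 := (hRc p (hQoQ hp)).differentiableAt (by norm_num)
    simp only [hA]
    fun_prop
  have hBd : ∀ p ∈ Qo, DifferentiableAt ℝ B p := by
    intro p hp
    have h5 := hwd 0 p hp
    have h6 := hwd 1 p hp
    have h7 := hwd 2 p hp
    have h2 := (hRc p (hQoQ hp)).differentiableAt (by norm_num)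
    have h3 := (hgc p (hQoQ hp)).differentiableAt (by norm_num)
    have h4 := (hg'c p (hQoQ hp)).differentiableAt (by norm_num)
    exact h2.mul ((h5.sub (h4.mul h6)).add
      (((h4.mul differentiableAt_fst).sub (differentiableAt_snd.add h3)).mul h7))
  -- The derivative of g' enters neither term: `B` is differentiated only in s, and `A` does not
  -- contain g'.
  have key : ∀ p ∈ Qo, fderiv ℝ A p (1, 0) + fderiv ℝ B p (0, 1) = T p := by
    rintro ⟨v, s⟩ hp
    have hx : χ (v, s) ∈ D := hχD v hp.1 s hp.2
    set L := fderivWithin ℝ W C (χ (v, s)) with hL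
    have hgd : HasDerivAt g (deriv g v) v :=
      ((hg v (Ioo_subset_Icc_self hp.1)).differentiableAt (by norm_num)).hasDerivAt
    have hWv : HasDerivAt (fun v => W (χ (v, s))) (L (deriv g v • e 0 + e 1)) v :=
      (hWd _ hp).comp_hasDerivAt (f := fun v => χ (v, s)) v (hasDerivAt_gnom_graph e s hgd)
    have hχs : HasDerivAt (fun s => χ (v, s)) (e 0) s := by
      simp only [hχ, gnom]
      simpa using ((((hasDerivAt_id s).add_const (g v)).smul_const (e 0)).add_const
        (v • e 1)).add_const (e 2)
    have hWs : HasDerivAt (fun s => W (χ (v, s))) (L (e 0)) s :=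
      (hWd _ hp).comp_hasDerivAt (f := fun s => χ (v, s)) s hχs
    have hRv : HasDerivAt (fun v => R (v, s)) (-((s + g v) * deriv g v + v * 1) * R (v, s) ^ 3) v :=
      hasDerivAt_rho (hgd.const_add s) (hasDerivAt_id v)
    have hRs : HasDerivAt (fun s => R (v, s)) (-((s + g v) * 1 + v * 0) * R (v, s) ^ 3) s :=
      hasDerivAt_rho ((hasDerivAt_id s).add_const (g v)) (hasDerivAt_const s v)
    have hA1 : fderiv ℝ A (v, s) (1, 0) = -((s + g v) * deriv g v + v * 1) * R (v, s) ^ 3 *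
        (inner ℝ (e 1) (W (χ (v, s))) - v * inner ℝ (e 2) (W (χ (v, s)))) + R (v, s) *
        (inner ℝ (e 1) (L (deriv g v • e 0 + e 1)) - (1 * inner ℝ (e 2) (W (χ (v, s))) +
          v * inner ℝ (e 2) (L (deriv g v • e 0 + e 1)))) := by
      have h1 : HasDerivAt (fun v => A (v, s)) (fderiv ℝ A (v, s) (1, 0)) v :=
        HasFDerivAt.comp_hasDerivAt (f := fun v => (v, s)) v (hAd _ hp).hasFDerivAt
          ((hasDerivAt_id v).prodMk (hasDerivAt_const v s))
      exact h1.unique (hRv.mul ((inner_hasDerivAt hWv (e 1)).sub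
        ((hasDerivAt_id v).mul (inner_hasDerivAt hWv (e 2)))))
    have hB1 : fderiv ℝ B (v, s) (0, 1) = -((s + g v) * 1 + v * 0) * R (v, s) ^ 3 *
        (inner ℝ (e 0) (W (χ (v, s))) - deriv g v * inner ℝ (e 1) (W (χ (v, s))) +
          (deriv g v * v - (s + g v)) * inner ℝ (e 2) (W (χ (v, s)))) + R (v, s) *
        (inner ℝ (e 0) (L (e 0)) - deriv g v * inner ℝ (e 1) (L (e 0)) +
          (-1 * inner ℝ (e 2) (W (χ (v, s))) +
            (deriv g v * v - (s + g v)) * inner ℝ (e 2) (L (e 0)))) := by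
      have h1 : HasDerivAt (fun s => B (v, s)) (fderiv ℝ B (v, s) (0, 1)) s :=
        HasFDerivAt.comp_hasDerivAt (f := fun s => (v, s)) s (hBd _ hp).hasFDerivAt
          ((hasDerivAt_const s v).prodMk (hasDerivAt_id s))
      exact h1.unique (hRs.mul (((inner_hasDerivAt hWs (e 0)).sub
        ((inner_hasDerivAt hWs (e 1)).const_mul (deriv g v))).add
        ((((hasDerivAt_id s).add_const (g v)).const_sub (deriv g v * v)).mul
          (inner_hasDerivAt hWs (e 2)))))
    rw [hA1, hB1]
    simp only [hT, trc_eq_sum e, ← hL]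
    have hχe : χ (v, s) = (s + g v) • e 0 + v • e 1 + e 2 := rfl
    have ht := htan _ hx
    have he := heuler _ hx
    rw [← hL] at he
    conv at he => lhs; rw [hχe]
    have he2 := congrArg (fun z => inner ℝ (e 2) z) he
    rw [real_inner_comm, hχe, inner_add_right, inner_add_right, inner_smul_right, inner_smul_right] at ht
    simp only [map_add, map_smul, inner_add_right, inner_smul_right, inner_neg_right] at he2 ⊢
    rw [← hχe, real_inner_comm, real_inner_comm (e 1), real_inner_comm (e 2)] at ht
    have hRR : R (v, s) ^ 2 * (1 + (s + g v) ^ 2 + v ^ 2) = 1 := by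
      have := rho_sq (s + g v, v)
      simp only at this
      rw [← this]
      simp only [hR]
      have hr := (rho_pos (s + g v, v)).ne'
      field_simp
    -- The identity rests on tangency of W, on R = 1/ρ, and on the `e 2` component of Euler's
    -- relation for homogeneity -1.
    linear_combination -R (v, s) ^ 3 * ht + R (v, s) * inner ℝ (e 2) (W (χ (v, s))) * hRR -
      R (v, s) * he2
  classical
  -- Derivatives exist only in the open rectangle. Off it these values are chosen so that their
  -- divergence is the continuous function `T` everywhere, which makes integrability over the closed
  -- rectangle immediate.
  set A' : ℝ × ℝ → ℝ × ℝ →L[ℝ] ℝ := fun p => if p ∈ Qo then fderiv ℝ A p else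
    T p • ContinuousLinearMap.fst ℝ ℝ ℝ with hA'
  set B' : ℝ × ℝ → ℝ × ℝ →L[ℝ] ℝ := fun p => if p ∈ Qo then fderiv ℝ B p else 0 with hB'
  have hsum : ∀ p, A' p (1, 0) + B' p (0, 1) = T p := by
    intro p
    by_cases hp : p ∈ Qo
    · simp only [hA', hB', if_pos hp]
      exact key p hp
    · simp [hA', hB', if_neg hp]
  have hu1 : uIcc (-d) d = Icc (-d) d := uIcc_of_le hdd
  have hu2 : uIcc (-M) 0 = Icc (-M) 0 := uIcc_of_le hMM
  have main := integral2_divergence_prod_of_hasFDerivAt A B A' B' (-d) (-M) d 0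
    (by rwa [hu1, hu2]) (by rwa [hu1, hu2])
    (by
      rw [min_eq_left hdd, max_eq_right hdd, min_eq_left hMM, max_eq_right hMM]
      intro p hp
      have hp' : p ∈ Qo := hp
      simp only [hA', if_pos hp']
      exact (hAd p hp).hasFDerivAt)
    (by
      rw [min_eq_left hdd, max_eq_right hdd, min_eq_left hMM, max_eq_right hMM]
      intro p hp
      have hp' : p ∈ Qo := hp
      simp only [hB', if_pos hp']
      exact (hBd p hp).hasFDerivAt)
    (by
      simp only [hsum]
      rw [hu1, hu2]
      exact hTcont.integrableOn_compact (isCompact_Icc.prod isCompact_Icc))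
  simp only [hsum] at main
  -- W vanishes on three sides of the rectangle; the remaining side s = 0 is the graph, where `B` is
  -- the product of W with the conormal.
  have z1 : ∫ v in (-d)..d, B (v, -M) = 0 := by
    rw [intervalIntegral.integral_congr (g := fun _ => 0)]
    · simp
    · intro v hv
      rw [hu1] at hv
      simp only [hB, hχ, hbot v hv, inner_zero_right]
      ring
  have z2 : ∫ s in (-M)..0, A (d, s) = 0 := by
    rw [intervalIntegral.integral_congr (g := fun _ => 0)]
    · simp
    · intro s hs
      rw [hu2] at hs
      simp only [hA, hχ, hright s hs, inner_zero_right]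
      ring
  have z3 : ∫ s in (-M)..0, A (-d, s) = 0 := by
    rw [intervalIntegral.integral_congr (g := fun _ => 0)]
    · simp
    · intro s hs
      rw [hu2] at hs
      simp only [hA, hχ, hleft s hs, inner_zero_right]
      ring
  rw [z1, z2, z3, sub_zero, add_zero, sub_zero] at main
  rw [main]
  refine intervalIntegral.integral_congr fun v _ => ?_
  simp only [hB, hχ, hR, zero_add, conormal, inner_add_left, inner_sub_left, inner_smul_left]
  simp

/-- Surface integrals in flattened gnomonic coordinates. -/
theorem integral_chart (e : OrthonormalBasis (Fin 3) ℝ E3) {h : Sph → ℝ}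
    (hh : Integrable h surfMeasure) (h0 : ∀ η : Sph, inner ℝ (e 2) (η : E3) ≤ 0 → h η = 0)
    {g : ℝ → ℝ} {d M : ℝ} (hd : 0 ≤ d) (hM : 0 ≤ M)
    (hsupp : ∀ u v, h (proj (gnom e (u, v))) ≠ 0 → v ∈ Ioo (-d) d ∧ u - g v ∈ Ioo (-M) 0) :
    ∫ η, h η ∂surfMeasure = ∫ v in (-d)..d, ∫ s in (-M)..0,
      (rho (s + g v, v))⁻¹ ^ 3 * h (proj (gnom e (s + g v, v))) := by
  obtain ⟨h1, h2⟩ := integral_gnom e hh h0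
  rw [h2, Measure.volume_eq_prod, integral_prod_symm _ h1, intervalIntegral.integral_of_le (by linarith),
    ← integral_indicator measurableSet_Ioc]
  refine integral_congr_ae (Eventually.of_forall fun v => ?_)
  by_cases hv : v ∈ Ioc (-d) d
  · rw [indicator_of_mem hv, intervalIntegral.integral_of_le (by linarith),
      ← integral_indicator measurableSet_Ioc]
    simp only
    -- The shear u = s + g(v) is, for fixed v, a translation and preserves the integral.
    rw [← integral_add_right_eq_self _ (g v)]
    refine integral_congr_ae (Eventually.of_forall fun s => ?_)
    simp only
    by_cases hs : s ∈ Ioc (-M) 0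
    · rw [indicator_of_mem hs]
    · rw [indicator_of_notMem hs]
      by_contra hne
      have := (hsupp _ _ (right_ne_zero_of_mul hne)).2
      rw [add_sub_cancel_right] at this
      exact hs (Ioo_subset_Ioc_self this)
  · rw [indicator_of_notMem hv]
    refine (integral_congr_ae (Eventually.of_forall fun u => ?_)).trans (integral_zero ℝ ℝ)
    by_contra hne
    exact hv (Ioo_subset_Ioc_self (hsupp _ _ (right_ne_zero_of_mul hne)).1)

/-! ### Tangential fields and the local divergence theorem. -/

/-- A `C¹` tangential vector field on the closure of `Γ`, extended to be homogeneous
of degree `-1`. -/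
structure IsTangentialField (Γ : Set Sph) (W : E3 → E3) : Prop where
  contDiffOn : ContDiffOn ℝ 1 W (cone (closure Γ))
  hom : ∀ x ∈ cone (closure Γ), ∀ c : ℝ, 0 < c → W (c • x) = c⁻¹ • W x
  tangential : ∀ x ∈ cone (closure Γ), inner ℝ x (W x) = 0

/-- The surface divergence of a homogeneous tangential field. -/
def surfDiv (Γ : Set Sph) (W : E3 → E3) (x : E3) : ℝ :=
  trc (fderivWithin ℝ W (cone (closure Γ)) x)

namespace IsTangentialField

variable {Γ : Set Sph} {W : E3 → E3}

lemma surfDiv_smul (hW : IsTangentialField Γ W) (hΓ : IsRegularRegion Γ) {x : E3}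
    (hx : x ∈ cone (closure Γ)) {c : ℝ} (hc : 0 < c) :
    surfDiv Γ W (c • x) = c⁻¹ ^ 2 * surfDiv Γ W x := by
  have h1 := (hW.contDiffOn.differentiableOn (by norm_num) x hx).hasFDerivWithinAt
  have h2 := HasFDerivWithinAt.smul_of_homogeneous (d := c⁻¹) hc (fun y hy => hW.hom y hy c hc) hx h1
  rw [surfDiv, h2.fderivWithin (hΓ.uniqueDiffOn _ ((smul_mem_cone hc).2 hx)), trc_smul, surfDiv, sq]

lemma euler (hW : IsTangentialField Γ W) (hΓ : IsOpen Γ) {x : E3} (hx : x ∈ cone Γ) :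
    fderivWithin ℝ W (cone (closure Γ)) x x = -W x := by
  have hxC := cone_mono subset_closure hx
  have h1 := (hW.contDiffOn.differentiableOn (by norm_num) x hxC).hasFDerivWithinAt.hasFDerivAt
    (mem_of_superset ((isOpen_cone hΓ).mem_nhds hx) (cone_mono subset_closure))
  have h2 : HasDerivAt (fun t : ℝ => t • x) x 1 := by
    simpa using (hasDerivAt_id (1 : ℝ)).smul_const x
  have h3 : HasDerivAt (fun t : ℝ => W (t • x)) (fderivWithin ℝ W (cone (closure Γ)) x x) 1 :=
    HasFDerivAt.comp_hasDerivAt (1 : ℝ) (by rwa [one_smul]) h2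
  have h4 : HasDerivAt (fun t : ℝ => W (t • x)) (-W x) 1 := by
    have h5 : HasDerivAt (fun t : ℝ => t⁻¹ • W x) (-W x) 1 := by
      simpa using (hasDerivAt_inv (one_ne_zero (α := ℝ))).smul_const (W x)
    refine h5.congr_of_eventuallyEq ?_
    filter_upwards [lt_mem_nhds one_pos] with t ht using hW.hom x hxC t ht
  exact h3.unique h4

lemma continuousOn_surfDiv (hW : IsTangentialField Γ W) (hΓ : IsRegularRegion Γ) :
    ContinuousOn (fun η : Sph => surfDiv Γ W η) (closure Γ) := by
  have h1 := hW.contDiffOn.continuousOn_fderivWithin hΓ.uniqueDiffOn le_rfl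
  have h2 : ContinuousOn (fun η : Sph => fderivWithin ℝ W (cone (closure Γ)) (η : E3)) (closure Γ) :=
    h1.comp continuous_subtype_val.continuousOn fun η hη => coe_mem_cone.2 hη
  exact continuous_trc.comp_continuousOn h2

lemma integrableOn_surfDiv (hW : IsTangentialField Γ W) (hΓ : IsRegularRegion Γ) :
    IntegrableOn (fun η : Sph => surfDiv Γ W η) Γ surfMeasure :=
  ((hW.continuousOn_surfDiv hΓ).integrableOn_compact isClosed_closure.isCompact).mono_set
    subset_closure

/-- The divergence theorem for a field supported where the region is a subgraph. -/
theorem integral_surfDiv_subgraph (hW : IsTangentialField Γ W) (hΓ : IsRegularRegion Γ)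
    (e : OrthonormalBasis (Fin 3) ℝ E3) {g : ℝ → ℝ} {a b : ℝ} (ha : 0 < a) (hb : 0 < b)
    (hg : ∀ v ∈ Ioo (-b) b, ContDiffAt ℝ 2 g v) (hga : ∀ v ∈ Ioo (-b) b, |g v| < a / 3)
    (hle : ∀ u ∈ Ioo (-a) a, ∀ v ∈ Ioo (-b) b, u ≤ g v → gnom e (u, v) ∈ cone (closure Γ))
    (hlt : ∀ u ∈ Ioo (-a) a, ∀ v ∈ Ioo (-b) b, u < g v → gnom e (u, v) ∈ cone Γ)
    {K : Set Sph} (hK : IsClosed K) (hKb : K ⊆ chartBox e (a / 3) (b / 2))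
    (hWK : ∀ x, x ≠ 0 → proj x ∉ K → W x = 0)
    (hKlt : ∀ u v, proj (gnom e (u, v)) ∈ K → gnom e (u, v) ∈ cone Γ → u < g v) :
    ∫ η in Γ, surfDiv Γ W η ∂surfMeasure = ∫ v in (-(b / 2))..(b / 2),
      (rho (g v, v))⁻¹ * inner ℝ (conormal e g v) (W (gnom e (g v, v))) := by
  have hbb : ∀ v ∈ Icc (-(b / 2)) (b / 2), v ∈ Ioo (-b) b := fun v hv =>
    ⟨by linarith [hv.1], by linarith [hv.2]⟩
  -- The sizes fit because |g| < a/3: the depth 2a/3 keeps the sheared rectangle within |u| < a,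
  -- while its bottom lies below u = -a/3 and so outside the support of W.
  have hsa : ∀ v ∈ Icc (-(b / 2)) (b / 2), ∀ s ∈ Icc (-(2 * a / 3)) 0, s + g v ∈ Ioo (-a) a := by
    intro v hv s hs
    have := abs_lt.1 (hga v (hbb v hv))
    exact ⟨by linarith [hs.1, this.1], by linarith [hs.2, this.2]⟩
  have hWz : ∀ u v, ¬ (u ∈ Ioo (-(a / 3)) (a / 3) ∧ v ∈ Ioo (-(b / 2)) (b / 2)) →
      W (gnom e (u, v)) = 0 := by
    intro u v huv
    refine hWK _ (gnom_ne_zero e _) fun h => huv ?_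
    exact proj_gnom_mem_chartBox.1 (hKb h)
  have hdivK : ∀ η : Sph, η ∈ Γ → η ∉ K → surfDiv Γ W η = 0 := by
    intro η hη hηK
    have hev : W =ᶠ[𝓝 (η : E3)] fun _ => 0 := by
      have h1 : ∀ᶠ x in 𝓝 (η : E3), proj x ∈ Kᶜ :=
        (continuousAt_proj (sph_ne_zero η)).eventually (hK.isOpen_compl.mem_nhds (by rwa [proj_coe]))
      have h2 : ∀ᶠ x in 𝓝 (η : E3), x ≠ 0 := isOpen_ne.mem_nhds (sph_ne_zero η)
      filter_upwards [h1, h2] with x hx hx0 using hWK x hx0 hx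
    rw [surfDiv, (hev.filter_mono nhdsWithin_le_nhds).fderivWithin_eq
      hev.self_of_nhds, fderivWithin_const_apply, trc_zero]
  set h : Sph → ℝ := Γ.indicator fun η : Sph => surfDiv Γ W η with hh
  have hne : ∀ η, h η ≠ 0 → η ∈ Γ ∧ η ∈ K := by
    intro η hη
    have h1 : η ∈ Γ := mem_of_indicator_ne_zero hη
    refine ⟨h1, ?_⟩
    by_contra h2
    rw [hh, indicator_of_mem h1] at hη
    exact hη (hdivK η h1 h2)
  have hint : Integrable h surfMeasure :=
    (integrable_indicator_iff hΓ.isOpen.measurableSet).2 (hW.integrableOn_surfDiv hΓ)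
  rw [← integral_indicator hΓ.isOpen.measurableSet]
  have hchart := integral_chart e hint (g := g) (d := b / 2) (M := 2 * a / 3)
    (fun η hη => by
      by_contra hcon
      exact absurd (hKb (hne η hcon).2).1 (not_lt.2 hη)) (by positivity) (by positivity)
    (fun u v huv => by
      obtain ⟨h1, h2⟩ := hne _ huv
      have h3 := proj_gnom_mem_chartBox.1 (hKb h2)
      have h4 := hKlt u v h2 (gnom_mem_cone_iff.2 h1)
      refine ⟨h3.2, ?_, by linarith⟩
      have := abs_lt.1 (hga v ⟨by linarith [h3.2.1], by linarith [h3.2.2]⟩)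
      linarith [h3.1.1, this.2])
  rw [hchart, ← chart_divergence e (C := cone (closure Γ)) (D := cone Γ) (W := W) (g := g)
    (d := b / 2) (M := 2 * a / 3) (by positivity) (by positivity) (fun v hv => hg v (hbb v hv))
    hΓ.uniqueDiffOn (isOpen_cone hΓ.isOpen) (cone_mono subset_closure)
    (fun v hv s hs => hle _ (hsa v hv s hs) v (hbb v hv) (by linarith [hs.2]))
    (fun v hv s hs => hlt _ (hsa v (Ioo_subset_Icc_self hv) s (Ioo_subset_Icc_self hs)) v
      (hbb v (Ioo_subset_Icc_self hv)) (by linarith [hs.2]))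
    hW.contDiffOn (fun x hx => hW.euler hΓ.isOpen hx)
    (fun x hx => hW.tangential x (cone_mono subset_closure hx))
    (fun v hv => hWz _ _ fun h => by
      have := abs_lt.1 (hga v (hbb v hv))
      linarith [h.1.1, this.2])
    (fun s hs => hWz _ _ fun h => by linarith [h.2.1])
    (fun s hs => hWz _ _ fun h => by linarith [h.2.2])]
  refine intervalIntegral.integral_congr_ae (Eventually.of_forall fun v hv => ?_)
  rw [uIoc_of_le (by linarith)] at hv
  have hv' : v ∈ Icc (-(b / 2)) (b / 2) := Ioc_subset_Icc_self hv
  refine intervalIntegral.integral_congr_Ioo_of_le (by linarith) fun s hs => ?_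
  have hmem : gnom e (s + g v, v) ∈ cone Γ :=
    hlt _ (hsa v hv' s (Ioo_subset_Icc_self hs)) v (hbb v hv') (by linarith [hs.2])
  have hr := rho_pos (s + g v, v)
  -- The divergence is homogeneous of degree -2, so passing to the tangent plane yields ρ²; with the
  -- surface density ρ⁻³ this is the weight ρ⁻¹ in the chart formula.
  have h1 : h (proj (gnom e (s + g v, v))) =
      rho (s + g v, v) ^ 2 * surfDiv Γ W (gnom e (s + g v, v)) := by
    rw [hh, indicator_of_mem (gnom_mem_cone_iff.1 hmem), coe_proj_gnom,
      hW.surfDiv_smul hΓ (cone_mono subset_closure hmem) (inv_pos.2 hr), inv_inv]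
  simp only [h1, surfDiv]
  field_simp

end IsTangentialField

/-! ### Boundary integrals in charts, and localisation of the divergence theorem. -/

lemma continuousOn_outerNormal {Γ : Set Sph} (hΓ : IsRegularRegion Γ) :
    ContinuousOn (outerNormal Γ) (frontier Γ) := by
  intro η hη
  obtain ⟨Φ, hom, hΦ⟩ := hΓ.exists_definesAt (coe_mem_cone.2 hη)
  have hD := hΦ.self_of_nhds
  have h1 : ContinuousAt (fun ζ : Sph => gradient Φ (ζ : E3)) η :=
    ContinuousAt.comp (g := gradient Φ) hD.continuousAt_gradient continuous_subtype_val.continuousAt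
  have h2 : ContinuousAt (fun ζ : Sph => ‖gradient Φ (ζ : E3)‖⁻¹ • gradient Φ (ζ : E3)) η :=
    (h1.norm.inv₀ (norm_ne_zero_iff.2 hD.gradient_ne)).smul h1
  refine h2.continuousWithinAt.congr_of_eventuallyEq ?_ (outerNormal_eq hΓ.isOpen hom hη hΦ)
  have h3 : ∀ᶠ ζ : Sph in 𝓝 η, ∀ᶠ y in 𝓝 (ζ : E3), DefinesAt Γ Φ y :=
    continuous_subtype_val.continuousAt.eventually hΦ.eventually_nhds
  filter_upwards [self_mem_nhdsWithin, mem_nhdsWithin_of_mem_nhds h3] with ζ hζ hζΦ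
  exact outerNormal_eq hΓ.isOpen hom hζ hζΦ

lemma aestronglyMeasurable_of_continuousOn_frontier {Γ : Set Sph} {f : Sph → ℝ}
    (hf : ContinuousOn f (frontier Γ)) : AEStronglyMeasurable f (lineMeasure Γ) :=
  hf.aestronglyMeasurable isClosed_frontier.measurableSet

lemma ae_mem_frontier (Γ : Set Sph) : ∀ᵐ η ∂(lineMeasure Γ), η ∈ frontier Γ :=
  ae_restrict_mem isClosed_frontier.measurableSet

lemma DefinesAt.smul {Γ : Set Sph} {Φ : E3 → ℝ} {y : E3} (h : DefinesAt Γ Φ y)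
    (hom : ∀ c : ℝ, 0 < c → ∀ y, Φ (c • y) = Φ y) {c : ℝ} (hc : 0 < c) :
    DefinesAt Γ Φ (c • y) := by
  have h1 : ContDiffAt ℝ 2 Φ (c • y) := by
    have h2 : ContDiffAt ℝ 2 (fun z : E3 => c⁻¹ • z) (c • y) := by fun_prop
    refine (ContDiffAt.comp (c • y) (by rw [inv_smul_smul₀ hc.ne']; exact h.contDiffAt)
      h2).congr_of_eventuallyEq (Eventually.of_forall fun z => ?_)
    simp only [Function.comp, hom _ (inv_pos.2 hc)]
  refine ⟨smul_ne_zero hc.ne' h.ne_zero, h1, ?_, ?_, ?_⟩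
  · rw [gradient_smul_of_homogeneous hom h.ne_zero h.differentiableAt hc]
    exact smul_ne_zero (inv_ne_zero hc.ne') h.gradient_ne
  · rw [smul_mem_cone hc, hom c hc, h.mem_iff]
  · rw [smul_mem_cone hc, hom c hc, h.mem_closure_iff]

namespace GraphChart

variable {Γ : Set Sph} {Φ : E3 → ℝ} {e : OrthonormalBasis (Fin 3) ℝ E3} {g : ℝ → ℝ} {a b : ℝ}

lemma aemeasurable_graphSpeed (H : GraphChart Γ Φ e g a b) :
    AEMeasurable (fun v => ENNReal.ofReal (graphSpeed e g v)) (volume.restrict (Ioo (-b) b)) :=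
  ((continuousOn_graphSpeed e H.contDiffAt).aemeasurable measurableSet_Ioo).ennreal_ofReal

lemma integrableOn_line_iff (H : GraphChart Γ Φ e g a b) (hΓ : IsOpen Γ) {f : Sph → ℝ}
    (hf : AEStronglyMeasurable f (lineMeasure Γ)) :
    IntegrableOn f (chartBox e a b) (lineMeasure Γ) ↔
      IntegrableOn (fun v => graphSpeed e g v * f (graphCurve e g v)) (Ioo (-b) b) := by
  obtain ⟨h1, h2⟩ := H.restrict_hausdorffMeasure hΓ
  have h3 := hf.restrict (s := chartBox e a b)
  rw [IntegrableOn, IntegrableOn, h2] at *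
  rw [integrable_map_measure h3 h1, integrable_withDensity_iff_integrable_smul₀'
    H.aemeasurable_graphSpeed (by simp)]
  simp only [ENNReal.toReal_ofReal (graphSpeed_pos e g _).le, smul_eq_mul, Function.comp]

lemma setIntegral_line (H : GraphChart Γ Φ e g a b) (hΓ : IsOpen Γ) {f : Sph → ℝ}
    (hf : AEStronglyMeasurable f (lineMeasure Γ)) :
    ∫ η in chartBox e a b, f η ∂(lineMeasure Γ) =
      ∫ v in Ioo (-b) b, graphSpeed e g v * f (graphCurve e g v) := by
  obtain ⟨h1, h2⟩ := H.restrict_hausdorffMeasure hΓ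
  have h3 := hf.restrict (s := chartBox e a b)
  rw [h2] at *
  rw [integral_map h1 h3, integral_withDensity_eq_integral_toReal_smul₀
    H.aemeasurable_graphSpeed (by simp)]
  simp only [ENNReal.toReal_ofReal (graphSpeed_pos e g _).le, smul_eq_mul]

lemma outerNormal_graphCurve (H : GraphChart Γ Φ e g a b)
    (hom : ∀ c : ℝ, 0 < c → ∀ y, Φ (c • y) = Φ y) (hΓ : IsOpen Γ) {v : ℝ} (hv : v ∈ Ioo (-b) b) :
    graphCurve e g v ∈ frontier Γ ∧
      outerNormal Γ (graphCurve e g v) = ‖conormal e g v‖⁻¹ • conormal e g v := by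
  have hfr : graphCurve e g v ∈ frontier Γ ∩ chartBox e a b := by
    rw [H.frontier_inter_chartBox hΓ]
    exact ⟨v, hv, rfl⟩
  refine ⟨hfr.1, ?_⟩
  have hev : ∀ᶠ y in 𝓝 (graphCurve e g v : E3), DefinesAt Γ Φ y := by
    have h1 : ∀ᶠ y in 𝓝 (graphCurve e g v : E3), proj y ∈ chartBox e a b :=
      (continuousAt_proj (sph_ne_zero _)).eventually
        ((isOpen_chartBox e a b).mem_nhds (by rw [proj_coe]; exact hfr.2))
    filter_upwards [h1, isOpen_ne.mem_nhds (sph_ne_zero (graphCurve e g v))] with y hy hy0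
    obtain ⟨p, hp, q, hq, hpq⟩ := mem_chartBox_iff.1 hy
    have h2 : y = (‖y‖ * (rho (p, q))⁻¹) • gnom e (p, q) := by
      rw [mul_smul, ← coe_proj_gnom, ← hpq, norm_smul_proj]
    rw [h2]
    exact (H.definesAt p hp q hq).smul hom
      (mul_pos (norm_pos_iff.2 hy0) (inv_pos.2 (rho_pos _)))
  have hD := H.definesAt (g v) (H.mem_Ioo hv) v hv
  have hr := inv_pos.2 (rho_pos (g v, v))
  have hpos := H.inner_pos (g v) (H.mem_Ioo hv) v hv
  rw [outerNormal_eq hΓ hom hfr.1 hev, graphCurve, coe_proj_gnom,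
    gradient_smul_of_homogeneous hom hD.ne_zero hD.differentiableAt hr, inv_inv,
    H.gradient_eq hom hv, ← conormal, norm_smul, norm_smul, smul_smul, smul_smul,
    Real.norm_of_nonneg (rho_pos _).le, Real.norm_of_nonneg hpos.le]
  have h1 := rho_pos (g v, v)
  have h2 := norm_conormal_pos e g v
  congr 1
  field_simp

end GraphChart

lemma exists_orthonormalBasis_two (ξ : Sph) :
    ∃ e : OrthonormalBasis (Fin 3) ℝ E3, e 2 = ξ := by
  have hon : Orthonormal ℝ (({2} : Set (Fin 3)).domRestrict fun _ => (ξ : E3)) := by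
    refine ⟨fun i => norm_sph ξ, ?_⟩
    rintro ⟨i, rfl⟩ ⟨j, rfl⟩ hij
    exact absurd rfl hij
  obtain ⟨e, he⟩ := hon.exists_orthonormalBasis_extension_of_card_eq (by simp)
  exact ⟨e, he 2 rfl⟩

namespace IsTangentialField

variable {Γ : Set Sph} {W : E3 → E3}

lemma continuousOn (hW : IsTangentialField Γ W) :
    ContinuousOn (fun η : Sph => W η) (closure Γ) :=
  hW.contDiffOn.continuousOn.comp continuous_subtype_val.continuousOn fun _ hη => coe_mem_cone.2 hη

lemma continuousOn_inner_outerNormal (hW : IsTangentialField Γ W) (hΓ : IsRegularRegion Γ) :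
    ContinuousOn (fun η : Sph => inner ℝ (outerNormal Γ η) (W η)) (frontier Γ) :=
  (continuousOn_outerNormal hΓ).inner (hW.continuousOn.mono frontier_subset_closure)

/-- The divergence theorem for fields supported near a given point. -/
theorem exists_isOpen_integral_surfDiv (hΓ : IsRegularRegion Γ) (ξ : Sph) :
    ∃ U : Set Sph, IsOpen U ∧ ξ ∈ U ∧ ∀ W, IsTangentialField Γ W → ∀ K ⊆ U, IsClosed K →
      (∀ x, x ≠ 0 → proj x ∉ K → W x = 0) →
      ∫ η in Γ, surfDiv Γ W η ∂surfMeasure =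
        ∫ η, inner ℝ (outerNormal Γ η) (W η) ∂(lineMeasure Γ) := by
  by_cases hξ : ξ ∈ closure Γ
  swap
  · refine ⟨(closure Γ)ᶜ, isClosed_closure.isOpen_compl, hξ, fun W hW K hKU hK hWK => ?_⟩
    have hz : ∀ x ∈ cone (closure Γ), W x = 0 := fun x hx => hWK x hx.1 fun h => hKU h hx.2
    rw [setIntegral_eq_zero_of_forall_eq_zero, integral_eq_zero_of_ae]
    · filter_upwards [ae_mem_frontier Γ] with η hη
      simp [hz η (coe_mem_cone.2 (frontier_subset_closure hη))]
    · intro η hη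
      have hη' : (η : E3) ∈ cone (closure Γ) := coe_mem_cone.2 (subset_closure hη)
      rw [surfDiv, fderivWithin_congr (fun x hx => hz x hx) (hz _ hη'),
        fderivWithin_const_apply, trc_zero]
  by_cases hξΓ : ξ ∈ Γ
  · obtain ⟨e, he⟩ := exists_orthonormalBasis_two ξ
    have h1 : Tendsto (gnom e) (𝓝 (0, 0)) (𝓝 (ξ : E3)) := by
      have := (contDiff_gnom (n := 0) e).continuous.tendsto (0, 0)
      simpa [gnom, he] using this
    obtain ⟨a, ha, hbox⟩ := Metric.eventually_nhds_iff.1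
      (h1.eventually ((isOpen_cone hΓ.isOpen).mem_nhds (coe_mem_cone.2 hξΓ)))
    have hmem : ∀ u ∈ Ioo (-a) a, ∀ v ∈ Ioo (-a) a, gnom e (u, v) ∈ cone Γ := by
      intro u hu v hv
      refine hbox (y := (u, v)) ?_
      rw [Prod.dist_eq, max_lt_iff, Real.dist_eq, Real.dist_eq, sub_zero, sub_zero]
      exact ⟨abs_lt.2 hu, abs_lt.2 hv⟩
    refine ⟨chartBox e (a / 4) (a / 2), isOpen_chartBox _ _ _, ?_, fun W hW K hKU hK hWK => ?_⟩
    · refine mem_chartBox_iff.2 ⟨0, by constructor <;> linarith, 0, by constructor <;> linarith, ?_⟩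
      rw [show gnom e (0, 0) = ξ by simp [gnom, he], proj_coe]
    have hKU' : K ⊆ chartBox e (a / 3) (a / 2) := fun η hη => by
      obtain ⟨u, hu, v, hv, rfl⟩ := mem_chartBox_iff.1 (hKU hη)
      exact proj_gnom_mem_chartBox.2 ⟨⟨by linarith [hu.1], by linarith [hu.2]⟩, hv⟩
    -- At an interior point the subgraph formula is used with the constant graph u = a/4, which is
    -- not a boundary of Γ but lies outside the support of W. The graph integral therefore vanishes.
    have hz : ∀ v, W (gnom e (a / 4, v)) = 0 := fun v => hWK _ (gnom_ne_zero e _) fun h =>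
      lt_irrefl _ (proj_gnom_mem_chartBox.1 (hKU h)).1.2
    rw [hW.integral_surfDiv_subgraph hΓ e (g := fun _ => a / 4) ha ha
      (fun v _ => contDiffAt_const) (fun v _ => by rw [abs_of_pos] <;> linarith)
      (fun u hu v hv _ => cone_mono subset_closure (hmem u hu v hv)) (fun u hu v hv _ => hmem u hu v hv)
      hK hKU' hWK (fun u v h _ => (proj_gnom_mem_chartBox.1 (hKU h)).1.2)]
    simp only [hz, inner_zero_right, mul_zero, intervalIntegral.integral_zero]
    refine (integral_eq_zero_of_ae ?_).symm
    filter_upwards [ae_mem_frontier Γ] with η hη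
    have hηΓ : η ∉ Γ := fun h => (hΓ.isOpen.frontier_eq ▸ hη).2 h
    rw [hWK η (sph_ne_zero η), inner_zero_right, Pi.zero_apply]
    rw [proj_coe]
    intro hηK
    obtain ⟨u, hu, v, hv, rfl⟩ := mem_chartBox_iff.1 (hKU hηK)
    exact hηΓ (hmem u ⟨by linarith [hu.1], by linarith [hu.2]⟩ v
      ⟨by linarith [hv.1], by linarith [hv.2]⟩).2 |>.elim
  have hξf : ξ ∈ frontier Γ := by rw [hΓ.isOpen.frontier_eq]; exact ⟨hξ, hξΓ⟩
  obtain ⟨Φ, hom, hΦ⟩ := hΓ.exists_definesAt (coe_mem_cone.2 hξf)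
  obtain ⟨e, g, a, b, he, -, H⟩ := exists_graphChart hΓ.isOpen hom hξf hΦ
  have ha := H.a_pos
  have hb := H.b_pos
  refine ⟨chartBox e (a / 3) (b / 2), isOpen_chartBox _ _ _, ?_, fun W hW K hKU hK hWK => ?_⟩
  · refine mem_chartBox_iff.2 ⟨0, by constructor <;> linarith, 0, by constructor <;> linarith, ?_⟩
    rw [show gnom e (0, 0) = ξ by simp [gnom, he], proj_coe]
  have hKU' : K ⊆ chartBox e a b := fun η hη => by
    obtain ⟨u, hu, v, hv, rfl⟩ := mem_chartBox_iff.1 (hKU hη)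
    exact proj_gnom_mem_chartBox.2 ⟨⟨by linarith [hu.1], by linarith [hu.2]⟩,
      ⟨by linarith [hv.1], by linarith [hv.2]⟩⟩
  have hmemK : ∀ u v, proj (gnom e (u, v)) ∈ K → u ∈ Ioo (-a) a ∧ v ∈ Ioo (-b) b := fun u v h =>
    proj_gnom_mem_chartBox.1 (hKU' h)
  rw [hW.integral_surfDiv_subgraph hΓ e ha hb H.contDiffAt H.abs_lt
    (fun u hu v hv h => (H.mem_cone_closure_iff hu hv).2 h)
    (fun u hu v hv h => (H.mem_cone_iff hu hv).2 h) hK hKU hWK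
    (fun u v h h' => (H.mem_cone_iff (hmemK u v h).1 (hmemK u v h).2).1 h')]
  have hzero : ∀ η : Sph, η ∉ chartBox e a b → inner ℝ (outerNormal Γ η) (W η) = (0 : ℝ) := by
    intro η hη
    rw [hWK η (sph_ne_zero η), inner_zero_right]
    rw [proj_coe]
    exact fun h => hη (hKU' h)
  rw [← setIntegral_eq_integral_of_forall_compl_eq_zero hzero, H.setIntegral_line hΓ.isOpen
    (aestronglyMeasurable_of_continuousOn_frontier (hW.continuousOn_inner_outerNormal hΓ)),
    intervalIntegral.integral_of_le (by linarith), integral_Ioc_eq_integral_Ioo]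
  -- The length of the conormal in the speed cancels its normalisation in the unit normal, and ρ⁻²
  -- from the speed combines with ρ from the homogeneity of W to ρ⁻¹.
  have hval : ∀ v ∈ Ioo (-b) b, graphSpeed e g v *
      inner ℝ (outerNormal Γ (graphCurve e g v)) (W (graphCurve e g v)) =
      (rho (g v, v))⁻¹ * inner ℝ (conormal e g v) (W (gnom e (g v, v))) := by
    intro v hv
    have hr := rho_pos (g v, v)
    have hn := norm_conormal_pos e g v
    rw [(H.outerNormal_graphCurve hom hΓ.isOpen hv).2, graphCurve, coe_proj_gnom,
      hW.hom _ ((H.mem_cone_closure_iff (H.mem_Ioo hv) hv).2 le_rfl) _ (inv_pos.2 hr), inv_inv,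
      inner_smul_left, inner_smul_right, graphSpeed]
    simp only [conj_trivial]
    field_simp
  rw [setIntegral_congr_fun measurableSet_Ioo hval]
  refine setIntegral_eq_of_subset_of_forall_sdiff_eq_zero measurableSet_Ioo
    (Ioo_subset_Ioo (by linarith) (by linarith)) ?_ |>.symm
  rintro v ⟨-, hv⟩
  rw [hWK _ (gnom_ne_zero e _), inner_zero_right, mul_zero]
  exact fun h => hv (proj_gnom_mem_chartBox.1 (hKU h)).2

end IsTangentialField

/-! ### Integrability along the boundary. -/

namespace GraphChart

variable {Γ : Set Sph} {Φ : E3 → ℝ} {e : OrthonormalBasis (Fin 3) ℝ E3} {g : ℝ → ℝ} {a b : ℝ}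

lemma shrink (H : GraphChart Γ Φ e g a b) {c : ℝ} (hc : 0 < c) (hcb : c ≤ b) :
    GraphChart Γ Φ e g a c := by
  have hsub : ∀ v ∈ Ioo (-c) c, v ∈ Ioo (-b) b := fun v hv =>
    ⟨by linarith [hv.1], by linarith [hv.2]⟩
  exact ⟨H.a_pos, hc, fun u hu v hv => H.definesAt u hu v (hsub v hv),
    fun u hu v hv => H.inner_pos u hu v (hsub v hv), fun v hv => H.contDiffAt v (hsub v hv),
    fun v hv => H.abs_lt v (hsub v hv), H.zero, H.deriv_zero,
    fun v hv => H.eq_zero v (hsub v hv)⟩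

/-- The `e 1` coordinate of the chord is v/ρ up to sign, and ρ ≤ 1 + a + b in the box. Thus the
parameter is controlled by the distance to ξ. -/
lemma abs_le_norm_sub_graphCurve (H : GraphChart Γ Φ e g a b) {v : ℝ} (hv : v ∈ Ioo (-b) b) :
    |v| ≤ (1 + a + b) * ‖e 2 - (graphCurve e g v : E3)‖ := by
  have h1 : inner ℝ (e 1) (e 2 - (graphCurve e g v : E3)) = -((rho (g v, v))⁻¹ * v) := by
    rw [inner_sub_right, graphCurve, (inner_proj_gnom e _).2.1, inner_basis]
    simp
  have h2 := abs_real_inner_le_norm (e 1) (e 2 - (graphCurve e g v : E3))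
  have hr := rho_pos (g v, v)
  rw [h1, e.norm_eq_one, one_mul, abs_neg, abs_mul, abs_inv, abs_of_pos hr, inv_mul_le_iff₀ hr] at h2
  refine h2.trans (mul_le_mul_of_nonneg_right ?_ (norm_nonneg _))
  have h3 := _root_.abs_lt.1 (H.abs_lt v hv)
  have h4 := H.a_pos
  have h5 := H.b_pos
  refine Real.sqrt_le_iff.2 ⟨by positivity, ?_⟩
  have h6 : g v ^ 2 ≤ a ^ 2 := sq_le_sq' (by linarith [h3.1]) (by linarith [h3.2])
  have h7 : v ^ 2 ≤ b ^ 2 := sq_le_sq' hv.1.le hv.2.le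
  have h8 : 0 < a * b := mul_pos h4 h5
  simp only
  nlinarith

lemma continuousOn_graphCurve (H : GraphChart Γ Φ e g a b) :
    ContinuousOn (fun v => (graphCurve e g v : E3)) (Ioo (-b) b) := fun v hv =>
  (contDiffAt_graphCurve e (H.contDiffAt v hv)).continuousAt.continuousWithinAt

/-- In the parameter v the integrand is bounded by a multiple of |v|^p. Halving b makes the speed
bounded, by compactness of the closed half-interval. -/
lemma integrableOn_norm_sub_rpow (H : GraphChart Γ Φ e g a b) (hΓ : IsOpen Γ) {p : ℝ}
    (hp : -1 < p) (hp0 : p ≤ 0) :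
    IntegrableOn (fun η : Sph => ‖e 2 - (η : E3)‖ ^ p) (chartBox e a (b / 2)) (lineMeasure Γ) := by
  have hb := H.b_pos
  have ha := H.a_pos
  have H' := H.shrink (half_pos hb) (by linarith)
  have hmeas : Measurable fun η : Sph => ‖e 2 - (η : E3)‖ ^ p := by fun_prop
  rw [H'.integrableOn_line_iff hΓ hmeas.aestronglyMeasurable]
  have hsub : Icc (-(b / 2)) (b / 2) ⊆ Ioo (-b) b := fun v hv =>
    ⟨by linarith [hv.1], by linarith [hv.2]⟩
  obtain ⟨M, hM⟩ := isCompact_Icc.exists_bound_of_continuousOn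
    ((continuousOn_graphSpeed e H.contDiffAt).mono hsub)
  have hC : 0 < (1 + a + b)⁻¹ := by positivity
  have hdom : IntegrableOn (fun v : ℝ => M * (((1 + a + b)⁻¹) ^ p * |v| ^ p))
      (Ioo (-(b / 2)) (b / 2)) :=
    ((((integrableOn_abs_rpow hp (b / 2)).mono_set Ioo_subset_Icc_self).const_mul _).const_mul _)
  refine Integrable.mono' hdom ?_ ?_
  · have h1 := ((continuousOn_graphSpeed e H'.contDiffAt).aemeasurable (μ := volume)
      measurableSet_Ioo)
    have h2 : AEMeasurable (fun v => ‖e 2 - (graphCurve e g v : E3)‖)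
        (volume.restrict (Ioo (-(b / 2)) (b / 2))) :=
      (continuousOn_const.sub H'.continuousOn_graphCurve).norm.aemeasurable measurableSet_Ioo
    exact (h1.mul (h2.pow_const p)).aestronglyMeasurable
  · have hne : ∀ᵐ v : ℝ, v ≠ 0 := by simp [ae_iff, measure_singleton]
    filter_upwards [ae_restrict_mem measurableSet_Ioo, ae_restrict_of_ae hne] with v hv hv0
    have h1 := hM v (Ioo_subset_Icc_self hv)
    have h2 := H.abs_le_norm_sub_graphCurve (hsub (Ioo_subset_Icc_self hv))
    have hv1 : 0 < |v| := abs_pos.2 hv0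
    rw [norm_mul, Real.norm_of_nonneg (Real.rpow_nonneg (norm_nonneg _) _),
      ← Real.mul_rpow hC.le hv1.le]
    refine mul_le_mul h1 ?_ (Real.rpow_nonneg (norm_nonneg _) _) ((norm_nonneg _).trans h1)
    refine Real.rpow_le_rpow_of_nonpos (by positivity) ?_ hp0
    rw [inv_mul_le_iff₀ (by positivity)]
    exact h2

lemma coe_mem_chartBox (H : GraphChart Γ Φ e g a b) {ξ : Sph} (he : e 2 = ξ) {c : ℝ} (hc : 0 < c) :
    ξ ∈ chartBox e a c := by
  have ha := H.a_pos
  refine mem_chartBox_iff.2 ⟨0, ⟨by linarith, ha⟩, 0, ⟨by linarith, hc⟩, ?_⟩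
  rw [show gnom e (0, 0) = ξ by simp [gnom, he], proj_coe]

end GraphChart

lemma integrableAtFilter_norm_sub_rpow {Γ : Set Sph} (hΓ : IsRegularRegion Γ) (ξ : Sph) {p : ℝ}
    (hp : -1 < p) (hp0 : p ≤ 0) :
    IntegrableAtFilter (fun η : Sph => ‖(ξ : E3) - η‖ ^ p) (𝓝 ξ) (lineMeasure Γ) := by
  by_cases hξ : ξ ∈ frontier Γ
  · obtain ⟨Φ, hom, hΦ⟩ := hΓ.exists_definesAt (coe_mem_cone.2 hξ)
    obtain ⟨e, g, a, b, he, -, H⟩ := exists_graphChart hΓ.isOpen hom hξ hΦ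
    have hb := H.b_pos
    refine ⟨chartBox e a (b / 2), (isOpen_chartBox _ _ _).mem_nhds
      (H.coe_mem_chartBox he (by positivity)), ?_⟩
    rw [← he]
    exact H.integrableOn_norm_sub_rpow hΓ.isOpen hp hp0
  · refine ⟨(frontier Γ)ᶜ, isClosed_frontier.isOpen_compl.mem_nhds hξ, ?_⟩
    rw [IntegrableOn, lineMeasure, Measure.restrict_restrict isClosed_frontier.isOpen_compl.measurableSet,
      compl_inter_self, Measure.restrict_empty]
    exact integrable_zero_measure

lemma isFiniteMeasure_lineMeasure {Γ : Set Sph} (hΓ : IsRegularRegion Γ) :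
    IsFiniteMeasure (lineMeasure Γ) := by
  -- The exponent p = 0 gives local finiteness; compactness of the sphere does the rest.
  have h : LocallyIntegrable (fun _ : Sph => (1 : ℝ)) (lineMeasure Γ) := fun ξ => by
    simpa using integrableAtFilter_norm_sub_rpow hΓ ξ (p := 0) (by norm_num) le_rfl
  have h1 := h.integrableOn_isCompact isCompact_univ
  rw [integrableOn_univ] at h1
  simpa [integrable_const_iff] using h1

/-- Distance powers above `-1` are integrable along the boundary curve. -/
theorem integrable_norm_sub_rpow_lineMeasure {Γ : Set Sph} (hΓ : IsRegularRegion Γ) (ξ : Sph) {p : ℝ}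
    (hp : -1 < p) (hp0 : p ≤ 0) :
    Integrable (fun η : Sph => ‖(ξ : E3) - η‖ ^ p) (lineMeasure Γ) := by
  have := isFiniteMeasure_lineMeasure hΓ
  have h : LocallyIntegrable (fun η : Sph => ‖(ξ : E3) - η‖ ^ p) (lineMeasure Γ) := by
    intro η
    by_cases hη : η = ξ
    · rw [hη]
      exact integrableAtFilter_norm_sub_rpow hΓ ξ hp hp0
    · have hc : ContinuousAt (fun η : Sph => ‖(ξ : E3) - η‖ ^ p) η := by
        refine ContinuousAt.rpow_const (by fun_prop) (Or.inl ?_)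
        rw [norm_ne_zero_iff, sub_ne_zero]
        exact fun h => hη (Subtype.ext h.symm)
      have hmeas : Measurable fun η : Sph => ‖(ξ : E3) - η‖ ^ p := by fun_prop
      exact (Measure.finiteAt_nhds _ η).integrableAtFilter_of_tendsto
        (hmeas.stronglyMeasurable.stronglyMeasurableAtFilter) hc.tendsto
  have h1 := h.integrableOn_isCompact isCompact_univ
  rwa [integrableOn_univ] at h1

lemma ae_ne_lineMeasure (Γ : Set Sph) (ξ : Sph) : ∀ᵐ η ∂(lineMeasure Γ), η ≠ ξ := by
  refine ae_restrict_of_ae ?_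
  have := Measure.nullSingletonClass_hausdorff Sph (d := 1) one_pos
  simp [ae_iff, measure_singleton]

lemma integrable_of_continuousOn_frontier {Γ : Set Sph} (hΓ : IsRegularRegion Γ) {f : Sph → ℝ}
    (hf : ContinuousOn f (frontier Γ)) : Integrable f (lineMeasure Γ) := by
  have := isFiniteMeasure_lineMeasure hΓ
  obtain ⟨C, hC⟩ := isClosed_frontier.isCompact.exists_bound_of_continuousOn hf
  refine Integrable.mono' (integrable_const C) (aestronglyMeasurable_of_continuousOn_frontier hf) ?_
  filter_upwards [ae_mem_frontier Γ] with η hη using hC η hη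

/-! ### The global divergence theorem. -/

/-- The divergence theorem on a regular region of the sphere. -/
theorem IsTangentialField.integral_surfDiv {Γ : Set Sph} {W : E3 → E3}
    (hW : IsTangentialField Γ W) (hΓ : IsRegularRegion Γ) :
    ∫ η in Γ, surfDiv Γ W η ∂surfMeasure =
      ∫ η, inner ℝ (outerNormal Γ η) (W η) ∂(lineMeasure Γ) := by
  choose U hUo hUξ hU using IsTangentialField.exists_isOpen_integral_surfDiv hΓ
  obtain ⟨t, -, ht⟩ := (isCompact_univ (X := Sph)).elim_nhds_subcover U
    fun ξ _ => (hUo ξ).mem_nhds (hUξ ξ)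
  have hcov : Metric.sphere (0 : E3) 1 ⊆ ⋃ i : t, cone (U i) := by
    intro x hx
    obtain ⟨i, hi, hxi⟩ := mem_iUnion₂.1 (ht (mem_univ (⟨x, hx⟩ : Sph)))
    exact mem_iUnion.2 ⟨⟨i, hi⟩, coe_mem_cone.2 hxi⟩
  obtain ⟨r, hr⟩ := SmoothPartitionOfUnity.exists_isSubordinate (modelWithCornersSelf ℝ E3)
    Metric.isClosed_sphere (fun i : t => cone (U i)) (fun i => isOpen_cone (hUo i)) hcov
  -- The partition of unity lives in space; composing it with `proj` makes the cutoffs constant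
  -- along rays, so the pieces keep homogeneity -1.
  set V : t → E3 → E3 := fun i x => r i (proj x : E3) • W x with hV
  have hsum : ∀ x, W x = ∑ i, V i x := by
    intro x
    have h1 := r.sum_eq_one (proj x).2
    rw [finsum_eq_sum_of_fintype] at h1
    rw [← Finset.sum_smul, h1, one_smul]
  have hVt : ∀ i, IsTangentialField Γ (V i) := by
    intro i
    refine ⟨fun x hx => ?_, fun x hx c hc => ?_, fun x hx => ?_⟩
    · have h1 : ContDiffAt ℝ 1 (r i) (proj x : E3) :=
        ((r i).contMDiff.contDiff.of_le (by exact_mod_cast le_top)).contDiffAt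
      have h2 : ContDiffAt ℝ 1 (fun x => (proj x : E3)) x :=
        (contDiffAt_proj hx.1).of_le (by exact_mod_cast le_top)
      exact (ContDiffAt.comp x h1 h2).contDiffWithinAt.smul (hW.contDiffOn x hx)
    · simp only [hV, proj_smul hc, hW.hom x hx c hc]
      rw [smul_comm]
    · simp only [hV, inner_smul_right, hW.tangential x hx, mul_zero]
  have hVU : ∀ i, ∫ η in Γ, surfDiv Γ (V i) η ∂surfMeasure =
      ∫ η, inner ℝ (outerNormal Γ η) (V i η) ∂(lineMeasure Γ) := by
    intro i
    refine hU i (V i) (hVt i) {η | (η : E3) ∈ tsupport (r i)} (fun η hη => ?_) ?_ fun x _ hx => ?_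
    · exact coe_mem_cone.1 (hr i hη)
    · exact (isClosed_tsupport _).preimage continuous_subtype_val
    · simp only [hV]
      rw [image_eq_zero_of_notMem_tsupport hx, zero_smul]
  have hdiv : ∀ η ∈ Γ, surfDiv Γ W (η : E3) = ∑ i, surfDiv Γ (V i) (η : E3) := by
    intro η hη
    have hmem : (η : E3) ∈ cone (closure Γ) := coe_mem_cone.2 (subset_closure hη)
    rw [surfDiv, funext hsum, fderivWithin_fun_sum (hΓ.uniqueDiffOn _ hmem)
      fun i _ => (hVt i).contDiffOn.differentiableOn one_ne_zero _ hmem]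
    simp only [surfDiv, trc, ContinuousLinearMap.toLinearMap_sum, map_sum]
  rw [setIntegral_congr_fun hΓ.isOpen.measurableSet hdiv,
    integral_finsetSum _ fun i _ => (hVt i).integrableOn_surfDiv hΓ, Finset.sum_congr rfl fun i _ => hVU i,
    ← integral_finsetSum _ fun i _ => integrable_of_continuousOn_frontier hΓ
      ((hVt i).continuousOn_inner_outerNormal hΓ)]
  refine integral_congr_ae (Eventually.of_forall fun η => ?_)
  simp only [hsum (η : E3), inner_sum]

/-! ### Quadratic contact of the boundary with its tangent. -/

/-- Taylor's formula of first order with a locally uniform quadratic remainder. -/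
lemma exists_taylor_bound {Φ : E3 → ℝ} {x₀ : E3} (h : ContDiffAt ℝ 2 Φ x₀) :
    ∃ C δ : ℝ, 0 < C ∧ 0 < δ ∧ ∀ x ∈ Metric.ball x₀ δ, ∀ y ∈ Metric.ball x₀ δ,
      |Φ y - Φ x - inner ℝ (gradient Φ x) (y - x)| ≤ C * ‖y - x‖ ^ 2 := by
  have h1 : ContDiffAt ℝ 1 (fderiv ℝ Φ) x₀ := h.fderiv_right (by norm_num)
  obtain ⟨K, t, ht, hK⟩ := h1.exists_lipschitzOnWith
  have h2 : ∀ᶠ x in 𝓝 x₀, DifferentiableAt ℝ Φ x := by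
    filter_upwards [h.eventually (by simp)] with x hx using hx.differentiableAt (by norm_num)
  obtain ⟨δ, hδ, hball⟩ := Metric.mem_nhds_iff.1 (inter_mem ht h2)
  refine ⟨K + 1, δ, by positivity, hδ, fun x hx y hy => ?_⟩
  have hseg : segment ℝ x y ⊆ Metric.ball x₀ δ := (convex_ball x₀ δ).segment_subset hx hy
  -- The derivative is Lipschitz near x₀, so on the segment it differs from its value at `x` by at
  -- most K‖y - x‖; the mean value inequality supplies the second factor.
  have h3 := (convex_segment x y).norm_image_sub_le_of_norm_hasFDerivWithin_le' (𝕜 := ℝ) (f := Φ)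
    (f' := fderiv ℝ Φ) (φ := fderiv ℝ Φ x) (C := K * ‖y - x‖)
    (fun z hz => (hball (hseg hz)).2.hasFDerivAt.hasFDerivWithinAt) (fun z hz => by
      refine (hK.norm_sub_le (hball (hseg hz)).1 (hball hx).1).trans ?_
      refine mul_le_mul_of_nonneg_left ?_ K.2
      obtain ⟨s, hs, rfl⟩ := (segment_eq_image' ℝ x y ▸ hz)
      simp only [add_sub_cancel_left, norm_smul, Real.norm_of_nonneg hs.1]
      exact mul_le_of_le_one_left (norm_nonneg _) hs.2)
    (left_mem_segment ℝ x y) (right_mem_segment ℝ x y)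
  rw [inner_gradient_left, ← Real.norm_eq_abs]
  refine h3.trans ?_
  rw [sq, ← mul_assoc]
  refine mul_le_mul_of_nonneg_right ?_ (norm_nonneg _)
  exact mul_le_mul_of_nonneg_right (by linarith) (norm_nonneg _)

lemma norm_outerNormal {Γ : Set Sph} (hΓ : IsRegularRegion Γ) {η : Sph} (hη : η ∈ frontier Γ) :
    ‖outerNormal Γ η‖ = 1 ∧ inner ℝ (outerNormal Γ η) (η : E3) = 0 := by
  obtain ⟨Φ, hom, hΦ⟩ := hΓ.exists_definesAt (coe_mem_cone.2 hη)
  have hD := hΦ.self_of_nhds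
  have h1 := norm_pos_iff.2 hD.gradient_ne
  rw [outerNormal_eq hΓ.isOpen hom hη hΦ]
  refine ⟨?_, ?_⟩
  · rw [norm_smul, norm_inv, norm_norm, inv_mul_cancel₀ h1.ne']
  · rw [inner_smul_left, inner_gradient_self_of_homogeneous hom hD.differentiableAt, mul_zero]

/-- The normal is almost perpendicular to short chords of the boundary. -/
theorem exists_abs_inner_outerNormal_le {Γ : Set Sph} (hΓ : IsRegularRegion Γ) (ξ : Sph) :
    ∃ C : ℝ, 0 < C ∧ ∀ η ∈ frontier Γ,
      |inner ℝ (outerNormal Γ η) (ξ : E3)| ≤ C * ‖(ξ : E3) - η‖ ^ 2 := by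
  suffices h : ∃ C δ : ℝ, 0 < C ∧ 0 < δ ∧ ∀ η ∈ frontier Γ, ‖(ξ : E3) - η‖ < δ →
      |inner ℝ (outerNormal Γ η) (ξ : E3)| ≤ C * ‖(ξ : E3) - η‖ ^ 2 by
    obtain ⟨C, δ, hC, hδ, h⟩ := h
    -- The summand δ⁻² covers the points at distance at least δ, where the left side is at most 1.
    refine ⟨C + (δ ^ 2)⁻¹, by positivity, fun η hη => ?_⟩
    rw [add_mul]
    by_cases hηδ : ‖(ξ : E3) - η‖ < δ
    · exact (h η hη hηδ).trans (le_add_of_nonneg_right (by positivity))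
    · have h1 := abs_real_inner_le_norm (outerNormal Γ η) (ξ : E3)
      rw [(norm_outerNormal hΓ hη).1, norm_sph, one_mul] at h1
      have h2 : 1 ≤ (δ ^ 2)⁻¹ * ‖(ξ : E3) - η‖ ^ 2 := by
        rw [le_inv_mul_iff₀ (by positivity), mul_one]
        exact pow_le_pow_left₀ hδ.le (not_lt.1 hηδ) 2
      have h3 : 0 ≤ C * ‖(ξ : E3) - η‖ ^ 2 := by positivity
      linarith
  by_cases hξ : ξ ∈ frontier Γ
  swap
  · obtain ⟨δ, hδ, hball⟩ := Metric.mem_nhds_iff.1 (isClosed_frontier.isOpen_compl.mem_nhds hξ)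
    refine ⟨1, δ, one_pos, hδ, fun η hη hηδ => absurd hη (hball ?_)⟩
    rwa [Metric.mem_ball, dist_comm, Subtype.dist_eq, dist_eq_norm]
  obtain ⟨Φ, hom, hΦ⟩ := hΓ.exists_definesAt (coe_mem_cone.2 hξ)
  have hD := hΦ.self_of_nhds
  obtain ⟨C, δ, hC, hδ, hT⟩ := exists_taylor_bound hD.contDiffAt
  have hw := norm_pos_iff.2 hD.gradient_ne
  have h1 : ∀ᶠ y in 𝓝 (ξ : E3), ‖gradient Φ ξ‖ / 2 < ‖gradient Φ y‖ :=
    hD.continuousAt_gradient.norm.eventually (lt_mem_nhds (half_lt_self hw))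
  obtain ⟨δ', hδ', hb⟩ := Metric.eventually_nhds_iff.1 (hΦ.eventually_nhds.and h1)
  refine ⟨(‖gradient Φ ξ‖ / 2)⁻¹ * C, min δ δ', by positivity, lt_min hδ hδ', fun η hη hηδ => ?_⟩
  obtain ⟨h2, h3⟩ := hb (y := (η : E3)) (by
    rw [dist_comm, dist_eq_norm]; exact hηδ.trans_le (min_le_right _ _))
  have hDη := h2.self_of_nhds
  -- Taylor's formula is expanded at η and evaluated at ξ. Φ vanishes at both points and its
  -- gradient at η is orthogonal to η by homogeneity, so only the product of the gradient with ξ is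
  -- left.
  have h4 := hT η (by
    rw [Metric.mem_ball, dist_comm, dist_eq_norm]; exact hηδ.trans_le (min_le_left _ _)) ξ
    (Metric.mem_ball_self hδ)
  rw [(hD.mem_frontier_iff hΓ.isOpen).1 (coe_mem_cone.2 hξ),
    (hDη.mem_frontier_iff hΓ.isOpen).1 (coe_mem_cone.2 hη), inner_sub_right,
    inner_gradient_self_of_homogeneous hom hDη.differentiableAt, sub_zero, zero_sub, sub_zero,
    abs_neg] at h4
  rw [outerNormal_eq hΓ.isOpen hom hη h2, inner_smul_left, conj_trivial, abs_mul, abs_inv,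
    abs_norm, mul_assoc]
  refine mul_le_mul (inv_anti₀ (by positivity) h3.le) h4 (abs_nonneg _) (by positivity)

/-- The half-turn about the axis through `ξ`. -/
def halfTurn (ξ : Sph) : E3 ≃ₗᵢ[ℝ] E3 := (ℝ ∙ (ξ : E3)).reflection

lemma halfTurn_apply (ξ : Sph) (x : E3) :
    halfTurn ξ x = (2 * inner ℝ (ξ : E3) x) • (ξ : E3) - x := by
  rw [halfTurn, Submodule.reflection_singleton_apply, norm_sph]
  simp [mul_smul, two_smul]

lemma inner_halfTurn (ξ : Sph) (x : E3) : inner ℝ (ξ : E3) (halfTurn ξ x) = inner ℝ (ξ : E3) x := by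
  rw [halfTurn_apply, inner_sub_right, inner_smul_right, real_inner_self_eq_norm_sq, norm_sph]
  ring

lemma norm_sub_halfTurn (ξ : Sph) (x : E3) : ‖(ξ : E3) - halfTurn ξ x‖ = ‖(ξ : E3) - x‖ := by
  have h : halfTurn ξ (ξ : E3) = ξ := by
    rw [halfTurn_apply, real_inner_self_eq_norm_sq, norm_sph]
    norm_num [two_smul]
  conv_lhs => rw [← h]
  rw [← map_sub, LinearIsometryEquiv.norm_map]

/-- Near a boundary point, exactly one of `η` and its half-turn image belongs to the region, unless
`η` is very close to the tangent plane of the boundary. -/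
theorem exists_abs_inner_le_of_halfTurn {Γ : Set Sph} (hΓ : IsRegularRegion Γ) {ξ : Sph}
    (hξ : ξ ∈ frontier Γ) :
    ∃ (e : OrthonormalBasis (Fin 3) ℝ E3) (C : ℝ), e 2 = ξ ∧ 0 < C ∧
      ∀ η : Sph, (η ∈ Γ ↔ sphIso (halfTurn ξ) η ∈ Γ) →
        |inner ℝ (e 0) (η : E3)| ≤ C * ‖(ξ : E3) - η‖ ^ 2 := by
  obtain ⟨Φ, hom, hΦ⟩ := hΓ.exists_definesAt (coe_mem_cone.2 hξ)
  have hD := hΦ.self_of_nhds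
  obtain ⟨e, -, -, -, he2, he0, -⟩ := exists_graphChart hΓ.isOpen hom hξ hΦ
  obtain ⟨C, δ, hC, hδ, hT⟩ := exists_taylor_bound hD.contDiffAt
  have hw := norm_pos_iff.2 hD.gradient_ne
  obtain ⟨δ', hδ', hb⟩ := Metric.eventually_nhds_iff.1 hΦ
  have hm : 0 < min δ δ' := lt_min hδ hδ'
  refine ⟨e, ‖gradient Φ ξ‖⁻¹ * C + (min δ δ' ^ 2)⁻¹, he2, by positivity, fun η hη => ?_⟩
  rw [add_mul]
  by_cases hηδ : ‖(ξ : E3) - η‖ < min δ δ'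
  swap
  · have h1 := abs_real_inner_le_norm (e 0) (η : E3)
    rw [e.norm_eq_one, norm_sph, one_mul] at h1
    have h2 : 1 ≤ (min δ δ' ^ 2)⁻¹ * ‖(ξ : E3) - η‖ ^ 2 := by
      rw [le_inv_mul_iff₀ (by positivity), mul_one]
      exact pow_le_pow_left₀ hm.le (not_lt.1 hηδ) 2
    have h3 : 0 ≤ ‖gradient Φ ξ‖⁻¹ * C * ‖(ξ : E3) - η‖ ^ 2 := by positivity
    linarith
  refine le_add_of_le_of_nonneg ?_ (by positivity)
  -- Near ξ, Φ is ‖∇Φ(ξ)‖ times the `e 0` coordinate up to a quadratic error. The half-turn reverses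
  -- that coordinate and keeps the distance to ξ.
  have key : ∀ ζ : Sph, ‖(ξ : E3) - ζ‖ < min δ δ' → (ζ ∈ Γ ↔ Φ ζ < 0) ∧
      |Φ ζ - ‖gradient Φ ξ‖ * inner ℝ (e 0) (ζ : E3)| ≤ C * ‖(ξ : E3) - ζ‖ ^ 2 := by
    intro ζ hζ
    have h1 := hT ξ (Metric.mem_ball_self hδ) ζ (by
      rw [Metric.mem_ball, dist_comm, dist_eq_norm]; exact hζ.trans_le (min_le_left _ _))
    have h2 := hb (y := (ζ : E3)) (by
      rw [dist_comm, dist_eq_norm]; exact hζ.trans_le (min_le_right _ _))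
    refine ⟨by rw [← h2.mem_iff, coe_mem_cone], ?_⟩
    rw [(hD.mem_frontier_iff hΓ.isOpen).1 (coe_mem_cone.2 hξ), sub_zero, inner_sub_right,
      inner_gradient_self_of_homogeneous hom hD.differentiableAt, sub_zero, norm_sub_rev] at h1
    rwa [he0, inner_smul_left, conj_trivial] at h1
  obtain ⟨h1, h2⟩ := key η hηδ
  have hR : (sphIso (halfTurn ξ) η : E3) = halfTurn ξ η := rfl
  have hR0 : inner ℝ (e 0) (sphIso (halfTurn ξ) η : E3) = -inner ℝ (e 0) (η : E3) := by
    rw [hR, halfTurn_apply, ← he2, inner_sub_right, inner_smul_right, inner_basis]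
    simp
  obtain ⟨h3, h4⟩ := key (sphIso (halfTurn ξ) η) (by rwa [hR, norm_sub_halfTurn])
  rw [hR, norm_sub_halfTurn, ← hR, hR0] at h4
  rw [h1, h3] at hη
  rw [mul_assoc, le_inv_mul_iff₀ hw, ← abs_of_pos hw, ← abs_mul]
  rw [abs_le] at h2 h4 ⊢
  -- If the linear term exceeded the error, Φ would have opposite signs at η and at its image,
  -- contradicting that both or neither lie in Γ.
  constructor <;> by_contra! hcon
  · have h5 : Φ η < 0 := by linarith [h2.2]
    have h6 := hη.1 h5
    linarith [h4.1]
  · have h5 : Φ (sphIso (halfTurn ξ) η) < 0 := by linarith [h4.2]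
    have h6 := hη.2 h5
    linarith [h2.1]

/-! ### Divergence calculus and the regularised kernel. -/

lemma trc_sub (L M : E3 →L[ℝ] E3) : trc (L - M) = trc L - trc M := by
  simp [trc]

lemma trc_id : trc (ContinuousLinearMap.id ℝ E3) = 3 := by
  simp [trc]

lemma trc_smulRight (f : E3 →L[ℝ] ℝ) (v : E3) : trc (f.smulRight v) = f v := by
  rw [trc_eq_sum (EuclideanSpace.basisFun (Fin 3) ℝ)]
  conv_rhs => rw [← (EuclideanSpace.basisFun (Fin 3) ℝ).sum_repr' v]
  simp only [Fin.sum_univ_three, ContinuousLinearMap.smulRight_apply, inner_smul_right, map_add,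
    map_smul, smul_eq_mul]
  ring

/-- The product rule for the surface divergence. -/
lemma surfDiv_smul_field {Γ : Set Sph} (hΓ : IsRegularRegion Γ) {f : E3 → ℝ} {V : E3 → E3} {x : E3}
    (hx : x ∈ cone (closure Γ)) (hf : DifferentiableWithinAt ℝ f (cone (closure Γ)) x)
    (hV : DifferentiableWithinAt ℝ V (cone (closure Γ)) x) :
    surfDiv Γ (fun y => f y • V y) x =
      f x * surfDiv Γ V x + inner ℝ (gradientWithin f (cone (closure Γ)) x) (V x) := by
  have h := (hf.hasFDerivWithinAt.smul hV.hasFDerivWithinAt).fderivWithin (hΓ.uniqueDiffOn x hx)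
  have h2 : (fun y => f y • V y) = f • V := rfl
  rw [surfDiv, h2, h, trc_add, trc_smul, trc_smulRight, surfDiv, gradientWithin]
  simp

/-- The cosine of the angle between `ξ` and `x`. -/
def height (ξ : Sph) (x : E3) : ℝ := inner ℝ (ξ : E3) (proj x : E3)

lemma height_coe (ξ η : Sph) : height ξ η = inner ℝ (ξ : E3) (η : E3) := by
  rw [height, proj_coe]

lemma height_smul (ξ : Sph) {c : ℝ} (hc : 0 < c) (x : E3) : height ξ (c • x) = height ξ x := by
  rw [height, proj_smul hc, height]

lemma one_sub_height (ξ : Sph) (x : E3) : 1 - height ξ x = ‖(ξ : E3) - proj x‖ ^ 2 / 2 := by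
  rw [norm_sub_sq_real, norm_sph, norm_sph, height]
  ring

lemma height_le_one (ξ : Sph) (x : E3) : height ξ x ≤ 1 := by
  have := one_sub_height ξ x
  have : 0 ≤ ‖(ξ : E3) - proj x‖ ^ 2 / 2 := by positivity
  linarith

lemma contDiffAt_height (ξ : Sph) {x : E3} (hx : x ≠ 0) {n : ℕ} : ContDiffAt ℝ n (height ξ) x :=
  contDiffAt_const.inner ℝ ((contDiffAt_proj hx).of_le (by exact_mod_cast le_top))

lemma hasFDerivAt_norm_inv {x : E3} (hx : x ≠ 0) :
    HasFDerivAt (fun y : E3 => ‖y‖⁻¹) (-(‖x‖⁻¹ ^ 3) • innerSL ℝ x) x := by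
  have hn := norm_pos_iff.2 hx
  have h1 := (hasStrictFDerivAt_norm_sq x).hasFDerivAt.sqrt (by positivity)
  simp only [Real.sqrt_sq (norm_nonneg _)] at h1
  have h2 := (hasDerivAt_inv hn.ne').comp_hasFDerivAt x h1
  refine h2.congr_fderiv ?_
  ext y
  simp
  field_simp

/-- The gradient of the height function. -/
def heightGrad (ξ : Sph) (x : E3) : E3 :=
  ‖x‖⁻¹ • ((ξ : E3) - (height ξ x * ‖x‖⁻¹) • x)

lemma height_eq (ξ : Sph) {x : E3} (hx : x ≠ 0) :
    height ξ x = inner ℝ (ξ : E3) x * ‖x‖⁻¹ := by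
  rw [height, coe_proj hx, inner_smul_right, mul_comm]

lemma hasFDerivAt_height (ξ : Sph) {x : E3} (hx : x ≠ 0) :
    HasFDerivAt (height ξ) (innerSL ℝ (heightGrad ξ x)) x := by
  have h1 := ((innerSL ℝ (ξ : E3)).hasFDerivAt (x := x)).mul (hasFDerivAt_norm_inv hx)
  have h2 : height ξ =ᶠ[𝓝 x] fun y => innerSL ℝ (ξ : E3) y * ‖y‖⁻¹ := by
    filter_upwards [isOpen_ne.mem_nhds hx] with y hy using height_eq ξ hy
  refine (h1.congr_of_eventuallyEq h2).congr_fderiv ?_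
  ext y
  simp [heightGrad, height_eq ξ hx]
  ring

lemma inner_heightGrad_self (ξ : Sph) {x : E3} (hx : x ≠ 0) : inner ℝ x (heightGrad ξ x) = 0 := by
  have hn := norm_pos_iff.2 hx
  rw [heightGrad, inner_smul_right, inner_sub_right, inner_smul_right, real_inner_self_eq_norm_sq,
    height_eq ξ hx, real_inner_comm]
  field_simp
  ring

lemma heightGrad_coe (ξ η : Sph) :
    heightGrad ξ η = (ξ : E3) - (inner ℝ (ξ : E3) (η : E3)) • (η : E3) := by
  simp [heightGrad, height_coe]

/-- With t = ξ · η the squared norms are 1 - t² and 2(1 - t), and their difference is (1 - t)². -/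
lemma norm_heightGrad_coe (ξ η : Sph) : ‖heightGrad ξ η‖ ≤ ‖(ξ : E3) - η‖ := by
  have h1 := one_sub_height ξ η
  rw [proj_coe, height_coe] at h1
  refine (sq_le_sq₀ (norm_nonneg _) (norm_nonneg _)).1 ?_
  rw [heightGrad_coe, norm_sub_sq_real, norm_smul, norm_sph, norm_sph, inner_smul_right, mul_one,
    Real.norm_eq_abs, sq_abs]
  nlinarith [sq_nonneg (inner ℝ (ξ : E3) (η : E3) - 1)]

/-- The regularised kernel. -/
def greenReg (ξ : Sph) (ε : ℝ) (x : E3) : ℝ :=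
  1 / (4 * Real.pi) * Real.log (1 + ε - height ξ x) + 1 / (4 * Real.pi) * (1 - Real.log 2)

/-- The gradient of the regularised kernel. -/
def kernelField (ξ : Sph) (ε : ℝ) (x : E3) : E3 :=
  (-(4 * Real.pi * (1 + ε - height ξ x))⁻¹) • heightGrad ξ x

lemma hasFDerivAt_greenReg (ξ : Sph) {ε : ℝ} {x : E3} (hx : x ≠ 0) (hε : 0 < 1 + ε - height ξ x) :
    HasFDerivAt (greenReg ξ ε) (innerSL ℝ (kernelField ξ ε x)) x := by
  have h1 := (((hasFDerivAt_height ξ hx).const_sub (1 + ε)).log hε.ne').const_mul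
    (1 / (4 * Real.pi))
  refine (h1.add_const (1 / (4 * Real.pi) * (1 - Real.log 2))).congr_fderiv ?_
  ext y
  simp [kernelField]
  ring

lemma reg_pos (ξ : Sph) {ε : ℝ} (hε : 0 < ε) (x : E3) : 0 < 1 + ε - height ξ x := by
  linarith [height_le_one ξ x]

lemma contDiffAt_heightGrad (ξ : Sph) {x : E3} (hx : x ≠ 0) {n : ℕ} :
    ContDiffAt ℝ n (heightGrad ξ) x := by
  have h1 : ContDiffAt ℝ n (fun y : E3 => ‖y‖⁻¹) x :=
    (contDiffAt_norm ℝ hx).inv (norm_ne_zero_iff.2 hx)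
  exact h1.smul (contDiffAt_const.sub (((contDiffAt_height ξ hx).mul h1).smul contDiffAt_id))

lemma contDiffAt_kernelField (ξ : Sph) {ε : ℝ} {x : E3} (hx : x ≠ 0) (hε : 0 < 1 + ε - height ξ x)
    {n : ℕ} : ContDiffAt ℝ n (kernelField ξ ε) x := by
  have h1 : ContDiffAt ℝ n (fun y => 4 * Real.pi * (1 + ε - height ξ y)) x :=
    contDiffAt_const.mul (contDiffAt_const.sub (contDiffAt_height ξ hx))
  have h2 : 4 * Real.pi * (1 + ε - height ξ x) ≠ 0 := by
    have := Real.pi_pos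
    positivity
  exact (h1.inv h2).neg.smul (contDiffAt_heightGrad ξ hx)

lemma heightGrad_smul (ξ : Sph) {c : ℝ} (hc : 0 < c) (x : E3) :
    heightGrad ξ (c • x) = c⁻¹ • heightGrad ξ x := by
  rw [heightGrad, height_smul ξ hc, norm_smul, Real.norm_of_nonneg hc.le, heightGrad, smul_smul,
    smul_smul, mul_inv]
  congr 3
  field_simp

lemma kernelField_smul (ξ : Sph) (ε : ℝ) {c : ℝ} (hc : 0 < c) (x : E3) :
    kernelField ξ ε (c • x) = c⁻¹ • kernelField ξ ε x := by
  rw [kernelField, height_smul ξ hc, heightGrad_smul ξ hc, kernelField, smul_comm]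

lemma inner_kernelField_self (ξ : Sph) (ε : ℝ) {x : E3} (hx : x ≠ 0) :
    inner ℝ x (kernelField ξ ε x) = 0 := by
  rw [kernelField, inner_smul_right, inner_heightGrad_self ξ hx, mul_zero]

/-! ### The approximate identity and its mass in the region. -/

/-- The approximate identity. -/
def peak (ξ : Sph) (ε : ℝ) (η : Sph) : ℝ :=
  (2 * ε + ε ^ 2) / (4 * Real.pi * (1 + ε - inner ℝ (ξ : E3) (η : E3)) ^ 2)

/-- For a function f(t) of the height, Δ* is (1 - t²)f'' - 2t f'. For f = ln(1 + ε - t)/(4π) the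
numerator over 4π(1 + ε - t)² is 2t(1 + ε) - 1 - t² = (2ε + ε²) - (1 + ε - t)². -/
lemma surfDiv_kernelField {Γ : Set Sph} (hΓ : IsRegularRegion Γ) (ξ : Sph) {ε : ℝ} (hε : 0 < ε)
    {η : Sph} (hη : η ∈ closure Γ) :
    surfDiv Γ (kernelField ξ ε) η = peak ξ ε η - 1 / (4 * Real.pi) := by
  have hη0 := sph_ne_zero η
  have hpos := reg_pos ξ hε η
  have hpi := Real.pi_pos
  set τ := height ξ η with hτ
  have hτ' := hasFDerivAt_height ξ hη0
  have hn := hasFDerivAt_norm_inv hη0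
  have hden : HasFDerivAt (fun x => 4 * Real.pi * (1 + ε - height ξ x))
      ((4 * Real.pi) • -innerSL ℝ (heightGrad ξ η)) η :=
    (hτ'.const_sub (1 + ε)).const_mul (4 * Real.pi)
  have hinv := (hasDerivAt_inv (x := 4 * Real.pi * (1 + ε - τ))
    (by positivity)).comp_hasFDerivAt (η : E3) hden
  have hα := hinv.neg.mul hn
  have hβ := (hα.mul hτ').mul hn
  have hW := (hα.smul_const (ξ : E3)).sub (hβ.smul (hasFDerivAt_id (η : E3)))
  have heq : kernelField ξ ε = fun x => (-(4 * Real.pi * (1 + ε - height ξ x))⁻¹ * ‖x‖⁻¹) • (ξ : E3) -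
      ((-(4 * Real.pi * (1 + ε - height ξ x))⁻¹ * ‖x‖⁻¹) * height ξ x * ‖x‖⁻¹) • x := by
    funext x
    rw [kernelField, heightGrad, smul_smul, smul_sub, smul_smul, mul_assoc _ (height ξ x)]
  have hW' := hW.congr_of_eventuallyEq (f₁ := kernelField ξ ε)
    (Eventually.of_forall fun x => congrFun heq x)
  have h1 : inner ℝ (heightGrad ξ η) (ξ : E3) = 1 - τ ^ 2 := by
    rw [heightGrad_coe, inner_sub_left, inner_smul_left, real_inner_self_eq_norm_sq, norm_sph,
      conj_trivial, real_inner_comm (ξ : E3) η, hτ, height_coe]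
    ring
  have h2 : inner ℝ (heightGrad ξ η) (η : E3) = 0 := by
    rw [real_inner_comm, inner_heightGrad_self ξ hη0]
  have h3 : inner ℝ (η : E3) (ξ : E3) = τ := by rw [hτ, height_coe, real_inner_comm]
  rw [surfDiv, (hW'.hasFDerivWithinAt).fderivWithin (hΓ.uniqueDiffOn _ (coe_mem_cone.2 hη)),
    trc_sub, trc_smulRight, trc_add, trc_smul, trc_smulRight, trc_id, peak, ← height_coe, ← hτ]
  simp [h1, h2, h3, ← hτ]
  field_simp
  ring

lemma isRegularRegion_univ : IsRegularRegion univ :=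
  ⟨isOpen_univ, fun ξ hξ => by simp at hξ⟩

lemma isTangentialField_kernelField (Γ : Set Sph) (ξ : Sph) {ε : ℝ} (hε : 0 < ε) :
    IsTangentialField Γ (kernelField ξ ε) :=
  ⟨fun _ hx => (contDiffAt_kernelField ξ hx.1 (reg_pos ξ hε _) (n := 1)).contDiffWithinAt,
    fun x _ _ hc => kernelField_smul ξ ε hc x, fun _ hx => inner_kernelField_self ξ ε hx.1⟩

lemma reg_inner_pos (ξ : Sph) {ε : ℝ} (hε : 0 < ε) (η : Sph) :
    0 < 1 + ε - inner ℝ (ξ : E3) (η : E3) := by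
  rw [← height_coe]; exact reg_pos ξ hε η

lemma continuous_peak (ξ : Sph) {ε : ℝ} (hε : 0 < ε) : Continuous (peak ξ ε) := by
  have hpi := Real.pi_pos
  refine continuous_const.div (by fun_prop) fun η => ?_
  have := reg_inner_pos ξ hε η
  positivity

lemma peak_nonneg (ξ : Sph) {ε : ℝ} (hε : 0 < ε) (η : Sph) : 0 ≤ peak ξ ε η := by
  have hpi := Real.pi_pos
  have := reg_inner_pos ξ hε η
  rw [peak]
  positivity

lemma integrable_of_continuous {f : Sph → ℝ} (hf : Continuous f) : Integrable f surfMeasure := by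
  rw [← integrableOn_univ]
  exact hf.continuousOn.integrableOn_compact isCompact_univ

lemma measureReal_surfMeasure_univ : surfMeasure.real univ = 4 * Real.pi := by
  rw [measureReal_def, surfMeasure_univ, ENNReal.toReal_ofReal (by positivity)]

/-- The whole sphere is a regular region with empty boundary, so the divergence of `kernelField`
integrates to zero and the mass equals the integral of 1/(4π). -/
lemma integral_peak (ξ : Sph) {ε : ℝ} (hε : 0 < ε) : ∫ η, peak ξ ε η ∂surfMeasure = 1 := by
  have h := (isTangentialField_kernelField univ ξ hε).integral_surfDiv isRegularRegion_univ
  have h0 : lineMeasure univ = 0 := by simp [lineMeasure]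
  rw [h0, integral_zero_measure, Measure.restrict_univ,
    integral_congr_ae (Eventually.of_forall fun η =>
      surfDiv_kernelField isRegularRegion_univ ξ hε (η := η) (by simp)),
    integral_sub (integrable_of_continuous (continuous_peak ξ hε)) (integrable_const _),
    integral_const, measureReal_surfMeasure_univ, smul_eq_mul] at h
  have hpi := Real.pi_pos
  field_simp at h
  linarith

lemma one_sub_inner (ξ η : Sph) :
    1 - inner ℝ (ξ : E3) (η : E3) = ‖(ξ : E3) - η‖ ^ 2 / 2 := by
  have := one_sub_height ξ η
  rwa [proj_coe, height_coe] at this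

lemma tendsto_peak_bound (m : ℝ) :
    Tendsto (fun ε : ℝ => (2 * ε + ε ^ 2) / (4 * Real.pi * m ^ 2)) (𝓝[>] 0) (𝓝 0) := by
  have h : Continuous fun ε : ℝ => (2 * ε + ε ^ 2) / (4 * Real.pi * m ^ 2) := by fun_prop
  have := (h.tendsto 0).mono_left (nhdsWithin_le_nhds (s := Ioi 0))
  simpa using this

lemma peak_le (ξ : Sph) {ε m : ℝ} (hε : 0 < ε) (hm : 0 < m) {η : Sph}
    (h : m ≤ 1 - inner ℝ (ξ : E3) (η : E3)) :
    peak ξ ε η ≤ (2 * ε + ε ^ 2) / (4 * Real.pi * m ^ 2) := by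
  have hpi := Real.pi_pos
  rw [peak]
  gcongr
  linarith

/-- The regularised kernels form an approximate identity. -/
theorem tendsto_integral_peak_mul (ξ : Sph) {g : Sph → ℝ} {a : ℝ} (hg : Integrable g surfMeasure)
    (ha : Tendsto g (𝓝 ξ) (𝓝 a)) :
    Tendsto (fun ε => ∫ η, peak ξ ε η * g η ∂surfMeasure) (𝓝[>] 0) (𝓝 a) := by
  have hpos : ∀ᶠ ε : ℝ in 𝓝[>] 0, 0 < ε := self_mem_nhdsWithin
  have h := tendsto_setIntegral_peak_smul_of_integrableOn_of_tendsto (μ := surfMeasure) (x₀ := ξ)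
    (l := 𝓝[>] (0 : ℝ)) (φ := fun ε η => peak ξ ε η) (g := g) (a := a) MeasurableSet.univ
    MeasurableSet.univ (subset_univ _) univ_mem (measure_ne_top _ _) ?_ ?_ ?_ ?_ hg.integrableOn
    (by simpa using ha)
  · simpa using h
  · filter_upwards [hpos] with ε hε η _ using peak_nonneg ξ hε η
  · intro u hu hξu
    obtain ⟨δ, hδ, hball⟩ := Metric.mem_nhds_iff.1 (hu.mem_nhds hξu)
    have hm : 0 < δ ^ 2 / 2 := by positivity
    rw [Metric.tendstoUniformlyOn_iff]
    intro r hr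
    filter_upwards [hpos, (tendsto_peak_bound (δ ^ 2 / 2)).eventually (gt_mem_nhds hr)] with
      ε hε hεr η hη
    rw [Pi.zero_apply, dist_zero_left, Real.norm_of_nonneg (peak_nonneg ξ hε η)]
    refine (peak_le ξ hε hm ?_).trans_lt hεr
    rw [one_sub_inner]
    have h1 : δ ≤ ‖(ξ : E3) - η‖ := by
      by_contra! h2
      refine hη.2 (hball ?_)
      rwa [Metric.mem_ball, dist_comm, Subtype.dist_eq, dist_eq_norm]
    gcongr
  · refine tendsto_const_nhds.congr' ?_
    filter_upwards [hpos] with ε hε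
    rw [Measure.restrict_univ, integral_peak ξ hε]
  · filter_upwards [hpos] with ε hε
    exact (continuous_peak ξ hε).aestronglyMeasurable

lemma abs_inner_le_norm_sub {e : OrthonormalBasis (Fin 3) ℝ E3} {ξ : Sph} (he : e 2 = ξ)
    {i : Fin 3} (hi : i ≠ 2) (η : Sph) : |inner ℝ (e i) (η : E3)| ≤ ‖(ξ : E3) - η‖ := by
  have h1 := abs_real_inner_le_norm (e i) (e 2 - (η : E3))
  rwa [e.norm_eq_one, one_mul, inner_sub_right, inner_basis, if_neg hi, zero_sub, abs_neg, he] at h1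

/-- The reciprocal distance is integrable over the sphere. -/
theorem integrable_norm_sub_inv (ξ : Sph) :
    Integrable (fun η : Sph => ‖(ξ : E3) - η‖⁻¹) surfMeasure := by
  obtain ⟨e, he⟩ := exists_orthonormalBasis_two ξ
  have hdom := integrable_abs_rpow_mul_abs_rpow e (a := -(1 / 2)) (b := -(1 / 2)) (by norm_num)
    (by norm_num) (by norm_num) (by norm_num)
  refine hdom.mono' (by fun_prop) ?_
  filter_upwards [ae_inner_ne_zero (v := e 0) (e.orthonormal.ne_zero 0),
    ae_inner_ne_zero (v := e 1) (e.orthonormal.ne_zero 1)] with η h0 h1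
  have hx := abs_inner_le_norm_sub he (i := 0) (by decide) η
  have hy := abs_inner_le_norm_sub he (i := 1) (by decide) η
  have hx0 := abs_pos.2 h0
  have hy0 := abs_pos.2 h1
  have hd : 0 < ‖(ξ : E3) - η‖ := hx0.trans_le hx
  -- The exponent -1 is split evenly between the two tangential coordinates, each of which is at
  -- most the distance to ξ in absolute value.
  rw [Real.norm_of_nonneg (by positivity), ← Real.rpow_neg_one,
    show (-1 : ℝ) = -(1 / 2) + -(1 / 2) by norm_num, Real.rpow_add hd]
  exact mul_le_mul (Real.rpow_le_rpow_of_nonpos hx0 hx (by norm_num))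
    (Real.rpow_le_rpow_of_nonpos hy0 hy (by norm_num)) (by positivity) (by positivity)

/-- A bound independent of ε. It is not integrable over the sphere, and becomes useful only on the
thin set near a boundary point where the half-turn symmetry fails. -/
lemma peak_le_of_le_one (ξ : Sph) {ε : ℝ} (hε : 0 < ε) (hε1 : ε ≤ 1) {η : Sph}
    (h : 0 < ‖(ξ : E3) - η‖) : peak ξ ε η ≤ 3 / (2 * Real.pi) * (‖(ξ : E3) - η‖ ^ 2)⁻¹ := by
  have hpi := Real.pi_pos
  have h1 := one_sub_inner ξ η
  have h2 := reg_inner_pos ξ hε η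
  set d := ‖(ξ : E3) - η‖ ^ 2 with hd
  have hd0 : 0 < d := by positivity
  rw [peak, ← div_eq_mul_inv, div_div, div_le_div_iff₀ (by positivity) (by positivity),
    show 1 + ε - inner ℝ (ξ : E3) (η : E3) = d / 2 + ε by linarith]
  have h3 : (2 * ε + ε ^ 2) * d ≤ 3 * (2 * (d / 2 + ε) ^ 2) := by
    have h5 : 0 ≤ ε * (1 - ε) * d := mul_nonneg (mul_nonneg hε.le (by linarith)) hd0.le
    nlinarith [mul_pos hε hd0, sq_nonneg d, sq_nonneg ε]
  have h4 := mul_le_mul_of_nonneg_left h3 (by positivity : 0 ≤ 2 * Real.pi)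
  nlinarith

lemma peak_sphIso_halfTurn (ξ : Sph) (ε : ℝ) (η : Sph) :
    peak ξ ε (sphIso (halfTurn ξ) η) = peak ξ ε η := by
  rw [peak, show (sphIso (halfTurn ξ) η : E3) = halfTurn ξ η from rfl, inner_halfTurn, peak]

/-- Half of the mass of the approximate identity at a boundary point lies in the region. -/
theorem tendsto_setIntegral_peak_frontier {Γ : Set Sph} (hΓ : IsRegularRegion Γ) {ξ : Sph}
    (hξ : ξ ∈ frontier Γ) :
    Tendsto (fun ε => ∫ η in Γ, peak ξ ε η ∂surfMeasure) (𝓝[>] 0) (𝓝 (1 / 2)) := by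
  obtain ⟨e, C, he, hC, hΓC⟩ := exists_abs_inner_le_of_halfTurn hΓ hξ
  have hpi := Real.pi_pos
  have hmp := measurePreserving_sphIso (halfTurn ξ)
  set R := sphIso (halfTurn ξ) with hR
  set ψ₁ : Sph → ℝ := Γ.indicator 1 with hψ₁
  have hψm : Measurable ψ₁ := measurable_one.indicator hΓ.isOpen.measurableSet
  -- ψ measures how far Γ and its half-turn image fail to be complementary; it is nonzero only where
  -- |η · `e 0`| ≤ C|ξ - η|². By symmetry of `peak`, its integral against ψ is twice the mass in Γ
  -- minus 1.
  set ψ : Sph → ℝ := fun η => ψ₁ η + ψ₁ (R η) - 1 with hψ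
  have hψ0 : ∀ η, |ψ η| ≤ 1 ∧ (ψ η ≠ 0 → (η ∈ Γ ↔ R η ∈ Γ)) := by
    intro η
    by_cases h1 : η ∈ Γ <;> by_cases h2 : R η ∈ Γ <;> simp [hψ, hψ₁, h1, h2]
  have hpos : ∀ᶠ ε : ℝ in 𝓝[>] 0, ε ∈ Ioc (0 : ℝ) 1 := Ioc_mem_nhdsGT one_pos
  have hlim : Tendsto (fun ε => ∫ η, peak ξ ε η * ψ η ∂surfMeasure) (𝓝[>] 0) (𝓝 0) := by
    -- With d = |ξ - η|, the bound d⁻² is written as (d²)^(-3/4) · d^(-1/2). On the support of ψ the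
    -- first factor is controlled by |η · `e 0`|^(-3/4), the second by |η · `e 1`|^(-1/2); both
    -- exponents exceed -1.
    have hdom := (integrable_abs_rpow_mul_abs_rpow e (a := -(3 / 4)) (b := -(1 / 2)) (by norm_num)
      (by norm_num) (by norm_num) (by norm_num)).const_mul (3 / (2 * Real.pi) * C⁻¹ ^ (-(3 / 4) : ℝ))
    suffices h : Tendsto (fun ε => ∫ η, peak ξ ε η * ψ η ∂surfMeasure) (𝓝[>] 0)
        (𝓝 (∫ _ : Sph, 0 ∂surfMeasure)) by simpa using h
    refine tendsto_integral_filter_of_dominated_convergence _ ?_ ?_ hdom ?_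
    · filter_upwards [hpos] with ε hε
      refine ((continuous_peak ξ hε.1).measurable.mul ?_).aestronglyMeasurable
      exact (hψm.add (hψm.comp hmp.measurable)).sub_const 1
    · filter_upwards [hpos] with ε hε
      filter_upwards [ae_inner_ne_zero (v := e 0) (e.orthonormal.ne_zero 0),
        ae_inner_ne_zero (v := e 1) (e.orthonormal.ne_zero 1)] with η h0 h1
      by_cases hη : ψ η = 0
      · rw [hη, mul_zero, norm_zero]
        positivity
      have hx := hΓC η ((hψ0 η).2 hη)
      have hy := abs_inner_le_norm_sub he (i := 1) (by decide) η
      have hx0 := abs_pos.2 h0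
      have hy0 := abs_pos.2 h1
      have hd : 0 < ‖(ξ : E3) - η‖ := hy0.trans_le hy
      rw [norm_mul, Real.norm_of_nonneg (peak_nonneg ξ hε.1 η), Real.norm_eq_abs]
      have h2 := mul_le_mul (peak_le_of_le_one ξ hε.1 hε.2 hd) (hψ0 η).1 (abs_nonneg _)
        (by positivity)
      refine h2.trans ?_
      rw [mul_one, mul_assoc]
      refine mul_le_mul_of_nonneg_left ?_ (by positivity)
      rw [← mul_assoc, ← Real.mul_rpow (by positivity) hx0.le]
      have h3 : (‖(ξ : E3) - η‖ ^ 2)⁻¹ =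
          (‖(ξ : E3) - η‖ ^ 2) ^ (-(3 / 4) : ℝ) * ‖(ξ : E3) - η‖ ^ (-(1 / 2) : ℝ) := by
        rw [← Real.rpow_natCast, ← Real.rpow_mul hd.le, ← Real.rpow_add hd, ← Real.rpow_neg hd.le]
        norm_num
      rw [h3]
      refine mul_le_mul (Real.rpow_le_rpow_of_nonpos (by positivity) ?_ (by norm_num))
        (Real.rpow_le_rpow_of_nonpos hy0 hy (by norm_num)) (by positivity) (by positivity)
      rwa [inv_mul_le_iff₀ hC]
    · filter_upwards [ae_inner_ne_zero (v := e 0) (e.orthonormal.ne_zero 0)] with η h0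
      have hd : 0 < ‖(ξ : E3) - η‖ :=
        (abs_pos.2 h0).trans_le (abs_inner_le_norm_sub he (by decide) η)
      suffices h : Tendsto (fun ε => peak ξ ε η) (𝓝[>] 0) (𝓝 0) by simpa using h.mul_const (ψ η)
      refine tendsto_of_tendsto_of_tendsto_of_le_of_le' tendsto_const_nhds
        (tendsto_peak_bound (‖(ξ : E3) - η‖ ^ 2 / 2)) ?_ ?_
      · filter_upwards [hpos] with ε hε using peak_nonneg ξ hε.1 η
      · filter_upwards [hpos] with ε hε using
          peak_le ξ hε.1 (by positivity) (one_sub_inner ξ η).ge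
  have heq : ∀ᶠ ε : ℝ in 𝓝[>] 0, (∫ η, peak ξ ε η * ψ η ∂surfMeasure + 1) / 2 =
      ∫ η in Γ, peak ξ ε η ∂surfMeasure := by
    filter_upwards [hpos] with ε hε
    have hi := integrable_of_continuous (continuous_peak ξ hε.1)
    have h1 : Integrable (fun η => peak ξ ε η * ψ₁ η) surfMeasure := by
      refine hi.mul_bdd (c := 1) hψm.aestronglyMeasurable (Eventually.of_forall fun η => ?_)
      by_cases h1 : η ∈ Γ <;> simp [hψ₁, h1]
    have h2 : Integrable (fun η => peak ξ ε η * ψ₁ (R η)) surfMeasure := by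
      refine (hmp.integrable_comp_of_integrable h1).congr (Eventually.of_forall fun η => ?_)
      simp only [Function.comp, hR, peak_sphIso_halfTurn]
    have h3 : ∫ η, peak ξ ε η * ψ₁ η ∂surfMeasure = ∫ η in Γ, peak ξ ε η ∂surfMeasure := by
      rw [← integral_indicator hΓ.isOpen.measurableSet]
      refine integral_congr_ae (Eventually.of_forall fun η => ?_)
      by_cases h : η ∈ Γ <;> simp [hψ₁, h]
    have h4 : ∫ η, peak ξ ε η * ψ₁ (R η) ∂surfMeasure = ∫ η, peak ξ ε η * ψ₁ η ∂surfMeasure := by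
      have h5 := integral_map hmp.measurable.aemeasurable
        (f := fun η => peak ξ ε η * ψ₁ η) (by rw [hmp.map_eq]; exact h1.aestronglyMeasurable)
      rw [hmp.map_eq] at h5
      rw [h5]
      simp only [hR, peak_sphIso_halfTurn]
    have h6 : ∫ η, peak ξ ε η * ψ η ∂surfMeasure = ∫ η, peak ξ ε η * ψ₁ η ∂surfMeasure +
        ∫ η, peak ξ ε η * ψ₁ (R η) ∂surfMeasure - ∫ η, peak ξ ε η ∂surfMeasure := by
      rw [← integral_add h1 h2, ← integral_sub (h1.fun_add h2) hi]
      refine integral_congr_ae (Eventually.of_forall fun η => ?_)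
      simp only [hψ]
      ring
    rw [h6, h4, h3, integral_peak ξ hε.1]
    ring
  have := ((hlim.add_const 1).div_const 2).congr' heq
  simpa using this

lemma ClassC.continuousOn {k : ℕ} {S : Set Sph} {F : Sph → ℝ} (h : ClassC k S F) :
    ContinuousOn F S := by
  have h1 : ContinuousOn (fun η : Sph => radialExt F η) S :=
    (ContDiffOn.continuousOn h).comp continuous_subtype_val.continuousOn
      fun η hη => coe_mem_cone.2 hη
  simpa only [radialExt_coe] using h1

lemma integrableOn_of_continuousOn_closure {Γ : Set Sph} {f : Sph → ℝ}
    (hf : ContinuousOn f (closure Γ)) : IntegrableOn f Γ surfMeasure :=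
  (hf.integrableOn_compact isClosed_closure.isCompact).mono_set subset_closure

/-- The limit of the smoothed values of a continuous function on a regular region. -/
theorem tendsto_setIntegral_peak_mul {Γ : Set Sph} (hΓ : IsRegularRegion Γ) {F : Sph → ℝ}
    (hF : ContinuousOn F (closure Γ)) (ξ : Sph) :
    Tendsto (fun ε => ∫ η in Γ, peak ξ ε η * F η ∂surfMeasure) (𝓝[>] 0)
      (𝓝 (solidAngle Γ ξ / (2 * Real.pi) * F ξ)) := by
  have hpi := Real.pi_pos
  have hm := hΓ.isOpen.measurableSet
  have hFi : IntegrableOn F Γ surfMeasure := integrableOn_of_continuousOn_closure hF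
  have hind : ∀ c ε, ∫ η, peak ξ ε η * Γ.indicator (fun ζ => F ζ - c) η ∂surfMeasure =
      ∫ η in Γ, peak ξ ε η * (F η - c) ∂surfMeasure := by
    intro c ε
    rw [← integral_indicator hm]
    refine integral_congr_ae (Eventually.of_forall fun η => ?_)
    by_cases h : η ∈ Γ <;> simp [h]
  have hlim : ∀ c a, Tendsto (Γ.indicator fun ζ => F ζ - c) (𝓝 ξ) (𝓝 a) →
      Tendsto (fun ε => ∫ η in Γ, peak ξ ε η * (F η - c) ∂surfMeasure) (𝓝[>] 0) (𝓝 a) := by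
    intro c a h
    have h1 := tendsto_integral_peak_mul ξ
      ((integrable_indicator_iff hm).2 (hFi.sub (integrable_const c))) h
    refine h1.congr fun ε => ?_
    exact hind c ε
  by_cases hξΓ : ξ ∈ Γ
  · have h1 := hlim 0 (F ξ) (by
      have h2 : ContinuousAt F ξ := hF.continuousAt
        (mem_of_superset (hΓ.isOpen.mem_nhds hξΓ) subset_closure)
      refine h2.tendsto.congr' ?_
      filter_upwards [hΓ.isOpen.mem_nhds hξΓ] with η hη
      simp [hη])
    rw [solidAngle, if_pos hξΓ, div_self (by positivity), one_mul]
    simpa using h1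
  by_cases hξ : ξ ∈ frontier Γ
  -- F - F(ξ), cut off to Γ, tends to 0 at ξ although the indicator jumps. The constant F(ξ) is
  -- left, and it sees half the mass.
  · have h1 := hlim (F ξ) 0 (by
      have h2 := hF ξ (frontier_subset_closure hξ)
      rw [Metric.tendsto_nhds]
      intro r hr
      have h3 := eventually_nhdsWithin_iff.1 ((Metric.tendsto_nhds.1 h2) r hr)
      filter_upwards [h3] with η hη
      by_cases h : η ∈ Γ
      · simpa [h, Real.dist_eq] using hη (subset_closure h)
      · simpa [h] using hr)
    have h2 := h1.add ((tendsto_setIntegral_peak_frontier hΓ hξ).mul_const (F ξ))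
    rw [solidAngle, if_neg hξΓ, if_pos hξ]
    have h3 : Real.pi / (2 * Real.pi) * F ξ = 0 + 1 / 2 * F ξ := by field_simp; ring
    rw [h3]
    refine h2.congr' ?_
    filter_upwards [self_mem_nhdsWithin] with ε hε
    have hε' : 0 < ε := hε
    have hp := (continuous_peak ξ hε').continuousOn (s := closure Γ)
    have i1 : IntegrableOn (fun η => peak ξ ε η * (F η - F ξ)) Γ surfMeasure :=
      integrableOn_of_continuousOn_closure (hp.mul (hF.sub continuousOn_const))
    have i2 : IntegrableOn (fun η => peak ξ ε η * F ξ) Γ surfMeasure :=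
      integrableOn_of_continuousOn_closure (hp.mul continuousOn_const)
    rw [← integral_mul_const, ← integral_add i1 i2]
    refine integral_congr_ae (Eventually.of_forall fun η => ?_)
    simp only
    ring
  · have hcl : ξ ∉ closure Γ := fun h => hξ (by rw [hΓ.isOpen.frontier_eq]; exact ⟨h, hξΓ⟩)
    have h1 := hlim 0 0 (by
      refine tendsto_const_nhds.congr' ?_
      filter_upwards [isClosed_closure.isOpen_compl.mem_nhds hcl] with η hη
      have : η ∉ Γ := fun h => hη (subset_closure h)
      simp [this])
    rw [solidAngle, if_neg hξΓ, if_neg hξ, zero_div, zero_mul]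
    simpa using h1

/-! ### The representation formula with first derivatives. -/

lemma ClassC.continuousOn_gradientWithin {Γ : Set Sph} {F : Sph → ℝ}
    (hΓ : IsRegularRegion Γ) (h : ClassC 1 (closure Γ) F) :
    ContinuousOn (surfGrad (closure Γ) F) (closure Γ) := by
  have h1 := ContDiffOn.continuousOn_fderivWithin h hΓ.uniqueDiffOn (by norm_num)
  exact (InnerProductSpace.toDual ℝ E3).symm.continuous.comp_continuousOn
    (h1.comp continuous_subtype_val.continuousOn fun η hη => coe_mem_cone.2 hη)

lemma continuous_kernelField (ξ : Sph) {ε : ℝ} (hε : 0 < ε) :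
    Continuous fun η : Sph => kernelField ξ ε η :=
  continuous_iff_continuousAt.2 fun η => ContinuousAt.comp (g := kernelField ξ ε)
    (contDiffAt_kernelField ξ (sph_ne_zero η) (reg_pos ξ hε η) (n := 0)).continuousAt
    continuous_subtype_val.continuousAt

/-- Green's formula with the regularised kernel. -/
theorem setIntegral_peak_mul_eq {Γ : Set Sph} (hΓ : IsRegularRegion Γ) {F : Sph → ℝ}
    (hF : ClassC 1 (closure Γ) F) (ξ : Sph) {ε : ℝ} (hε : 0 < ε) :
    ∫ η in Γ, peak ξ ε η * F η ∂surfMeasure = 1 / (4 * Real.pi) * (∫ η in Γ, F η ∂surfMeasure)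
      - (∫ η in Γ, inner ℝ (kernelField ξ ε η) (surfGrad (closure Γ) F η) ∂surfMeasure)
      + ∫ η, F η * inner ℝ (outerNormal Γ η) (kernelField ξ ε η) ∂(lineMeasure Γ) := by
  have hV := isTangentialField_kernelField Γ ξ hε
  -- The divergence of F times the kernel gradient has three parts: `peak` times F, the correction
  -- -F/(4π), and the product of the two gradients.
  have hW : IsTangentialField Γ fun x => radialExt F x • kernelField ξ ε x := by
    refine ⟨?_, fun x hx c hc => ?_, fun x hx => ?_⟩
    · have h1 : ContDiffOn ℝ 1 (radialExt F) (cone (closure Γ)) := by exact_mod_cast hF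
      exact h1.smul hV.contDiffOn
    · rw [radialExt_smul F hc, hV.hom x hx c hc, smul_comm]
    · rw [inner_smul_right, hV.tangential x hx, mul_zero]
  have hdiv : ∀ η ∈ Γ, surfDiv Γ (fun x => radialExt F x • kernelField ξ ε x) (η : E3) =
      peak ξ ε η * F η - 1 / (4 * Real.pi) * F η +
        inner ℝ (kernelField ξ ε η) (surfGrad (closure Γ) F η) := by
    intro η hη
    have hη' := subset_closure hη
    have hmem : (η : E3) ∈ cone (closure Γ) := coe_mem_cone.2 hη'
    rw [surfDiv_smul_field hΓ hmem (ContDiffOn.differentiableOn hF (by norm_num) _ hmem)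
      (hV.contDiffOn.differentiableOn (by norm_num) _ hmem), surfDiv_kernelField hΓ ξ hε hη',
      radialExt_coe, real_inner_comm, ← surfGrad]
    ring
  have h := hW.integral_surfDiv hΓ
  have hFc := hF.continuousOn
  have i1 : IntegrableOn (fun η => peak ξ ε η * F η) Γ surfMeasure :=
    integrableOn_of_continuousOn_closure ((continuous_peak ξ hε).continuousOn.mul hFc)
  have i2 : IntegrableOn (fun η => 1 / (4 * Real.pi) * F η) Γ surfMeasure :=
    integrableOn_of_continuousOn_closure (continuousOn_const.mul hFc)
  have i3 : IntegrableOn (fun η : Sph => inner ℝ (kernelField ξ ε η) (surfGrad (closure Γ) F η)) Γ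
      surfMeasure := integrableOn_of_continuousOn_closure
    ((continuous_kernelField ξ hε).continuousOn.inner (hF.continuousOn_gradientWithin hΓ))
  rw [setIntegral_congr_fun hΓ.isOpen.measurableSet hdiv, integral_add (i1.fun_sub i2) i3,
    integral_sub i1 i2, integral_const_mul] at h
  simp only [radialExt_coe, inner_smul_right] at h
  linarith

lemma one_sub_inner_pos {ξ η : Sph} (h : η ≠ ξ) : 0 < 1 - inner ℝ (ξ : E3) (η : E3) := by
  rw [one_sub_inner]
  have : 0 < ‖(ξ : E3) - η‖ := norm_pos_iff.2 (sub_ne_zero.2 fun h1 => h (Subtype.ext h1.symm))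
  positivity

lemma hasFDerivAt_radialExt_greenAt {ξ η : Sph} (h : η ≠ ξ) :
    HasFDerivAt (radialExt (greenAt ξ)) (innerSL ℝ (kernelField ξ 0 η)) (η : E3) := by
  have h1 := hasFDerivAt_greenReg ξ (ε := 0) (sph_ne_zero η)
    (by rw [add_zero, height_coe]; exact one_sub_inner_pos h)
  refine h1.congr_of_eventuallyEq (Eventually.of_forall fun x => ?_)
  rw [radialExt, greenAt, fundSol, greenReg, height, add_zero]

/-- Away from ξ the singular kernel is the member ε = 0 of the regularised family, so limits and
bounds can be stated for one family. -/
lemma surfGrad_greenAt {ξ η : Sph} (h : η ≠ ξ) :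
    surfGrad univ (greenAt ξ) η = kernelField ξ 0 η := by
  have hmem : (η : E3) ∈ cone univ := coe_mem_cone.2 (mem_univ η)
  rw [surfGrad, gradientWithin, (hasFDerivAt_radialExt_greenAt h).hasFDerivWithinAt.fderivWithin
    ((isOpen_cone isOpen_univ).uniqueDiffWithinAt hmem), LinearIsometryEquiv.symm_apply_eq]
  rfl

lemma tendsto_kernelField {ξ η : Sph} (h : η ≠ ξ) :
    Tendsto (fun ε => kernelField ξ ε η) (𝓝[>] 0) (𝓝 (kernelField ξ 0 η)) := by
  have hpi := Real.pi_pos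
  have h1 := one_sub_inner_pos h
  have h2 : ContinuousAt (fun ε : ℝ => 4 * Real.pi * (1 + ε - height ξ η)) 0 := by fun_prop
  have h3 : 4 * Real.pi * (1 + 0 - height ξ η) ≠ 0 := by
    rw [add_zero, height_coe]
    positivity
  exact (((h2.inv₀ h3).neg.smul continuousAt_const).tendsto).mono_left nhdsWithin_le_nhds

lemma reg_inv_le {ξ η : Sph} (h : η ≠ ξ) {ε : ℝ} (hε : 0 ≤ ε) :
    |(4 * Real.pi * (1 + ε - height ξ η))⁻¹| ≤ (2 * Real.pi)⁻¹ * (‖(ξ : E3) - η‖ ^ 2)⁻¹ := by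
  have hpi := Real.pi_pos
  have h1 := one_sub_inner_pos h
  have h2 := one_sub_inner ξ η
  rw [height_coe]
  have h3 : 0 < 1 + ε - inner ℝ (ξ : E3) (η : E3) := by linarith
  have h4 : 0 < ‖(ξ : E3) - η‖ ^ 2 := by linarith
  rw [abs_of_pos (by positivity), ← mul_inv]
  refine inv_anti₀ (by positivity) ?_
  nlinarith

lemma norm_kernelField_le {ξ η : Sph} (h : η ≠ ξ) {ε : ℝ} (hε : 0 ≤ ε) :
    ‖kernelField ξ ε η‖ ≤ (2 * Real.pi)⁻¹ * ‖(ξ : E3) - η‖⁻¹ := by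
  have hd : 0 < ‖(ξ : E3) - η‖ := norm_pos_iff.2 (sub_ne_zero.2 fun h1 => h (Subtype.ext h1.symm))
  rw [kernelField, norm_smul, norm_neg, Real.norm_eq_abs]
  refine (mul_le_mul (reg_inv_le h hε) (norm_heightGrad_coe ξ η) (norm_nonneg _)
    (by positivity)).trans_eq ?_
  field_simp

/-- Since ν(η) is orthogonal to η, only ν · ξ survives; its quadratic smallness cancels the factor
|ξ - η|⁻² of the kernel, uniformly in ε. -/
lemma exists_abs_inner_kernelField_le {Γ : Set Sph} (hΓ : IsRegularRegion Γ) (ξ : Sph) :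
    ∃ C : ℝ, ∀ η ∈ frontier Γ, η ≠ ξ → ∀ ε : ℝ, 0 ≤ ε →
      |inner ℝ (outerNormal Γ η) (kernelField ξ ε η)| ≤ C := by
  obtain ⟨C, hC, h⟩ := exists_abs_inner_outerNormal_le hΓ ξ
  refine ⟨(2 * Real.pi)⁻¹ * C, fun η hη hne ε hε => ?_⟩
  have hd : 0 < ‖(ξ : E3) - η‖ := norm_pos_iff.2 (sub_ne_zero.2 fun h1 => hne (Subtype.ext h1.symm))
  rw [kernelField, inner_smul_right, heightGrad_coe, inner_sub_right, inner_smul_right,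
    (norm_outerNormal hΓ hη).2, mul_zero, sub_zero, abs_mul, abs_neg]
  refine (mul_le_mul (reg_inv_le hne hε) (h η hη) (abs_nonneg _) (by positivity)).trans_eq ?_
  field_simp

lemma measurable_kernelField (ξ : Sph) (ε : ℝ) : Measurable fun η : Sph => kernelField ξ ε η := by
  simp only [kernelField, height_coe, heightGrad_coe]
  fun_prop

lemma ae_ne_surfMeasure (ξ : Sph) : ∀ᵐ η ∂surfMeasure, η ≠ ξ := by
  obtain ⟨e, he⟩ := exists_orthonormalBasis_two ξ
  filter_upwards [ae_inner_ne_zero (v := e 0) (e.orthonormal.ne_zero 0)] with η h hη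
  rw [hη, ← he, inner_basis] at h
  simp at h

/-- The boundary term of Green's formula. -/
theorem tendsto_integral_inner_kernelField_line {Γ : Set Sph} (hΓ : IsRegularRegion Γ) {F : Sph → ℝ}
    (hF : ContinuousOn F (closure Γ)) (ξ : Sph) :
    Integrable (fun η => F η * normalDeriv Γ univ (greenAt ξ) η) (lineMeasure Γ) ∧
    Tendsto (fun ε => ∫ η, F η * inner ℝ (outerNormal Γ η) (kernelField ξ ε η) ∂(lineMeasure Γ))
      (𝓝[>] 0) (𝓝 (∫ η, F η * normalDeriv Γ univ (greenAt ξ) η ∂(lineMeasure Γ))) := by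
  have := isFiniteMeasure_lineMeasure hΓ
  obtain ⟨C, hC⟩ := exists_abs_inner_kernelField_le hΓ ξ
  have hFf := hF.mono frontier_subset_closure
  obtain ⟨M, hM⟩ := isClosed_frontier.isCompact.exists_bound_of_continuousOn hFf
  have hν : AEStronglyMeasurable (outerNormal Γ) (lineMeasure Γ) :=
    (continuousOn_outerNormal hΓ).aestronglyMeasurable isClosed_frontier.measurableSet
  have hmeas : ∀ ε, AEStronglyMeasurable
      (fun η : Sph => F η * inner ℝ (outerNormal Γ η) (kernelField ξ ε η)) (lineMeasure Γ) := fun ε =>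
    (aestronglyMeasurable_of_continuousOn_frontier hFf).mul
      (hν.inner (measurable_kernelField ξ ε).aestronglyMeasurable)
  have hbound : ∀ ε : ℝ, 0 ≤ ε → ∀ᵐ η ∂(lineMeasure Γ),
      ‖F η * inner ℝ (outerNormal Γ η) (kernelField ξ ε η)‖ ≤ M * C := by
    intro ε hε
    filter_upwards [ae_mem_frontier Γ, ae_ne_lineMeasure Γ ξ] with η hη hne
    rw [norm_mul, Real.norm_eq_abs (inner ℝ _ _)]
    exact mul_le_mul (hM η hη) (hC η hη hne ε hε) (abs_nonneg _) ((norm_nonneg _).trans (hM η hη))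
  have hae : (fun η : Sph => F η * inner ℝ (outerNormal Γ η) (kernelField ξ 0 η)) =ᵐ[lineMeasure Γ]
      fun η => F η * normalDeriv Γ univ (greenAt ξ) η := by
    filter_upwards [ae_ne_lineMeasure Γ ξ] with η hne
    rw [normalDeriv, surfGrad_greenAt hne]
  refine ⟨((integrable_const (M * C)).mono' (hmeas 0) (hbound 0 le_rfl)).congr hae, ?_⟩
  rw [← integral_congr_ae hae]
  refine tendsto_integral_filter_of_dominated_convergence (fun _ => M * C)
    (Eventually.of_forall hmeas) ?_ (integrable_const _) ?_
  · filter_upwards [self_mem_nhdsWithin] with ε hε using hbound ε (le_of_lt hε)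
  · filter_upwards [ae_ne_lineMeasure Γ ξ] with η hne
    exact (tendsto_const_nhds.inner (tendsto_kernelField hne)).const_mul _

/-- The interior term of Green's formula. -/
theorem tendsto_integral_inner_kernelField {Γ : Set Sph} (hΓ : IsRegularRegion Γ) {w : Sph → E3}
    (hw : ContinuousOn w (closure Γ)) (ξ : Sph) :
    IntegrableOn (fun η => inner ℝ (surfGrad univ (greenAt ξ) η) (w η)) Γ surfMeasure ∧
    Tendsto (fun ε => ∫ η in Γ, inner ℝ (kernelField ξ ε η) (w η) ∂surfMeasure) (𝓝[>] 0)
      (𝓝 (∫ η in Γ, inner ℝ (surfGrad univ (greenAt ξ) η) (w η) ∂surfMeasure)) := by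
  have hm := hΓ.isOpen.measurableSet
  obtain ⟨M, hM⟩ := isClosed_closure.isCompact.exists_bound_of_continuousOn hw
  have hmeas : ∀ ε, AEStronglyMeasurable (fun η : Sph => inner ℝ (kernelField ξ ε η) (w η))
      (surfMeasure.restrict Γ) := fun ε =>
    (measurable_kernelField ξ ε).aestronglyMeasurable.inner
      ((hw.mono subset_closure).aestronglyMeasurable hm)
  -- The same bound serves ε > 0 for domination and ε = 0 for integrability of the limit.
  have hbound : ∀ ε : ℝ, 0 ≤ ε → ∀ᵐ η : Sph ∂(surfMeasure.restrict Γ),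
      ‖inner ℝ (kernelField ξ ε η) (w η)‖ ≤ (2 * Real.pi)⁻¹ * ‖(ξ : E3) - η‖⁻¹ * M := by
    intro ε hε
    filter_upwards [ae_restrict_mem hm, ae_restrict_of_ae (ae_ne_surfMeasure ξ)] with η hη hne
    refine (norm_inner_le_norm _ _).trans ?_
    exact mul_le_mul (norm_kernelField_le hne hε) (hM η (subset_closure hη)) (norm_nonneg _)
      (by have := Real.pi_pos; positivity)
  have hdom : Integrable (fun η : Sph => (2 * Real.pi)⁻¹ * ‖(ξ : E3) - η‖⁻¹ * M)
      (surfMeasure.restrict Γ) := (((integrable_norm_sub_inv ξ).const_mul _).mul_const _).restrict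
  have hae : (fun η : Sph => inner ℝ (kernelField ξ 0 η) (w η)) =ᵐ[surfMeasure.restrict Γ]
      fun η => inner ℝ (surfGrad univ (greenAt ξ) η) (w η) := by
    filter_upwards [ae_restrict_of_ae (ae_ne_surfMeasure ξ)] with η hne
    rw [surfGrad_greenAt hne]
  refine ⟨(hdom.mono' (hmeas 0) (hbound 0 le_rfl)).congr hae, ?_⟩
  rw [← integral_congr_ae hae]
  refine tendsto_integral_filter_of_dominated_convergence _
    (Eventually.of_forall hmeas) ?_ hdom ?_
  · filter_upwards [self_mem_nhdsWithin] with ε hε using hbound ε (le_of_lt hε)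
  · filter_upwards [ae_restrict_of_ae (ae_ne_surfMeasure ξ)] with η hne
    exact (tendsto_kernelField hne).inner tendsto_const_nhds

/-- Green's representation formula with first derivatives. -/
theorem green_formula_grad {Γ : Set Sph} (hΓ : IsRegularRegion Γ) {F : Sph → ℝ}
    (hF : ClassC 1 (closure Γ) F) (ξ : Sph) :
    solidAngle Γ ξ / (2 * Real.pi) * F ξ =
      1 / (4 * Real.pi) * (∫ η in Γ, F η ∂surfMeasure)
      - (∫ η in Γ, inner ℝ (surfGrad univ (greenAt ξ) η) (surfGrad (closure Γ) F η) ∂surfMeasure)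
      + (∫ η, F η * normalDeriv Γ univ (greenAt ξ) η ∂(lineMeasure Γ)) := by
  have h1 := tendsto_setIntegral_peak_mul hΓ hF.continuousOn ξ
  have h2 := ((tendsto_const_nhds (x := 1 / (4 * Real.pi) * (∫ η in Γ, F η ∂surfMeasure))).sub
    (tendsto_integral_inner_kernelField hΓ (hF.continuousOn_gradientWithin hΓ) ξ).2).add
    (tendsto_integral_inner_kernelField_line hΓ hF.continuousOn ξ).2
  refine tendsto_nhds_unique (h1.congr' ?_) h2
  filter_upwards [self_mem_nhdsWithin] with ε hε using setIntegral_peak_mul_eq hΓ hF ξ hε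

/-- Lagrange's identity (η ∧ a) · (η ∧ b) = |η|² a · b - (η · a)(η · b). Tangency of one factor,
here the gradient of the kernel, removes the second term. -/
lemma inner_surfCurlGrad {ξ η : Sph} (h : η ≠ ξ) (S : Set Sph) (F : Sph → ℝ) :
    inner ℝ (surfCurlGrad univ (greenAt ξ) η) (surfCurlGrad S F η) =
      inner ℝ (surfGrad univ (greenAt ξ) η) (surfGrad S F η) := by
  have h1 : inner ℝ (η : E3) (surfGrad univ (greenAt ξ) η) = 0 := by
    rw [surfGrad_greenAt h, inner_kernelField_self ξ 0 (sph_ne_zero η)]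
  have h2 : inner ℝ (η : E3) (η : E3) = (1 : ℝ) := by
    rw [real_inner_self_eq_norm_sq, norm_sph, one_pow]
  rw [EuclideanSpace.inner_eq_star_dotProduct, star_trivial] at h1 h2
  rw [EuclideanSpace.inner_eq_star_dotProduct, EuclideanSpace.inner_eq_star_dotProduct,
    star_trivial, star_trivial, surfCurlGrad, surfCurlGrad, cross_dot_cross, h2,
    dotProduct_comm (WithLp.ofLp (η : E3)) (WithLp.ofLp (surfGrad univ (greenAt ξ) η)), h1]
  ring

/-! ### Green's first identity and the formula with the Beltrami operator. -/

lemma ClassC.of_two {S : Set Sph} {F : Sph → ℝ} (h : ClassC 2 S F) : ClassC 1 S F :=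
  ContDiffOn.of_le h (by norm_num)

/-- The gradient of the radially constant extension is a tangential field. -/
theorem ClassC.isTangentialField_gradientWithin {Γ : Set Sph} (hΓ : IsRegularRegion Γ) {F : Sph → ℝ}
    (hF : ClassC 2 (closure Γ) F) :
    IsTangentialField Γ (gradientWithin (radialExt F) (cone (closure Γ))) := by
  have hd : ∀ x ∈ cone (closure Γ), HasFDerivWithinAt (radialExt F)
      (fderivWithin ℝ (radialExt F) (cone (closure Γ)) x) (cone (closure Γ)) x := fun x hx =>
    (ContDiffOn.differentiableOn hF (by norm_num) x hx).hasFDerivWithinAt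
  refine ⟨?_, fun x hx c hc => ?_, fun x hx => ?_⟩
  · have h1 : ContDiffOn ℝ 1 (fderivWithin ℝ (radialExt F) (cone (closure Γ))) (cone (closure Γ)) :=
      ContDiffOn.fderivWithin hF hΓ.uniqueDiffOn (by norm_num)
    exact (InnerProductSpace.toDual ℝ E3).symm.contDiff.comp_contDiffOn h1
  · have h1 := HasFDerivWithinAt.smul_of_homogeneous (d := 1) hc
      (fun y _ => by rw [radialExt_smul F hc, one_smul]) hx (hd x hx)
    rw [gradientWithin, h1.fderivWithin (hΓ.uniqueDiffOn _ ((smul_mem_cone hc).2 hx)), one_mul,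
      gradientWithin]
    simp
  -- The ray through x stays in the cone, even at boundary points, and the extension is constant on
  -- it; hence the radial derivative is zero.
  · rw [real_inner_comm, gradientWithin, InnerProductSpace.toDual_symm_apply]
    have h1 : HasDerivWithinAt (fun t : ℝ => t • x) x (Ioi 0) 1 := by
      simpa using ((hasDerivAt_id (1 : ℝ)).smul_const x).hasDerivWithinAt
    have h2 : HasFDerivWithinAt (radialExt F)
        (fderivWithin ℝ (radialExt F) (cone (closure Γ)) x) (cone (closure Γ)) ((1 : ℝ) • x) := by
      rw [one_smul]; exact hd x hx
    have h3 := (h2.comp_hasDerivWithinAt (1 : ℝ) h1 fun t ht =>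
      (smul_mem_cone ht).2 hx).hasDerivAt (Ioi_mem_nhds one_pos)
    refine h3.unique ((hasDerivAt_const (1 : ℝ) (radialExt F x)).congr_of_eventuallyEq ?_)
    filter_upwards [Ioi_mem_nhds (one_pos : (0 : ℝ) < 1)] with t ht using radialExt_smul F ht x

/-- Both sides are the trace of the second derivative of the ray-constant extension, once covectors
are identified with vectors. -/
lemma ClassC.surfDiv_gradientWithin {Γ : Set Sph} (hΓ : IsRegularRegion Γ) {F : Sph → ℝ}
    {η : Sph} (hη : η ∈ closure Γ) :
    surfDiv Γ (gradientWithin (radialExt F) (cone (closure Γ))) η =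
      beltrami (closure Γ) F η := by
  have hmem : (η : E3) ∈ cone (closure Γ) := coe_mem_cone.2 hη
  have h1 : gradientWithin (radialExt F) (cone (closure Γ)) =
      (InnerProductSpace.toDual ℝ E3).symm ∘ fderivWithin ℝ (radialExt F) (cone (closure Γ)) := rfl
  rw [beltrami, laplacianWithin_eq_iteratedFDerivWithin_orthonormalBasis (radialExt F) hΓ.uniqueDiffOn
    hmem (EuclideanSpace.basisFun (Fin 3) ℝ), surfDiv,
    trc_eq_sum (EuclideanSpace.basisFun (Fin 3) ℝ), h1,
    LinearIsometryEquiv.comp_fderivWithin _ (hΓ.uniqueDiffOn _ hmem), Fin.sum_univ_three]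
  have h2 : ∀ (v : E3) (L : E3 →L[ℝ] E3 →L[ℝ] ℝ), 
      inner ℝ v ((InnerProductSpace.toDual ℝ E3).symm (L v)) = L v v := by
    intro v L
    rw [real_inner_comm]
    exact InnerProductSpace.toDual_symm_apply
  simp only [iteratedFDerivWithin_two_apply' _ hΓ.uniqueDiffOn hmem]
  exact congrArg₂ _ (congrArg₂ _ (h2 _ _) (h2 _ _)) (h2 _ _)

lemma contDiffAt_greenReg (ξ : Sph) {ε : ℝ} (hε : 0 < ε) {x : E3} (hx : x ≠ 0) {n : ℕ} :
    ContDiffAt ℝ n (greenReg ξ ε) x :=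
  (contDiffAt_const.mul ((contDiffAt_const.sub (contDiffAt_height ξ hx)).log
    (reg_pos ξ hε x).ne')).add contDiffAt_const

lemma greenReg_smul (ξ : Sph) (ε : ℝ) {c : ℝ} (hc : 0 < c) (x : E3) :
    greenReg ξ ε (c • x) = greenReg ξ ε x := by
  rw [greenReg, height_smul ξ hc, greenReg]

lemma greenReg_zero (ξ η : Sph) : greenReg ξ 0 η = greenAt ξ η := by
  rw [greenReg, greenAt, fundSol, add_zero, height_coe]

lemma continuous_greenReg (ξ : Sph) {ε : ℝ} (hε : 0 < ε) :
    Continuous fun η : Sph => greenReg ξ ε η :=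
  continuous_iff_continuousAt.2 fun η => ContinuousAt.comp (g := greenReg ξ ε)
    (contDiffAt_greenReg ξ hε (sph_ne_zero η) (n := 0)).continuousAt
    continuous_subtype_val.continuousAt

/-- Green's first identity with the regularised kernel. -/
theorem setIntegral_greenReg_mul_beltrami {Γ : Set Sph} (hΓ : IsRegularRegion Γ) {F : Sph → ℝ}
    (hF : ClassC 2 (closure Γ) F) (ξ : Sph) {ε : ℝ} (hε : 0 < ε) :
    (∫ η in Γ, greenReg ξ ε η * beltrami (closure Γ) F η ∂surfMeasure) +
        (∫ η in Γ, inner ℝ (kernelField ξ ε η) (surfGrad (closure Γ) F η) ∂surfMeasure) =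
      ∫ η, greenReg ξ ε η * normalDeriv Γ (closure Γ) F η ∂(lineMeasure Γ) := by
  have hV := hF.isTangentialField_gradientWithin hΓ
  set V := gradientWithin (radialExt F) (cone (closure Γ)) with hVdef
  have hG : ContDiffOn ℝ 1 (greenReg ξ ε) (cone (closure Γ)) := fun x hx =>
    (contDiffAt_greenReg ξ hε hx.1 (n := 1)).contDiffWithinAt
  -- The roles are exchanged: the kernel is now the scalar factor and the gradient of F the field,
  -- so its divergence produces Δ*F.
  have hW : IsTangentialField Γ fun x => greenReg ξ ε x • V x := by
    refine ⟨hG.smul hV.contDiffOn, fun x hx c hc => ?_, fun x hx => ?_⟩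
    · rw [greenReg_smul ξ ε hc, hV.hom x hx c hc, smul_comm]
    · rw [inner_smul_right, hV.tangential x hx, mul_zero]
  have hdiv : ∀ η ∈ Γ, surfDiv Γ (fun x => greenReg ξ ε x • V x) (η : E3) =
      greenReg ξ ε η * beltrami (closure Γ) F η +
        inner ℝ (kernelField ξ ε η) (surfGrad (closure Γ) F η) := by
    intro η hη
    have hη' := subset_closure hη
    have hmem : (η : E3) ∈ cone (closure Γ) := coe_mem_cone.2 hη'
    have h1 : gradientWithin (greenReg ξ ε) (cone (closure Γ)) (η : E3) = kernelField ξ ε η := by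
      rw [gradientWithin, (hasFDerivAt_greenReg ξ (sph_ne_zero η)
        (reg_pos ξ hε η)).hasFDerivWithinAt.fderivWithin (hΓ.uniqueDiffOn _ hmem),
        LinearIsometryEquiv.symm_apply_eq]
      rfl
    rw [surfDiv_smul_field hΓ hmem (hG.differentiableOn (by norm_num) _ hmem)
      (hV.contDiffOn.differentiableOn (by norm_num) _ hmem),
      ClassC.surfDiv_gradientWithin hΓ hη', h1]
    rfl
  have h := hW.integral_surfDiv hΓ
  have hB : ContinuousOn (beltrami (closure Γ) F) (closure Γ) :=
    (hV.continuousOn_surfDiv hΓ).congr fun η hη => (ClassC.surfDiv_gradientWithin hΓ hη).symm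
  have i1 : IntegrableOn (fun η : Sph => greenReg ξ ε η * beltrami (closure Γ) F η) Γ surfMeasure :=
    integrableOn_of_continuousOn_closure ((continuous_greenReg ξ hε).continuousOn.mul hB)
  have i3 : IntegrableOn (fun η : Sph => inner ℝ (kernelField ξ ε η) (surfGrad (closure Γ) F η)) Γ
      surfMeasure := integrableOn_of_continuousOn_closure
    ((continuous_kernelField ξ hε).continuousOn.inner (hF.of_two.continuousOn_gradientWithin hΓ))
  rw [setIntegral_congr_fun hΓ.isOpen.measurableSet hdiv, integral_add i1 i3] at h
  simp only [inner_smul_right] at h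
  exact h

/-- With d = |ξ - η|, from below ln(1 + ε - t) ≥ ln(1 - t) = 2 ln d - ln 2 and -ln d ≤ 2d^(-1/2);
from above ln x ≤ x - 1 ≤ 2 for x = 1 + ε - t ≤ 3. The exponent -1/2 is integrable both over the
sphere and along the boundary. -/
lemma abs_greenReg_le {ξ η : Sph} (h : η ≠ ξ) {ε : ℝ} (hε : 0 ≤ ε) (hε1 : ε ≤ 1) :
    |greenReg ξ ε η| ≤ 1 / (4 * Real.pi) * (4 * ‖(ξ : E3) - η‖ ^ (-(1 / 2) : ℝ) + 2) +
      |1 / (4 * Real.pi) * (1 - Real.log 2)| := by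
  have hpi := Real.pi_pos
  have hd : 0 < ‖(ξ : E3) - η‖ := norm_pos_iff.2 (sub_ne_zero.2 fun h1 => h (Subtype.ext h1.symm))
  have h1 := one_sub_inner_pos h
  have h2 := one_sub_inner ξ η
  have h3 : -1 ≤ inner ℝ (ξ : E3) (η : E3) := by
    have := abs_real_inner_le_norm (ξ : E3) (η : E3)
    rw [norm_sph, norm_sph, one_mul] at this
    exact (abs_le.1 this).1
  have h4 := Real.log_le_rpow_div (inv_nonneg.2 hd.le) (by norm_num : (0 : ℝ) < 1 / 2)
  rw [Real.log_inv, Real.inv_rpow hd.le, ← Real.rpow_neg hd.le] at h4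
  have h5 : Real.log (1 - inner ℝ (ξ : E3) (η : E3)) =
      2 * Real.log ‖(ξ : E3) - η‖ - Real.log 2 := by
    rw [h2, Real.log_div (by positivity) (by norm_num), Real.log_pow]
    norm_num
  have h6 : Real.log (1 - inner ℝ (ξ : E3) (η : E3)) ≤
      Real.log (1 + ε - inner ℝ (ξ : E3) (η : E3)) := Real.log_le_log h1 (by linarith)
  have h7 := Real.log_le_sub_one_of_pos (x := 1 + ε - inner ℝ (ξ : E3) (η : E3)) (by linarith)
  have h8 := Real.log_two_lt_d9
  have h9 : 0 ≤ ‖(ξ : E3) - η‖ ^ (-(1 / 2) : ℝ) := by positivity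
  rw [greenReg, height_coe]
  refine (abs_add_le _ _).trans (add_le_add_left ?_ _)
  rw [abs_mul, abs_of_pos (by positivity : 0 < 1 / (4 * Real.pi))]
  refine mul_le_mul_of_nonneg_left (abs_le.2 ⟨?_, ?_⟩) (by positivity) <;> linarith

lemma tendsto_greenReg {ξ η : Sph} (h : η ≠ ξ) :
    Tendsto (fun ε => greenReg ξ ε η) (𝓝[>] 0) (𝓝 (greenAt ξ η)) := by
  have h1 : ContinuousAt (fun ε : ℝ => 1 + ε - height ξ η) 0 := by fun_prop
  have h2 : 1 + 0 - height ξ η ≠ 0 := by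
    rw [add_zero, height_coe]
    exact (one_sub_inner_pos h).ne'
  rw [← greenReg_zero]
  exact (((h1.log h2).const_mul (1 / (4 * Real.pi))).add_const _).tendsto.mono_left
    nhdsWithin_le_nhds

lemma measurable_greenReg (ξ : Sph) (ε : ℝ) : Measurable fun η : Sph => greenReg ξ ε η := by
  simp only [greenReg, height_coe]
  fun_prop

/-- Removing the regularisation under an integral against the kernel. -/
theorem tendsto_integral_greenReg_mul {μ : Measure Sph} [IsFiniteMeasure μ] {ξ : Sph}
    (hμ : Integrable (fun η : Sph => ‖(ξ : E3) - η‖ ^ (-(1 / 2) : ℝ)) μ) (hne : ∀ᵐ η ∂μ, η ≠ ξ)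
    {w : Sph → ℝ} (hw : AEStronglyMeasurable w μ) {M : ℝ} (hM : ∀ᵐ η ∂μ, ‖w η‖ ≤ M) :
    Integrable (fun η => greenAt ξ η * w η) μ ∧
    Tendsto (fun ε => ∫ η, greenReg ξ ε η * w η ∂μ) (𝓝[>] 0)
      (𝓝 (∫ η, greenAt ξ η * w η ∂μ)) := by
  have hmeas : ∀ ε, AEStronglyMeasurable (fun η : Sph => greenReg ξ ε η * w η) μ := fun ε =>
    (measurable_greenReg ξ ε).aestronglyMeasurable.mul hw
  have hdom : Integrable (fun η : Sph =>
      (1 / (4 * Real.pi) * (4 * ‖(ξ : E3) - η‖ ^ (-(1 / 2) : ℝ) + 2) +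
        |1 / (4 * Real.pi) * (1 - Real.log 2)|) * M) μ :=
    ((((hμ.const_mul 4).add (integrable_const 2)).const_mul _).add (integrable_const _)).mul_const M
  have hbound : ∀ ε : ℝ, 0 ≤ ε → ε ≤ 1 → ∀ᵐ η : Sph ∂μ, ‖greenReg ξ ε η * w η‖ ≤
      (1 / (4 * Real.pi) * (4 * ‖(ξ : E3) - η‖ ^ (-(1 / 2) : ℝ) + 2) +
        |1 / (4 * Real.pi) * (1 - Real.log 2)|) * M := by
    intro ε hε hε1
    filter_upwards [hne, hM] with η hη hMη
    have h1 := abs_greenReg_le hη hε hε1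
    rw [norm_mul, Real.norm_eq_abs]
    exact mul_le_mul h1 hMη (norm_nonneg _) ((abs_nonneg _).trans h1)
  refine ⟨?_, ?_⟩
  · simpa only [greenReg_zero] using hdom.mono' (hmeas 0) (hbound 0 le_rfl zero_le_one)
  · refine tendsto_integral_filter_of_dominated_convergence _ (Eventually.of_forall hmeas) ?_ hdom ?_
    · filter_upwards [Ioc_mem_nhdsGT one_pos] with ε hε using hbound ε hε.1.le hε.2
    · filter_upwards [hne] with η hη using (tendsto_greenReg hη).mul_const _

lemma integrable_norm_sub_rpow_surfMeasure (ξ : Sph) :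
    Integrable (fun η : Sph => ‖(ξ : E3) - η‖ ^ (-(1 / 2) : ℝ)) surfMeasure := by
  have hm : Measurable fun η : Sph => ‖(ξ : E3) - η‖ ^ (-(1 / 2) : ℝ) := by fun_prop
  refine ((integrable_const (1 : ℝ)).add (integrable_norm_sub_inv ξ)).mono'
    hm.aestronglyMeasurable ?_
  filter_upwards with η
  -- The bound is d^(-1/2) ≤ 1 + d⁻¹. At d = 0 both powers take the default value 0.
  have h1 : ‖(ξ : E3) - η‖⁻¹ = ‖(ξ : E3) - η‖ ^ (-(1 / 2) : ℝ) * ‖(ξ : E3) - η‖ ^ (-(1 / 2) : ℝ) ∨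
      ‖(ξ : E3) - η‖ = 0 := by
    rcases (norm_nonneg ((ξ : E3) - η)).eq_or_lt with h | h
    · exact Or.inr h.symm
    · left
      rw [← Real.rpow_add h, ← Real.rpow_neg_one]
      norm_num
  rw [Real.norm_of_nonneg (by positivity), Pi.add_apply]
  rcases h1 with h1 | h1
  · rw [h1]
    nlinarith [sq_nonneg (‖(ξ : E3) - η‖ ^ (-(1 / 2) : ℝ) - 1)]
  · rw [h1, Real.zero_rpow (by norm_num)]
    norm_num

/-- Green's representation formula with second derivatives. -/
theorem green_formula_beltrami {Γ : Set Sph} (hΓ : IsRegularRegion Γ) {F : Sph → ℝ}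
    (hF : ClassC 2 (closure Γ) F) (ξ : Sph) :
    IntegrableOn (fun η => greenAt ξ η * beltrami (closure Γ) F η) Γ surfMeasure ∧
    Integrable (fun η => greenAt ξ η * normalDeriv Γ (closure Γ) F η) (lineMeasure Γ) ∧
    (∫ η in Γ, greenAt ξ η * beltrami (closure Γ) F η ∂surfMeasure) +
        (∫ η in Γ, inner ℝ (surfGrad univ (greenAt ξ) η) (surfGrad (closure Γ) F η) ∂surfMeasure) =
      ∫ η, greenAt ξ η * normalDeriv Γ (closure Γ) F η ∂(lineMeasure Γ) := by
  have hm := hΓ.isOpen.measurableSet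
  have := isFiniteMeasure_lineMeasure hΓ
  have hV := hF.isTangentialField_gradientWithin hΓ
  have hB : ContinuousOn (beltrami (closure Γ) F) (closure Γ) :=
    (hV.continuousOn_surfDiv hΓ).congr fun η hη => (ClassC.surfDiv_gradientWithin hΓ hη).symm
  have hN : ContinuousOn (normalDeriv Γ (closure Γ) F) (frontier Γ) :=
    hV.continuousOn_inner_outerNormal hΓ
  obtain ⟨M, hM⟩ := isClosed_closure.isCompact.exists_bound_of_continuousOn hB
  obtain ⟨M', hM'⟩ := isClosed_frontier.isCompact.exists_bound_of_continuousOn hN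
  -- Δ*F and the normal derivative are bounded by compactness, so the same limit argument serves the
  -- surface and the line measure.
  have h1 := tendsto_integral_greenReg_mul (μ := surfMeasure.restrict Γ)
    (integrable_norm_sub_rpow_surfMeasure ξ).restrict (ae_restrict_of_ae (ae_ne_surfMeasure ξ))
    ((hB.mono subset_closure).aestronglyMeasurable hm) (M := M)
    (by filter_upwards [ae_restrict_mem hm] with η hη using hM η (subset_closure hη))
  have h2 := tendsto_integral_greenReg_mul (μ := lineMeasure Γ)
    (integrable_norm_sub_rpow_lineMeasure hΓ ξ (by norm_num) (by norm_num)) (ae_ne_lineMeasure Γ ξ)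
    (aestronglyMeasurable_of_continuousOn_frontier hN) (M := M')
    (by filter_upwards [ae_mem_frontier Γ] with η hη using hM' η hη)
  refine ⟨h1.1, h2.1, ?_⟩
  have h3 := h1.2.add
    (tendsto_integral_inner_kernelField hΓ (hF.of_two.continuousOn_gradientWithin hΓ) ξ).2
  refine tendsto_nhds_unique (h3.congr' ?_) h2.2
  filter_upwards [self_mem_nhdsWithin] with ε hε using
    setIntegral_greenReg_mul_beltrami hΓ hF ξ hε

end SphericalGreen

end

theorem mainTheorem8 (Γ : Set Sph) (hΓ : IsRegularRegion Γ) (F : Sph → ℝ) :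
    (ClassC 2 (closure Γ) F → ∀ ξ : Sph,
      (IntegrableOn F Γ surfMeasure ∧
        IntegrableOn (fun η => greenAt ξ η * beltrami (closure Γ) F η) Γ surfMeasure ∧
        Integrable (fun η => F η * normalDeriv Γ univ (greenAt ξ) η) (lineMeasure Γ) ∧
        Integrable (fun η => greenAt ξ η * normalDeriv Γ (closure Γ) F η) (lineMeasure Γ)) ∧
      solidAngle Γ ξ / (2 * Real.pi) * F ξ =
        1 / (4 * Real.pi) * (∫ η in Γ, F η ∂surfMeasure)
        + (∫ η in Γ, greenAt ξ η * beltrami (closure Γ) F η ∂surfMeasure)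
        + (∫ η, F η * normalDeriv Γ univ (greenAt ξ) η ∂(lineMeasure Γ))
        - (∫ η, greenAt ξ η * normalDeriv Γ (closure Γ) F η ∂(lineMeasure Γ))) ∧
    (ClassC 1 (closure Γ) F → ∀ ξ : Sph,
      (IntegrableOn F Γ surfMeasure ∧
        IntegrableOn (fun η => inner ℝ (surfGrad univ (greenAt ξ) η)
          (surfGrad (closure Γ) F η)) Γ surfMeasure ∧
        IntegrableOn (fun η => inner ℝ (surfCurlGrad univ (greenAt ξ) η)
          (surfCurlGrad (closure Γ) F η)) Γ surfMeasure ∧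
        Integrable (fun η => F η * normalDeriv Γ univ (greenAt ξ) η) (lineMeasure Γ)) ∧
      solidAngle Γ ξ / (2 * Real.pi) * F ξ =
        1 / (4 * Real.pi) * (∫ η in Γ, F η ∂surfMeasure)
        - (∫ η in Γ, inner ℝ (surfGrad univ (greenAt ξ) η)
            (surfGrad (closure Γ) F η) ∂surfMeasure)
        + (∫ η, F η * normalDeriv Γ univ (greenAt ξ) η ∂(lineMeasure Γ)) ∧
      solidAngle Γ ξ / (2 * Real.pi) * F ξ =
        1 / (4 * Real.pi) * (∫ η in Γ, F η ∂surfMeasure)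
        - (∫ η in Γ, inner ℝ (surfCurlGrad univ (greenAt ξ) η)
            (surfCurlGrad (closure Γ) F η) ∂surfMeasure)
        + (∫ η, F η * normalDeriv Γ univ (greenAt ξ) η ∂(lineMeasure Γ))) := by
  refine ⟨fun hF ξ => ?_, fun hF ξ => ?_⟩
  · obtain ⟨h1, h2, h3⟩ := green_formula_beltrami hΓ hF ξ
    have hF1 := hF.of_two
    refine ⟨⟨integrableOn_of_continuousOn_closure hF.continuousOn, h1,
      (tendsto_integral_inner_kernelField_line hΓ hF.continuousOn ξ).1, h2⟩, ?_⟩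
    -- The gradient term of (b) is eliminated by the limiting form `h3` of Green's first identity.
    rw [green_formula_grad hΓ hF1 ξ]
    linarith
  · have h1 := (tendsto_integral_inner_kernelField hΓ (hF.continuousOn_gradientWithin hΓ) ξ).1
    -- The two integrands agree except possibly at η = ξ, a null set.
    have h2 : (fun η => inner ℝ (surfGrad univ (greenAt ξ) η) (surfGrad (closure Γ) F η))
        =ᵐ[surfMeasure.restrict Γ]
        fun η => inner ℝ (surfCurlGrad univ (greenAt ξ) η) (surfCurlGrad (closure Γ) F η) := by
      filter_upwards [ae_restrict_of_ae (ae_ne_surfMeasure ξ)] with η hη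
      rw [inner_surfCurlGrad hη]
    refine ⟨⟨integrableOn_of_continuousOn_closure hF.continuousOn, h1, h1.congr h2,
      (tendsto_integral_inner_kernelField_line hΓ hF.continuousOn ξ).1⟩,
      green_formula_grad hΓ hF ξ, ?_⟩
    rw [← integral_congr_ae h2]
    exact green_formula_grad hΓ hF ξ
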